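/- Let $d\ge 1$ and let $X\subset\mathbb{R}^d$ be a compact convex body (compact, convex, with nonempty interior) of Euclidean diameter $D$. Let $A(\theta)=\ln\int_X e^{\langle\theta,x\rangle}\,dx$ for $\theta\in\mathbb{R}^d$, and let $\psi(x)=\sup_{\theta\in\mathbb{R}^d}\{\langle\theta,x\rangle-A(\theta)\}\in(-\infty,+\infty]$ be the entropic barrier of $X$. All norms are Euclidean, and $D_g(x,y)=g(x)-g(y)-\langle\nabla g(y),x-y\rangle$. (1) $\psi$ is Legendre on $X$: it is convex on $X$, finite, differentiable and strictly convex on $\mathrm{int}(X)$, and $\|\nabla\psi(x)\|\to\infty$ as $x\in\mathrm{int}(X)$ tends to $\partial X$. It is $\frac1{D^2}$-strongly convex within $X$: $D_\psi(x,y)\ge\frac{1}{2D^2}\|x-y\|^2$ for all $x\in X$, $y\in\mathrm{int}(X)$. Its convex conjugate $\psi^*(w)=\sup_{x\in X}\{\langle w,x\rangle-\psi(x)\}$ is finite, three times differentiable on $\mathbb{R}^d$, and satisfies $|\nabla^3\psi^*(w)[h,h,h]|\le D^3$ for all $w\in\mathbb{R}^d$ and all unit vectors $h$. (2) There is an absolute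 constant $K>0$ such that the following holds for all $d\ge1$, all $X$ and $D$ as above, all $T\ge2$, and all $L>0$, $\beta\ge0$, $C\ge0$. Let $f_1,\dots,f_T:X\to\mathbb{R}$ be convex and three times differentiable with, for all $x,y\in X$ and $h\in\mathbb{R}^d$, $$\|\nabla f_t(x)\|\le L,\qquad D_{f_t}(x,y)\le\tfrac{\beta}{2}\|x-y\|^2,\qquad |\nabla^3f_t(x)[h,h,h]|\le 2C\big(\nabla^2f_t(x)[h,h]\big)^{3/2}.$$ Put $$\eta=\min\Big\{(d\ln T)^{\frac25}(CL^3D^3)^{-\frac25}T^{-\frac25},\ (d\ln T)^{\frac13}(L^3D^3+\beta L^2D^2)^{-\frac13}T^{-\frac13}\Big\},$$ where the first term is read as $+\infty$ if $C=0$. Then for every $t=1,\dots,T+1$ the minimizer $$x_t=\mathop{\mathrm{argmin}}_{x\in X}\ \sum_{\tau=1}^{t-1}f_\tau(x)+\frac1\eta\psi(x)$$ exists and is unique (the Follow-the-Regularized-Leader decisions), and the alternating regret satisfies $$\max_{u\in X}\Big[\sum_{t=1}^T\big(f_t(x_t)+f_t(x_{t+1})\big)-2\sum_{t=1}^Tf_t(u)\Big]\le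 K\max\Big\{(d\ln T)^{\frac35}(CL^3D^3)^{\frac25}T^{\frac25},\ (d\ln T)^{\frac23}(L^3D^3+\beta L^2D^2)^{\frac13}T^{\frac13}\Big\}.$$ -/

import Mathlib

noncomputable section

/-- The space `ℝ^d` with the Euclidean norm. -/
abbrev Euc (d : ℕ) : Type := EuclideanSpace ℝ (Fin d)

/-! ### Classes of functions on a set

Derivatives of a function on `s` are derivatives within `s`, so that only the values on `s` matter;
they are unambiguous on convex sets with nonempty interior, boundary points included. -/

/-- Bregman divergence `D_f(x, y) = f(x) - f(y) - ⟨∇f(y), x - y⟩` of `f : s → ℝ`. -/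
def bregman {d : ℕ} (s : Set (Euc d)) (f : Euc d → ℝ) (x y : Euc d) : ℝ :=
  f x - f y - inner ℝ (gradientWithin f s y) (x - y)

/-- `f` is three times differentiable on `s`: `f`, `∇f` and `∇²f` are differentiable on `s`. -/
def ThriceDifferentiableOn {d : ℕ} (s : Set (Euc d)) (f : Euc d → ℝ) : Prop :=
  ∀ k < 3, DifferentiableOn ℝ (iteratedFDerivWithin ℝ k f s) s

/-- `f` is differentiable with `‖∇f‖ ≤ L` on `s`. -/
def IsGradLipschitzOn {d : ℕ} (s : Set (Euc d)) (L : ℝ) (f : Euc d → ℝ) : Prop :=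
  DifferentiableOn ℝ f s ∧ ∀ x ∈ s, ‖gradientWithin f s x‖ ≤ L

/-- `f` is differentiable and `β`-smooth on `s`. -/
def IsSmoothOn {d : ℕ} (s : Set (Euc d)) (β : ℝ) (f : Euc d → ℝ) : Prop :=
  DifferentiableOn ℝ f s ∧ ∀ x ∈ s, ∀ y ∈ s, bregman s f x y ≤ β / 2 * ‖x - y‖ ^ 2

/-- `f` is `C`-self-concordant on `s`: `|∇³f(x)[h,h,h]| ≤ 2C (∇²f(x)[h,h])^{3/2}`. -/
def IsSelfConcordantOn {d : ℕ} (s : Set (Euc d)) (C : ℝ) (f : Euc d → ℝ) : Prop :=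
  ThriceDifferentiableOn s f ∧ ∀ x ∈ s, ∀ h : Euc d,
    |iteratedFDerivWithin ℝ 3 f s x (fun _ => h)| ≤
      2 * C * (iteratedFDerivWithin ℝ 2 f s x (fun _ => h)) ^ (3 / 2 : ℝ)

/-- `f` is `M`-smooth of order 3 on `s`. -/
def IsThirdOrderSmoothOn {d : ℕ} (s : Set (Euc d)) (M : ℝ) (f : Euc d → ℝ) : Prop :=
  ThriceDifferentiableOn s f ∧ ∀ w ∈ s, ∀ h : Euc d, ‖h‖ = 1 →
    |iteratedFDerivWithin ℝ 3 f s w (fun _ => h)| ≤ M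

/-- A loss function on `X`: convex, `L`-Lipschitz, `β`-smooth and `C`-self-concordant. -/
structure IsAdmissibleLoss {d : ℕ} (X : Set (Euc d)) (L β C : ℝ) (f : Euc d → ℝ) : Prop where
  convex : ConvexOn ℝ X f
  lipschitz : IsGradLipschitzOn X L f
  smooth : IsSmoothOn X β f
  selfConcordant : IsSelfConcordantOn X C f

/-! ### Regularizers

A regularizer on a convex body `X` may be `+∞` on the boundary, so it takes values in `EReal`.
On the interior it is finite, and there it is handled through its real part. -/

/-- Convex conjugate over `X`: `ψ*(w) = sup_{x ∈ X} ⟨w, x⟩ - ψ(x)`. -/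
def convexConjugate {d : ℕ} (X : Set (Euc d)) (ψ : Euc d → EReal) (w : Euc d) : EReal :=
  ⨆ x ∈ X, (((inner ℝ w x : ℝ) : EReal) - ψ x)

/-- `ψ` is a Legendre function on the convex body `X`. -/
structure IsLegendre {d : ℕ} (X : Set (Euc d)) (ψ : Euc d → EReal) : Prop where
  /-- convexity on `X`, through the epigraph -/
  convex : Convex ℝ {p : Euc d × ℝ | p.1 ∈ X ∧ ψ p.1 ≤ (p.2 : EReal)}
  ne_bot : ∀ x ∈ X, ψ x ≠ ⊥
  ne_top : ∀ x ∈ interior X, ψ x ≠ ⊤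
  differentiable : DifferentiableOn ℝ (fun x => (ψ x).toReal) (interior X)
  strictConvex : StrictConvexOn ℝ (interior X) (fun x => (ψ x).toReal)
  gradient_blowup : ∀ z ∈ frontier X,
    Filter.Tendsto (fun x => ‖gradientWithin (fun y => (ψ y).toReal) (interior X) x‖)
      (nhdsWithin z (interior X)) Filter.atTop

/-- `ψ` is `σ`-strongly convex within `X`, that is `D_ψ(x, y) ≥ (σ/2) ‖x - y‖²`, where the
base point `y` of the Bregman divergence is interior (so that `∇ψ(y)` makes sense) and `x` is any
point of `X` (with `ψ x = +∞` allowed). -/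
def IsStronglyConvexWithin {d : ℕ} (X : Set (Euc d)) (σ : ℝ) (ψ : Euc d → EReal) : Prop :=
  ∀ x ∈ X, ∀ y ∈ interior X,
    (((ψ y).toReal + inner ℝ (gradientWithin (fun z => (ψ z).toReal) (interior X) y) (x - y)
      + σ / 2 * ‖x - y‖ ^ 2 : ℝ) : EReal) ≤ ψ x

/-- The condition on the regularizer: Legendre and `σ`-strongly convex within `X`, with a (finite)
convex conjugate that is `M`-smooth of order 3 on the whole space. -/
structure IsAdmissibleRegularizer {d : ℕ} (X : Set (Euc d)) (σ M : ℝ) (ψ : Euc d → EReal) :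
    Prop where
  legendre : IsLegendre X ψ
  stronglyConvex : IsStronglyConvexWithin X σ ψ
  conjugate_finite : ∀ w, convexConjugate X ψ w ≠ ⊤ ∧ convexConjugate X ψ w ≠ ⊥
  conjugate_smooth :
    IsThirdOrderSmoothOn Set.univ M (fun w => (convexConjugate X ψ w).toReal)

/-- The log-partition function `θ ↦ log ∫_X exp⟨θ, x⟩ dx` of `X`. -/
def logPartition {d : ℕ} (X : Set (Euc d)) (θ : Euc d) : ℝ :=
  Real.log (∫ x in X, Real.exp (inner ℝ θ x))

/-- The entropic barrier of `X`: the Fenchel conjugate (over all of `ℝ^d`) of the log-partition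
function. It is `+∞` outside the interior of a convex body. -/
def entropicBarrier {d : ℕ} (X : Set (Euc d)) (x : Euc d) : EReal :=
  ⨆ θ : Euc d, ((inner ℝ θ x - logPartition X θ : ℝ) : EReal)

/-! ### The algorithm and its regret. Rounds are numbered `1, 2, …, T`. -/

/-- The objective `∑_{τ=1}^{t-1} f_τ(x) + ψ(x)/η` of round `t`. -/
def ftrlObjective {d : ℕ} (ψ : Euc d → EReal) (η : ℝ) (f : ℕ → Euc d → ℝ) (t : ℕ)
    (x : Euc d) : EReal :=
  ((∑ τ ∈ Finset.Ico 1 t, f τ x : ℝ) : EReal) + ((1 / η : ℝ) : EReal) * ψ x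

/-- `z` minimizes the objective of round `t` over `X`. -/
def IsFTRLPlay {d : ℕ} (X : Set (Euc d)) (ψ : Euc d → EReal) (η : ℝ) (f : ℕ → Euc d → ℝ)
    (t : ℕ) (z : Euc d) : Prop :=
  z ∈ X ∧ ∀ y ∈ X, ftrlObjective ψ η f t z ≤ ftrlObjective ψ η f t y

/-- Alternating regret against the comparator `u`. -/
def altRegret {d : ℕ} (f : ℕ → Euc d → ℝ) (x : ℕ → Euc d) (T : ℕ) (u : Euc d) : ℝ :=
  ∑ t ∈ Finset.Icc 1 T, (f t (x t) + f t (x (t + 1))) - 2 * ∑ t ∈ Finset.Icc 1 T, f t u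

/-- The learning rate
`min {(d ln T)^{2/5} (C L³ D³)^{-2/5} T^{-2/5}, (d ln T)^{1/3} (L³ D³ + β L² D²)^{-1/3} T^{-1/3}}`;
for `C = 0` the first term is `+∞`, so that the minimum is the second term. -/
def tunedRate (d T : ℕ) (L β C D : ℝ) : ℝ :=
  let a : ℝ := (d * Real.log T) ^ (2 / 5 : ℝ) * (C * L ^ 3 * D ^ 3) ^ (-(2 / 5) : ℝ)
    * (T : ℝ) ^ (-(2 / 5) : ℝ)
  let b : ℝ := (d * Real.log T) ^ (1 / 3 : ℝ)
    * (L ^ 3 * D ^ 3 + β * L ^ 2 * D ^ 2) ^ (-(1 / 3) : ℝ) * (T : ℝ) ^ (-(1 / 3) : ℝ)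
  if C = 0 then b else min a b

/-- `max {(d ln T)^{3/5} (C L³ D³)^{2/5} T^{2/5}, (d ln T)^{2/3} (L³ D³ + β L² D²)^{1/3} T^{1/3}}`. -/
def regretRate (d T : ℕ) (L β C D : ℝ) : ℝ :=
  max ((d * Real.log T) ^ (3 / 5 : ℝ) * (C * L ^ 3 * D ^ 3) ^ (2 / 5 : ℝ)
      * (T : ℝ) ^ (2 / 5 : ℝ))
    ((d * Real.log T) ^ (2 / 3 : ℝ)
      * (L ^ 3 * D ^ 3 + β * L ^ 2 * D ^ 2) ^ (1 / 3 : ℝ) * (T : ℝ) ^ (1 / 3 : ℝ))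

end

/-!
Write `A` for the log-partition function and `ψ` for the entropic barrier of the convex body `X`.
The derivatives of `A` at `θ` are the mean, the covariance and the third central moment of the
probability measure on `X` with density proportional to `exp ⟨θ, x⟩`. The mean lies in the interior
of `X`, and every interior point `x` is the mean for exactly one `θ = θ(x)`. Hence `∇ψ = θ(·)` is
the smooth inverse of `∇A` on the interior, `ψ = +∞` elsewhere, and the conjugate of `ψ` is `A`. The
bounds of the first part are the bounds on moments of variables with values in an interval of length
`D` (`IsConvexBody.isAdmissibleRegularizer_entropicBarrier`).

The second part also needs the self-concordance of `ψ` with an absolute constant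
(`IsConvexBody.abs_barrierThird_le`). It amounts to the reverse Hölder inequality
`E|Z|³ ≤ κ (E Z²)^{3/2}` for centred linear functionals, which follows from geometric decay of
log-concave tails (`integral_abs_pow_three_le`). That the tails are log-concave is the
Prékopa–Leindler inequality (`lintegral_mul_le_sq_euclidean`), needed at the midpoint only.

For the regret, let `Φ_t = ∑_{τ < t} f_τ + ψ/η` with minimizer `x_t`. The comparator is first moved
towards the centroid by a factor `1/T`, which costs `2LD` and makes its barrier value at most
`d ln T` above the minimum. What remains are the terms
`f_t(x_t) + f_t(x_{t+1}) + 2Φ_t(x_t) - 2Φ_{t+1}(x_{t+1})`. With `a` the restriction of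
`Φ_t + f_t/2` to the segment from `x_t` to `x_{t+1}`, such a term is `2(a(0) - a(1))`, while the
optimality conditions say that `a'(0) = φ'(0)/2` and `a'(1) = -φ'(1)/2` for the restriction `φ` of
`f_t`. The trapezoidal rule bounds the term by `(φ'(1) - φ'(0))/2` plus a multiple of `sup |a'''|`.
Self-concordance of `a` controls `a'''` by the local norm of the step, which is of order `√η D L`.
The second derivative of `φ` is bounded without using the smoothness constant `β`: by
self-concordance of `f_t` a large value would persist along the chord of `X`, whose length in the
local norm of `ψ` is bounded below (Dikin's ellipsoid, `IsConvexBody.add_smul_mem_interior`), and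
the slope would exceed the Lipschitz bound. Altogether a round contributes
`O(η² L³ D³ + C η^{3/2} L³ D³)` (`IsConvexBody.round_le`), and the learning rate balances the sum of
these contributions against `d ln T / η`.
-/

open MeasureTheory Set
open scoped ENNReal Pointwise

/-! ### The Prékopa–Leindler inequality -/

/-- Brunn–Minkowski for compact sets on the line: translates of `K` and `K'` inside `K + K'` meet in
at most one point. -/
theorem volume_add_volume_le_of_isCompact {K K' : Set ℝ} (hK : IsCompact K) (hK' : IsCompact K')
    (h0 : K.Nonempty) (h0' : K'.Nonempty) : volume K + volume K' ≤ volume (K + K') := by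
  obtain ⟨b, hbK, hb⟩ := hK.exists_isGreatest h0
  obtain ⟨a, haK, ha⟩ := hK'.exists_isLeast h0'
  have h1 : volume K = volume ((fun x => a + x) '' K) := by
    rw [image_add_left, measure_preimage_add]
  have h2 : volume K' = volume ((fun x => b + x) '' K') := by
    rw [image_add_left, measure_preimage_add]
  have hd : AEDisjoint volume ((fun x => a + x) '' K) ((fun x => b + x) '' K') := by
    refine measure_mono_null (t := {a + b}) ?_ (by simp)
    rintro _ ⟨⟨x, hx, rfl⟩, ⟨y, hy, hxy⟩⟩
    have h3 := hb hx
    have h4 := ha hy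
    simp only [mem_singleton_iff] at *
    linarith
  rw [h1, h2, ← measure_union₀ ((hK'.image (by fun_prop)).measurableSet.nullMeasurableSet) hd]
  refine measure_mono (union_subset ?_ ?_)
  · rintro _ ⟨x, hx, rfl⟩
    exact ⟨x, hx, a, haK, add_comm _ _⟩
  · rintro _ ⟨x, hx, rfl⟩
    exact ⟨b, hbK, x, hx, rfl⟩

/-- Brunn–Minkowski on the line. -/
theorem volume_add_volume_le {A B : Set ℝ} (hA : MeasurableSet A) (hB : MeasurableSet B)
    (h0 : A.Nonempty) (h0' : B.Nonempty) : volume A + volume B ≤ volume (A + B) := by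
  obtain ⟨a, ha⟩ := h0
  obtain ⟨b, hb⟩ := h0'
  have key : ∀ K ⊆ A, IsCompact K → ∀ K' ⊆ B, IsCompact K' →
      volume K + volume K' ≤ volume (A + B) := by
    intro K hKA hK K' hKB hK'
    calc volume K + volume K' ≤ volume (insert a K) + volume (insert b K') := by
          gcongr <;> exact subset_insert _ _
      _ ≤ volume (insert a K + insert b K') :=
          volume_add_volume_le_of_isCompact (hK.insert a) (hK'.insert b)
            (insert_nonempty _ _) (insert_nonempty _ _)
      _ ≤ volume (A + B) := measure_mono
          (add_subset_add (insert_subset ha hKA) (insert_subset hb hKB))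
  have sup : ∀ S : Set ℝ, MeasurableSet S →
      volume S = ⨆ K : {K : Set ℝ // K ⊆ S ∧ IsCompact K}, volume K.1 := by
    intro S hS
    rw [hS.measure_eq_iSup_isCompact, iSup_subtype]
    simp only [iSup_and]
  have : ∀ S : Set ℝ, Nonempty {K : Set ℝ // K ⊆ S ∧ IsCompact K} :=
    fun S => ⟨⟨∅, empty_subset _, isCompact_empty⟩⟩
  rw [sup A hA, sup B hB, ENNReal.iSup_add]
  refine iSup_le fun K => ?_
  rw [ENNReal.add_iSup]
  exact iSup_le fun K' => key _ K.2.1 K.2.2 _ K'.2.1 K'.2.2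

/-- One-dimensional Prékopa–Leindler inequality at the midpoint, for functions with supremum 1. -/
theorem lintegral_mul_le_sq_of_iSup_eq_one {f g h : ℝ → ℝ≥0∞} (hf : Measurable f)
    (hg : Measurable g) (hh : Measurable h) (hfs : ⨆ x, f x = 1) (hgs : ⨆ x, g x = 1)
    (H : ∀ x y, f x * g y ≤ h ((1 / 2 : ℝ) * (x + y)) ^ 2) :
    (∫⁻ x, f x) * ∫⁻ x, g x ≤ (∫⁻ x, h x) ^ 2 := by
  have layer : ∀ k : ℝ → ℝ≥0∞, Measurable k → (∀ x, k x ≤ 1) →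
      ∫⁻ x, k x = ∫⁻ t in Ioo (0 : ℝ) 1, volume {x | ENNReal.ofReal t < k x} := by
    intro k hk hk1
    have h1 : ∀ x, k x = ENNReal.ofReal (k x).toReal := fun x =>
      (ENNReal.ofReal_toReal ((hk1 x).trans_lt ENNReal.one_lt_top).ne).symm
    have h2 := lintegral_eq_lintegral_meas_lt volume (f := fun x => (k x).toReal)
      (Filter.Eventually.of_forall fun x => ENNReal.toReal_nonneg) hk.ennreal_toReal.aemeasurable
    simp only [← h1] at h2
    rw [h2, ← lintegral_indicator measurableSet_Ioi, ← lintegral_indicator measurableSet_Ioo]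
    congr 1
    ext t
    by_cases ht : 0 < t
    · by_cases ht1 : t < 1
      · rw [indicator_of_mem (by exact ht), indicator_of_mem (by exact ⟨ht, ht1⟩)]
        congr 1
        ext x
        simp only [mem_ofPred_eq]
        rw [ENNReal.ofReal_lt_iff_lt_toReal ht.le ((hk1 x).trans_lt ENNReal.one_lt_top).ne]
      · rw [indicator_of_mem (by exact ht), indicator_of_notMem (by simp [ht1])]
        rw [measure_eq_zero_iff_ae_notMem]
        refine Filter.Eventually.of_forall fun x hx => ht1 (lt_of_lt_of_le hx ?_)
        exact ENNReal.toReal_le_of_le_ofReal zero_le_one (by simpa using hk1 x)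
    · rw [indicator_of_notMem (by exact ht), indicator_of_notMem (by simp [ht])]
  have hf1 : ∀ x, f x ≤ 1 := fun x => hfs ▸ le_iSup f x
  have hg1 : ∀ x, g x ≤ 1 := fun x => hgs ▸ le_iSup g x
  -- `h` is cut off at `1` so that `layer` applies to it
  have level : ∀ t ∈ Ioo (0 : ℝ) 1, (volume {x | ENNReal.ofReal t < f x}
      + volume {x | ENNReal.ofReal t < g x})
      ≤ 2 * volume {x | ENNReal.ofReal t < min (h x) 1} := by
    intro t ht
    have ht1 : ENNReal.ofReal t < 1 := by simpa using ht.2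
    have hne : {x | ENNReal.ofReal t < f x}.Nonempty := by
      rw [← hfs] at ht1
      exact lt_iSup_iff.1 ht1
    have hne' : {x | ENNReal.ofReal t < g x}.Nonempty := by
      rw [← hgs] at ht1
      exact lt_iSup_iff.1 ht1
    have h1 := volume_add_volume_le (measurableSet_lt measurable_const hf)
      (measurableSet_lt measurable_const hg) hne hne'
    have h2 : volume ((1 / 2 : ℝ) • ({x | ENNReal.ofReal t < f x} + {x | ENNReal.ofReal t < g x}))
        = ENNReal.ofReal (1 / 2) * volume ({x | ENNReal.ofReal t < f x}
          + {x | ENNReal.ofReal t < g x}) := by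
      rw [Measure.addHaar_smul]
      simp
    have h3 : (1 / 2 : ℝ) • ({x | ENNReal.ofReal t < f x} + {x | ENNReal.ofReal t < g x})
        ⊆ {x | ENNReal.ofReal t < min (h x) 1} := by
      rintro _ ⟨_, ⟨x, hx, y, hy, rfl⟩, rfl⟩
      refine lt_min ?_ ht1
      have h4 : ENNReal.ofReal t ^ 2 < h ((1 / 2 : ℝ) * (x + y)) ^ 2 := by
        refine lt_of_lt_of_le ?_ (H x y)
        rw [sq]
        exact ENNReal.mul_lt_mul hx hy
      exact lt_of_not_ge fun h => absurd h4 (not_lt.2 (pow_le_pow_left' h 2))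
    calc _ ≤ _ := h1
      _ = 2 * (ENNReal.ofReal (1 / 2) * volume ({x | ENNReal.ofReal t < f x}
          + {x | ENNReal.ofReal t < g x})) := by
          rw [← mul_assoc, ← ENNReal.ofReal_ofNat, ← ENNReal.ofReal_mul (by norm_num)]
          norm_num
      _ ≤ _ := by
          rw [← h2]
          gcongr
  have sum : (∫⁻ x, f x) + ∫⁻ x, g x ≤ 2 * ∫⁻ x, h x := by
    calc (∫⁻ x, f x) + ∫⁻ x, g x
        ≤ ∫⁻ t in Ioo (0 : ℝ) 1, (volume {x | ENNReal.ofReal t < f x}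
          + volume {x | ENNReal.ofReal t < g x}) := by
          rw [layer f hf hf1, layer g hg hg1]
          exact le_lintegral_add _ _
      _ ≤ ∫⁻ t in Ioo (0 : ℝ) 1, 2 * volume {x | ENNReal.ofReal t < min (h x) 1} :=
          setLIntegral_mono' measurableSet_Ioo level
      _ = 2 * ∫⁻ x, min (h x) 1 := by
          rw [lintegral_const_mul' _ _ (by simp), layer _ (hh.min measurable_const)
            (fun x => min_le_right _ _)]
      _ ≤ 2 * ∫⁻ x, h x := by
          gcongr
          exact min_le_left _ _
  -- arithmetic–geometric mean
  rcases eq_or_ne (∫⁻ x, h x) ∞ with htop | htop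
  · simp [htop]
  have h2t : 2 * ∫⁻ x, h x ≠ ∞ := ENNReal.mul_ne_top (by simp) htop
  have hF : ∫⁻ x, f x ≠ ∞ := ne_top_of_le_ne_top h2t (le_self_add.trans sum)
  have hG : ∫⁻ x, g x ≠ ∞ := ne_top_of_le_ne_top h2t (le_add_self.trans sum)
  rw [← ENNReal.toReal_le_toReal (ENNReal.mul_ne_top hF hG) (ENNReal.pow_ne_top htop),
    ENNReal.toReal_mul, ENNReal.toReal_pow]
  have h5 := (ENNReal.toReal_le_toReal (ENNReal.add_ne_top.2 ⟨hF, hG⟩) h2t).2 sum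
  rw [ENNReal.toReal_add hF hG, ENNReal.toReal_mul, ENNReal.toReal_ofNat] at h5
  have h6 : 0 ≤ (∫⁻ x, f x).toReal := ENNReal.toReal_nonneg
  have h7 : 0 ≤ (∫⁻ x, g x).toReal := ENNReal.toReal_nonneg
  nlinarith [sq_nonneg ((∫⁻ x, f x).toReal - (∫⁻ x, g x).toReal)]

/-- The supremum of each function is normalised to `1`, which leaves the hypothesis and the
conclusion homogeneous. -/
theorem lintegral_mul_le_sq_of_le_const {f g h : ℝ → ℝ≥0∞} (hf : Measurable f)
    (hg : Measurable g) (hh : Measurable h) {N : ℝ≥0∞} (hN : N ≠ ∞) (hfN : ∀ x, f x ≤ N)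
    (hgN : ∀ x, g x ≤ N) (H : ∀ x y, f x * g y ≤ h ((1 / 2 : ℝ) * (x + y)) ^ 2) :
    (∫⁻ x, f x) * ∫⁻ x, g x ≤ (∫⁻ x, h x) ^ 2 := by
  set a := ⨆ x, f x with ha
  set b := ⨆ x, g x with hb
  have haN : a ≠ ∞ := ne_top_of_le_ne_top hN (iSup_le hfN)
  have hbN : b ≠ ∞ := ne_top_of_le_ne_top hN (iSup_le hgN)
  rcases eq_or_ne a 0 with h0 | h0
  · have : ∀ x, f x = 0 := fun x => le_antisymm (h0 ▸ le_iSup f x) zero_le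
    simp [this]
  rcases eq_or_ne b 0 with h0' | h0'
  · have : ∀ x, g x = 0 := fun x => le_antisymm (h0' ▸ le_iSup g x) zero_le
    simp [this]
  set c := (a * b) ^ (1 / 2 : ℝ) with hc
  have hc2 : c ^ 2 = a * b := by
    rw [hc, ← ENNReal.rpow_natCast, ← ENNReal.rpow_mul]
    norm_num
  have hcs : (c⁻¹) ^ 2 = a⁻¹ * b⁻¹ := by
    rw [← ENNReal.inv_pow, hc2, ENNReal.mul_inv (Or.inl h0) (Or.inl haN)]
  have key := lintegral_mul_le_sq_of_iSup_eq_one (f := fun x => a⁻¹ * f x)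
    (g := fun x => b⁻¹ * g x) (h := fun x => c⁻¹ * h x) (hf.const_mul _) (hg.const_mul _)
    (hh.const_mul _)
    (by rw [← ENNReal.mul_iSup, ← ha, ENNReal.inv_mul_cancel h0 haN])
    (by rw [← ENNReal.mul_iSup, ← hb, ENNReal.inv_mul_cancel h0' hbN])
    (fun x y => by
      rw [mul_pow, hcs, mul_mul_mul_comm]
      gcongr
      exact H x y)
  rw [lintegral_const_mul _ hf, lintegral_const_mul _ hg, lintegral_const_mul _ hh, mul_pow, hcs,
    mul_mul_mul_comm] at key
  have h8 : a⁻¹ * b⁻¹ ≠ 0 := mul_ne_zero (by simpa using haN) (by simpa using hbN)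
  have h9 : a⁻¹ * b⁻¹ ≠ ∞ := ENNReal.mul_ne_top (by simpa using h0) (by simpa using h0')
  exact (ENNReal.mul_le_mul_iff_right h8 h9).1 key

/-- Prékopa–Leindler inequality on the line at the midpoint. -/
theorem lintegral_mul_le_sq_real {f g h : ℝ → ℝ≥0∞} (hf : Measurable f)
    (hg : Measurable g) (hh : Measurable h)
    (H : ∀ x y, f x * g y ≤ h ((1 / 2 : ℝ) * (x + y)) ^ 2) :
    (∫⁻ x, f x) * ∫⁻ x, g x ≤ (∫⁻ x, h x) ^ 2 := by
  have trunc : ∀ k : ℝ → ℝ≥0∞, Measurable k →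
      Filter.Tendsto (fun n : ℕ => ∫⁻ x, min (k x) n) Filter.atTop (nhds (∫⁻ x, k x)) := by
    intro k hk
    refine lintegral_tendsto_of_tendsto_of_monotone
      (fun n => (hk.min measurable_const).aemeasurable) ?_ ?_
    · exact Filter.Eventually.of_forall fun x m n hmn => by
        dsimp only
        gcongr
    · refine Filter.Eventually.of_forall fun x => ?_
      have := (tendsto_const_nhds (x := k x) (f := Filter.atTop (α := ℕ))).min
        ENNReal.tendsto_nat_nhds_top
      simpa using this
  have hn : ∀ n : ℕ, (∫⁻ x, min (f x) n) * ∫⁻ x, min (g x) n ≤ (∫⁻ x, h x) ^ 2 := by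
    intro n
    refine lintegral_mul_le_sq_of_le_const (N := n) (hf.min measurable_const)
      (hg.min measurable_const) hh (by simp) (fun x => min_le_right _ _)
      (fun x => min_le_right _ _) fun x y => ?_
    exact (mul_le_mul' (min_le_left _ _) (min_le_left _ _)).trans (H x y)
  rcases eq_or_ne (∫⁻ x, f x) 0 with h0 | h0
  · simp [h0]
  rcases eq_or_ne (∫⁻ x, g x) 0 with h0' | h0'
  · simp [h0']
  exact le_of_tendsto' (ENNReal.Tendsto.mul (trunc f hf) (Or.inl h0) (trunc g hg) (Or.inl h0')) hn

/-- Prékopa–Leindler inequality at the midpoint in `ℝ^n`, by induction on the dimension: the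
integrals over the slices `x 0 = s` satisfy the hypothesis of the one-dimensional inequality. -/
theorem lintegral_mul_le_sq_pi (n : ℕ) : ∀ {f g h : (Fin n → ℝ) → ℝ≥0∞}, Measurable f →
    Measurable g → Measurable h → (∀ x y, f x * g y ≤ h ((1 / 2 : ℝ) • (x + y)) ^ 2) →
    (∫⁻ x, f x) * ∫⁻ x, g x ≤ (∫⁻ x, h x) ^ 2 := by
  induction n with
  | zero =>
    intro f g h hf hg hh H
    have h1 : ∀ k : (Fin 0 → ℝ) → ℝ≥0∞, ∫⁻ x, k x = k 0 := by
      intro k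
      rw [lintegral_unique, volume_pi, Measure.pi_of_empty (x := default)]
      simpa using congrArg k (Subsingleton.elim _ _)
    rw [h1, h1, h1]
    simpa using H 0 0
  | succ n ih =>
    intro f g h hf hg hh H
    let e := MeasurableEquiv.piFinSuccAbove (fun _ : Fin (n + 1) => ℝ) 0
    have he : MeasurePreserving e.symm :=
      (volume_preserving_piFinSuccAbove (fun _ : Fin (n + 1) => ℝ) 0).symm e
    have hes : ∀ p, e.symm p = Fin.cons p.1 p.2 := fun p => by
      simp [e, MeasurableEquiv.piFinSuccAbove, Fin.insertNthEquiv]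
    have split : ∀ k : (Fin (n + 1) → ℝ) → ℝ≥0∞, Measurable k →
        ∫⁻ x, k x = ∫⁻ s, ∫⁻ y, k (e.symm (s, y)) := by
      intro k hk
      rw [← he.lintegral_comp hk, Measure.volume_eq_prod,
        lintegral_prod (fun p => k (e.symm p)) (hk.comp e.symm.measurable).aemeasurable]
    have meas : ∀ k : (Fin (n + 1) → ℝ) → ℝ≥0∞, Measurable k →
        Measurable fun s => ∫⁻ y, k (e.symm (s, y)) := by
      intro k hk
      exact (hk.comp e.symm.measurable).lintegral_prod_right'
    have slice : ∀ k : (Fin (n + 1) → ℝ) → ℝ≥0∞, Measurable k → ∀ s,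
        Measurable fun y => k (e.symm (s, y)) := by
      intro k hk s
      exact hk.comp (e.symm.measurable.comp measurable_prodMk_left)
    rw [split f hf, split g hg, split h hh]
    refine lintegral_mul_le_sq_real (meas f hf) (meas g hg) (meas h hh) fun s t => ?_
    refine ih (slice f hf s) (slice g hg t) (slice h hh _) fun x y => ?_
    refine (H _ _).trans_eq ?_
    congr 2
    rw [hes, hes, hes]
    ext i
    refine Fin.cases ?_ (fun j => ?_) i <;> simp [mul_add]

/-- Prékopa–Leindler inequality at the midpoint in Euclidean space. -/
theorem lintegral_mul_le_sq_euclidean {d : ℕ} {f g h : Euc d → ℝ≥0∞} (hf : Measurable f)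
    (hg : Measurable g) (hh : Measurable h)
    (H : ∀ x y, f x * g y ≤ h ((1 / 2 : ℝ) • (x + y)) ^ 2) :
    (∫⁻ x, f x) * ∫⁻ x, g x ≤ (∫⁻ x, h x) ^ 2 := by
  have hp := PiLp.volume_preserving_toLp (Fin d)
  have hm : Measurable (WithLp.toLp 2 : (Fin d → ℝ) → Euc d) := hp.measurable
  rw [← hp.lintegral_comp hf, ← hp.lintegral_comp hg, ← hp.lintegral_comp hh]
  exact lintegral_mul_le_sq_pi d (hf.comp hm) (hg.comp hm) (hh.comp hm) fun x y => H _ _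

/-! ### Reverse Hölder inequality for log-concave tails -/

/-- The absolute constant in the reverse Hölder inequality `E|Z|³ ≤ κ (E Z²)^{3/2}`. -/
noncomputable def thirdMomentConst : ℝ := ∑' k : ℕ, (4 * k + 2 : ℝ) ^ 3 * (2 * (1 / 3 : ℝ) ^ k)

theorem summable_thirdMomentConst :
    Summable fun k : ℕ => (4 * k + 2 : ℝ) ^ 3 * (2 * (1 / 3 : ℝ) ^ k) := by
  have h : ∀ j : ℕ, Summable fun k : ℕ => (k : ℝ) ^ j * (1 / 3 : ℝ) ^ k := fun j =>
    summable_pow_mul_geometric_of_norm_lt_one j (by norm_num)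
  refine ((((h 3).mul_left 128).add ((h 2).mul_left 192)).add
    (((h 1).mul_left 96).add ((h 0).mul_left 16))).congr fun k => ?_
  ring

theorem thirdMomentConst_pos : 0 < thirdMomentConst :=
  summable_thirdMomentConst.tsum_pos (fun k => by positivity) 0 (by norm_num)

/-- A log-concave tail decays geometrically at the scale of the second moment. -/
theorem measureReal_tail_le {Ω : Type*} [MeasurableSpace Ω] {μ : Measure Ω}
    [IsProbabilityMeasure μ] {Z : Ω → ℝ} (hZ : Measurable Z) {σ : ℝ} (hσ : 0 < σ)
    (hint : Integrable (fun ω => Z ω ^ 2) μ) (h2 : ∫ ω, Z ω ^ 2 ∂μ = σ ^ 2)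
    (htail : ∀ a b, μ.real {ω | a ≤ Z ω} * μ.real {ω | b ≤ Z ω}
      ≤ μ.real {ω | (a + b) / 2 ≤ Z ω} ^ 2) (k : ℕ) :
    μ.real {ω | (4 * k - 2) * σ ≤ Z ω} ≤ (1 / 3) ^ k := by
  set S : ℕ → ℝ := fun k => μ.real {ω | (4 * k - 2) * σ ≤ Z ω} with hS
  have hS0 : ∀ k, 0 ≤ S k := fun k => measureReal_nonneg
  have cheb : μ.real {ω | (2 * σ) ^ 2 ≤ Z ω ^ 2} ≤ 1 / 4 := by
    have h := mul_meas_ge_le_integral_of_nonneg (μ := μ) (f := fun ω => Z ω ^ 2)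
      (Filter.Eventually.of_forall fun ω => sq_nonneg _) hint ((2 * σ) ^ 2)
    rw [h2] at h
    have h4 : 0 < σ ^ 2 := by positivity
    nlinarith
  -- Chebyshev gives `S 1 ≤ 1/4` and `S 0 ≥ 3/4`, and log-concavity propagates the ratio `1/3`
  have h1 : S 1 ≤ 1 / 4 := by
    refine (measureReal_mono ?_).trans cheb
    intro ω hω
    simp only [mem_ofPred_eq, Nat.cast_one] at hω ⊢
    nlinarith
  have h0 : 3 / 4 ≤ S 0 := by
    have hm : MeasurableSet {ω | (4 * ((0 : ℕ) : ℝ) - 2) * σ ≤ Z ω} :=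
      measurableSet_le measurable_const hZ
    have h3 := probReal_add_probReal_compl (μ := μ) hm
    have h5 : μ.real {ω | (4 * ((0 : ℕ) : ℝ) - 2) * σ ≤ Z ω}ᶜ ≤ 1 / 4 := by
      refine (measureReal_mono ?_).trans cheb
      intro ω hω
      simp only [mem_ofPred_eq, mem_compl_iff, not_le, Nat.cast_zero] at hω ⊢
      nlinarith
    rw [← eq_sub_iff_add_eq] at h3
    calc (3 / 4 : ℝ) ≤ 1 - μ.real {ω | (4 * ((0 : ℕ) : ℝ) - 2) * σ ≤ Z ω}ᶜ := by linarith
      _ = S 0 := h3.symm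
  have hstep : ∀ k, S k * S (k + 2) ≤ S (k + 1) ^ 2 := by
    intro k
    have h := htail ((4 * k - 2) * σ) ((4 * (k + 2 : ℕ) - 2) * σ)
    have e : ((4 * (k : ℝ) - 2) * σ + (4 * ((k + 2 : ℕ) : ℝ) - 2) * σ) / 2
      = (4 * ((k + 1 : ℕ) : ℝ) - 2) * σ := by
      push_cast
      ring
    rw [e] at h
    exact h
  have hanti : ∀ k, S (k + 1) ≤ S k := by
    intro k
    refine measureReal_mono fun ω hω => ?_
    simp only [mem_ofPred_eq, Nat.cast_add, Nat.cast_one] at hω ⊢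
    nlinarith
  have hratio : ∀ k, S (k + 1) ≤ S k / 3 := by
    intro k
    induction k with
    | zero => simp only [zero_add]; linarith
    | succ k ih =>
      rcases (hS0 k).eq_or_lt with h | h
      · have h5 := hanti k
        have h6 := hanti (k + 1)
        have h7 := hS0 (k + 1)
        linarith
      · have h5 := hstep k
        have h6 : S k * S (k + 2) ≤ S k * (S (k + 1) / 3) := by
          nlinarith [hS0 (k + 1)]
        exact le_of_mul_le_mul_left h6 h
  have : S k ≤ (1 / 3) ^ k := by
    induction k with
    | zero => exact (measureReal_le_one : S 0 ≤ 1).trans_eq (pow_zero _).symm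
    | succ k ih =>
      have := hratio k
      rw [pow_succ]
      linarith
  exact this

/-- Reverse Hölder inequality for a random variable with log-concave tails. -/
theorem integral_abs_pow_three_le {Ω : Type*} [MeasurableSpace Ω] {μ : Measure Ω}
    [IsProbabilityMeasure μ] {Z : Ω → ℝ} (hZ : Measurable Z) {σ : ℝ} (hσ : 0 < σ)
    (hint : Integrable (fun ω => Z ω ^ 2) μ) (h2 : ∫ ω, Z ω ^ 2 ∂μ = σ ^ 2)
    (htail : ∀ a b, μ.real {ω | a ≤ Z ω} * μ.real {ω | b ≤ Z ω}
      ≤ μ.real {ω | (a + b) / 2 ≤ Z ω} ^ 2)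
    (htail' : ∀ a b, μ.real {ω | a ≤ -Z ω} * μ.real {ω | b ≤ -Z ω}
      ≤ μ.real {ω | (a + b) / 2 ≤ -Z ω} ^ 2) :
    ∫ ω, |Z ω| ^ 3 ∂μ ≤ thirdMomentConst * σ ^ 3 := by
  have tail : ∀ k : ℕ, μ.real {ω | (4 * k - 2) * σ ≤ |Z ω|} ≤ 2 * (1 / 3) ^ k := by
    intro k
    have h1 := measureReal_tail_le hZ hσ hint h2 htail k
    have h3 := measureReal_tail_le (Z := fun ω => -Z ω) hZ.neg hσ (by simpa using hint)
      (by simpa using h2) htail' k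
    calc μ.real {ω | (4 * k - 2) * σ ≤ |Z ω|}
        ≤ μ.real ({ω | (4 * k - 2) * σ ≤ Z ω} ∪ {ω | (4 * k - 2) * σ ≤ -Z ω}) := by
          refine measureReal_mono fun ω hω => ?_
          simpa only [mem_union, mem_ofPred_eq, le_abs] using hω
      _ ≤ _ := measureReal_union_le _ _
      _ ≤ _ := by linarith
  have hc : 0 ≤ thirdMomentConst * σ ^ 3 := by
    have := thirdMomentConst_pos
    positivity
  rw [integral_eq_lintegral_of_nonneg_ae (Filter.Eventually.of_forall fun ω => by positivity)
    (by fun_prop)]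
  refine ENNReal.toReal_le_of_le_ofReal hc ?_
  -- only the term with `(4k - 2)σ ≤ |Z| < (4k + 2)σ` is needed
  have pt : ∀ ω, ENNReal.ofReal (|Z ω| ^ 3) ≤ ∑' k : ℕ,
      {ω | (4 * k - 2) * σ ≤ |Z ω|}.indicator
        (fun _ => ENNReal.ofReal (((4 * k + 2) * σ) ^ 3)) ω := by
    intro ω
    set k := ⌊(|Z ω| / σ + 2) / 4⌋₊ with hk
    have h3 : 0 ≤ (|Z ω| / σ + 2) / 4 := by positivity
    have h4 := Nat.floor_le h3
    have h5 := Nat.lt_floor_add_one ((|Z ω| / σ + 2) / 4)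
    rw [← hk] at h4 h5
    have h6 : |Z ω| / σ * σ = |Z ω| := by field_simp
    refine le_trans ?_ (ENNReal.le_tsum k)
    rw [indicator_of_mem]
    · refine ENNReal.ofReal_le_ofReal (pow_le_pow_left₀ (abs_nonneg _) ?_ 3)
      rw [← h6]
      gcongr
      linarith
    · simp only [mem_ofPred_eq]
      rw [← h6]
      gcongr
      linarith
  calc ∫⁻ ω, ENNReal.ofReal (|Z ω| ^ 3) ∂μ
      ≤ ∫⁻ ω, ∑' k : ℕ, {ω | (4 * k - 2) * σ ≤ |Z ω|}.indicator
        (fun _ => ENNReal.ofReal (((4 * k + 2) * σ) ^ 3)) ω ∂μ := lintegral_mono pt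
    _ = ∑' k : ℕ, ENNReal.ofReal (((4 * k + 2) * σ) ^ 3) * μ {ω | (4 * k - 2) * σ ≤ |Z ω|} := by
        have hm : ∀ k : ℕ, MeasurableSet {ω | (4 * k - 2) * σ ≤ |Z ω|} := fun k =>
          measurableSet_le measurable_const hZ.abs
        rw [lintegral_tsum fun k => (measurable_const.indicator (hm k)).aemeasurable]
        congr 1
        ext k
        rw [lintegral_indicator_const (hm k)]
    _ ≤ ∑' k : ℕ, ENNReal.ofReal (σ ^ 3 * ((4 * k + 2) ^ 3 * (2 * (1 / 3) ^ k))) := by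
        refine ENNReal.tsum_le_tsum fun k => ?_
        rw [← ofReal_measureReal, ← ENNReal.ofReal_mul (by positivity)]
        refine ENNReal.ofReal_le_ofReal ?_
        calc _ ≤ ((4 * k + 2) * σ) ^ 3 * (2 * (1 / 3) ^ k) := by
              gcongr
              exact tail k
          _ = _ := by ring
    _ = ENNReal.ofReal (thirdMomentConst * σ ^ 3) := by
        rw [← ENNReal.ofReal_tsum_of_nonneg (fun k => by positivity)
          (summable_thirdMomentConst.mul_left _), tsum_mul_left, mul_comm]
        rfl

/-- Tails of linear functionals under a log-affine density on a convex set are log-concave. -/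
theorem tilted_tail_mul_le {d : ℕ} {X : Set (Euc d)} (hX : MeasurableSet X) (hc : Convex ℝ X)
    (θ u : Euc d) (m a b : ℝ) :
    ((volume.restrict X).tilted (inner ℝ θ)) {x | a ≤ inner ℝ u x - m}
      * ((volume.restrict X).tilted (inner ℝ θ)) {x | b ≤ inner ℝ u x - m}
      ≤ ((volume.restrict X).tilted (inner ℝ θ)) {x | (a + b) / 2 ≤ inner ℝ u x - m} ^ 2 := by
  set Λ := ∫ x in X, Real.exp (inner ℝ θ x)
  have hms : ∀ a : ℝ, MeasurableSet {x : Euc d | a ≤ inner ℝ u x - m} := fun a =>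
    measurableSet_le measurable_const (by fun_prop)
  have hΛ : 0 ≤ Λ := integral_nonneg fun x => (Real.exp_pos _).le
  have rep : ∀ a : ℝ, ((volume.restrict X).tilted (inner ℝ θ)) {x | a ≤ inner ℝ u x - m}
      = ∫⁻ x, ({x | a ≤ inner ℝ u x - m} ∩ X).indicator
        (fun x => ENNReal.ofReal (Real.exp (inner ℝ θ x) / Λ)) x := by
    intro a
    rw [tilted_apply' _ _ (hms a), Measure.restrict_restrict (hms a),
      lintegral_indicator ((hms a).inter hX)]
  have meas : ∀ a : ℝ, Measurable (({x : Euc d | a ≤ inner ℝ u x - m} ∩ X).indicator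
        (fun x => ENNReal.ofReal (Real.exp (inner ℝ θ x) / Λ))) := by
    intro a
    refine Measurable.indicator ?_ ((hms a).inter hX)
    fun_prop
  rw [rep, rep, rep]
  refine lintegral_mul_le_sq_euclidean (meas _) (meas _) (meas _) fun x y => ?_
  by_cases hx : x ∈ {x : Euc d | a ≤ inner ℝ u x - m} ∩ X
  swap
  · simp [indicator_of_notMem hx]
  by_cases hy : y ∈ {x : Euc d | b ≤ inner ℝ u x - m} ∩ X
  swap
  · simp [indicator_of_notMem hy]
  have hz : (1 / 2 : ℝ) • (x + y) ∈ {x : Euc d | (a + b) / 2 ≤ inner ℝ u x - m} ∩ X := by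
    refine ⟨?_, ?_⟩
    · have h1 := hx.1
      have h2 := hy.1
      simp only [mem_ofPred_eq, inner_smul_right, inner_add_right] at h1 h2 ⊢
      linarith
    · rw [smul_add]
      exact hc hx.2 hy.2 (by norm_num) (by norm_num) (by norm_num)
  rw [indicator_of_mem hx, indicator_of_mem hy, indicator_of_mem hz,
    ← ENNReal.ofReal_mul (by positivity), ← ENNReal.ofReal_pow (by positivity)]
  refine ENNReal.ofReal_le_ofReal (le_of_eq ?_)
  rw [div_pow, ← Real.exp_nat_mul, div_mul_div_comm, ← Real.exp_add, sq Λ]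
  congr 2
  rw [inner_smul_right, inner_add_right]
  push_cast
  ring

/-! ### Laplace transforms and tilted measures -/

/-- Convex bodies, as sets: compact, convex, with nonempty interior. -/
structure IsConvexBody {d : ℕ} (X : Set (Euc d)) : Prop where
  isCompact : IsCompact X
  convex : Convex ℝ X
  nonempty_interior : (interior X).Nonempty

/-- The probability measure on `X` with density proportional to `exp ⟨θ, x⟩`. -/
noncomputable def tiltedUniform {d : ℕ} (X : Set (Euc d)) (θ : Euc d) : Measure (Euc d) :=
  (volume.restrict X).tilted (inner ℝ θ)

/-- The Laplace transform `θ ↦ ∫_X exp⟨θ, x⟩ g(x) dx`. -/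
noncomputable def laplace {d : ℕ} {F : Type} [NormedAddCommGroup F] [NormedSpace ℝ F]
    (X : Set (Euc d)) (g : Euc d → F) (θ : Euc d) : F :=
  ∫ x in X, Real.exp (inner ℝ θ x) • g x

section Laplace

variable {d : ℕ} {X : Set (Euc d)} {F : Type} [NormedAddCommGroup F] [NormedSpace ℝ F]

theorem hasFDerivAt_laplace (hX : IsCompact X) {g : Euc d → F} (hg : Continuous g) (θ : Euc d) :
    HasFDerivAt (laplace X g) (laplace X (fun x => (innerSL ℝ x).smulRight (g x)) θ) θ := by
  have hcont : ∀ θ : Euc d, Continuous fun x : Euc d => Real.exp (inner ℝ θ x) • g x := by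
    intro θ
    fun_prop
  have hcont' : ∀ θ : Euc d, Continuous fun x : Euc d =>
      Real.exp (inner ℝ θ x) • (innerSL ℝ x).smulRight (g x) := by
    intro θ
    have : Continuous fun x : Euc d => (innerSL ℝ x).smulRight (g x) :=
      (ContinuousLinearMap.smulRightL ℝ (Euc d) F).continuous₂.comp
        ((innerSL ℝ).continuous.prodMk hg)
    fun_prop
  obtain ⟨R, hR⟩ := hX.isBounded.exists_norm_le
  obtain ⟨G, hG⟩ := (hX.image hg).isBounded.exists_norm_le
  have hG : ∀ x ∈ X, ‖g x‖ ≤ G := fun x hx => hG _ (mem_image_of_mem g hx)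
  refine hasFDerivAt_integral_of_dominated_of_fderiv_le (Metric.ball_mem_nhds θ one_pos)
    (bound := fun _ => Real.exp ((‖θ‖ + 1) * R) * (R * G))
    (F' := fun θ x => Real.exp (inner ℝ θ x) • (innerSL ℝ x).smulRight (g x)) ?_ ?_ ?_ ?_ ?_ ?_
  · exact Filter.Eventually.of_forall fun θ =>
      ((hcont θ).continuousOn.aestronglyMeasurable_of_isCompact hX hX.measurableSet)
  · exact (hcont θ).continuousOn.integrableOn_compact hX
  · exact (hcont' θ).continuousOn.aestronglyMeasurable_of_isCompact hX hX.measurableSet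
  · refine (ae_restrict_iff' hX.measurableSet).2 (Filter.Eventually.of_forall fun x hx θ' hθ' => ?_)
    have h1 : ‖θ'‖ ≤ ‖θ‖ + 1 := by
      have := norm_sub_norm_le θ' θ
      rw [Metric.mem_ball, dist_eq_norm] at hθ'
      linarith
    rw [norm_smul, ContinuousLinearMap.norm_smulRight_apply, innerSL_apply_norm,
      Real.norm_of_nonneg (Real.exp_pos _).le]
    have h2 := hR x hx
    have h3 := hG x hx
    have h4 : inner ℝ θ' x ≤ (‖θ‖ + 1) * R :=
      (real_inner_le_norm _ _).trans (mul_le_mul h1 h2 (norm_nonneg _) (by positivity))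
    have h5 : 0 ≤ R := (norm_nonneg _).trans h2
    gcongr
  · have : IsFiniteMeasure (volume.restrict X) := ⟨by
      simpa using hX.measure_lt_top⟩
    exact integrable_const _
  · refine Filter.Eventually.of_forall fun x θ' _ => ?_
    have h1 : HasFDerivAt (fun θ : Euc d => inner ℝ θ x) (innerSL ℝ x) θ' := by
      have := (innerSL ℝ x).hasFDerivAt (x := θ')
      refine this.congr_of_eventuallyEq (Filter.Eventually.of_forall fun y => ?_)
      simp [real_inner_comm]
    have h2 := h1.exp.smul_const (g x)
    convert h2 using 1
    ext v
    simp [smul_smul]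

theorem contDiff_laplace (hX : IsCompact X) (n : ℕ) :
    ∀ {F : Type} [NormedAddCommGroup F] [NormedSpace ℝ F] {g : Euc d → F},
      Continuous g → ContDiff ℝ n (laplace X g) := by
  induction n with
  | zero =>
    intro F _ _ g hg
    exact contDiff_zero.2 (continuous_iff_continuousAt.2 fun θ =>
      (hasFDerivAt_laplace hX hg θ).continuousAt)
  | succ n ih =>
    intro F _ _ g hg
    rw [Nat.cast_add, Nat.cast_one, contDiff_succ_iff_fderiv]
    refine ⟨fun θ => (hasFDerivAt_laplace hX hg θ).differentiableAt, by simp, ?_⟩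
    have : fderiv ℝ (laplace X g) = laplace X (fun x => (innerSL ℝ x).smulRight (g x)) :=
      funext fun θ => (hasFDerivAt_laplace hX hg θ).fderiv
    rw [this]
    exact ih ((ContinuousLinearMap.smulRightL ℝ (Euc d) F).continuous₂.comp
        ((innerSL ℝ).continuous.prodMk hg))

theorem laplace_one (X : Set (Euc d)) (θ : Euc d) :
    laplace X (fun _ => (1 : ℝ)) θ = ∫ x in X, Real.exp (inner ℝ θ x) := by
  simp [laplace]

theorem integral_tiltedUniform (X : Set (Euc d)) (g : Euc d → F) (θ : Euc d) :
    ∫ x, g x ∂(tiltedUniform X θ) = (laplace X (fun _ => (1 : ℝ)) θ)⁻¹ • laplace X g θ := by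
  rw [tiltedUniform, integral_tilted, laplace_one, laplace, ← integral_smul]
  congr 1
  ext x
  rw [smul_smul, div_eq_inv_mul]

end Laplace

namespace IsConvexBody

variable {d : ℕ} {X : Set (Euc d)} {F : Type} [NormedAddCommGroup F] [NormedSpace ℝ F]

theorem volume_pos (hX : IsConvexBody X) : 0 < volume X :=
  Measure.measure_pos_of_nonempty_interior _ hX.nonempty_interior

theorem measurableSet (hX : IsConvexBody X) : MeasurableSet X := hX.isCompact.measurableSet

theorem restrict_ne_zero (hX : IsConvexBody X) : volume.restrict X ≠ 0 := by
  rw [Ne, Measure.restrict_eq_zero]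
  exact hX.volume_pos.ne'

theorem integrable_exp (hX : IsConvexBody X) (θ : Euc d) :
    Integrable (fun x => Real.exp (inner ℝ θ x)) (volume.restrict X) := by
  have : Continuous fun x : Euc d => Real.exp (inner ℝ θ x) := by fun_prop
  exact this.continuousOn.integrableOn_compact hX.isCompact

theorem isProbabilityMeasure_tiltedUniform (hX : IsConvexBody X) (θ : Euc d) :
    IsProbabilityMeasure (tiltedUniform X θ) := by
  have := NeZero.mk hX.restrict_ne_zero
  exact isProbabilityMeasure_tilted (hX.integrable_exp θ)

theorem integral_exp_pos (hX : IsConvexBody X) (θ : Euc d) :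
    0 < ∫ x in X, Real.exp (inner ℝ θ x) := by
  have := NeZero.mk hX.restrict_ne_zero
  exact MeasureTheory.integral_exp_pos (hX.integrable_exp θ)

theorem integrable_tiltedUniform (hX : IsConvexBody X) {g : Euc d → F} (hg : Continuous g)
    (θ : Euc d) : Integrable g (tiltedUniform X θ) := by
  rw [tiltedUniform, integrable_tilted_iff (hX.integrable_exp θ)]
  have : Continuous fun x : Euc d => Real.exp (inner ℝ θ x) • g x := by fun_prop
  exact this.continuousOn.integrableOn_compact hX.isCompact

theorem ae_mem_tiltedUniform (hX : IsConvexBody X) (θ : Euc d) :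
    ∀ᵐ x ∂(tiltedUniform X θ), x ∈ X :=
  (tilted_absolutelyContinuous _ _).ae_le (ae_restrict_mem hX.measurableSet)

theorem hasFDerivAt_integral_tiltedUniform [CompleteSpace F] (hX : IsConvexBody X) {g : Euc d → F}
    (hg : Continuous g) (θ : Euc d) :
    HasFDerivAt (fun θ => ∫ x, g x ∂(tiltedUniform X θ))
      ((∫ x, (innerSL ℝ x).smulRight (g x) ∂(tiltedUniform X θ))
        - (∫ x, innerSL ℝ x ∂(tiltedUniform X θ)).smulRight (∫ x, g x ∂(tiltedUniform X θ))) θ := by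
  have h0 : laplace X (fun _ => (1 : ℝ)) θ ≠ 0 := by
    rw [laplace_one]
    exact (hX.integral_exp_pos θ).ne'
  have h1 := (hasDerivAt_inv h0).comp_hasFDerivAt θ
    (hasFDerivAt_laplace hX.isCompact (continuous_const (y := (1 : ℝ))) θ)
  have h2 := h1.smul (hasFDerivAt_laplace hX.isCompact hg θ)
  simp only [integral_tiltedUniform]
  refine h2.congr_fderiv ?_
  ext v
  have e : (fun x : Euc d => (innerSL ℝ x).smulRight (1 : ℝ)) = fun x => innerSL ℝ x := by
    ext x w
    simp
  simp only [e, Function.comp_apply, add_apply, smul_apply, sub_apply,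
    ContinuousLinearMap.smulRight_apply, smul_eq_mul]
  rw [smul_smul, sub_eq_add_neg, ← neg_smul]
  congr 2
  field_simp

theorem contDiff_integral_tiltedUniform (hX : IsConvexBody X) {g : Euc d → F} (hg : Continuous g)
    (n : ℕ) : ContDiff ℝ n (fun θ => ∫ x, g x ∂(tiltedUniform X θ)) := by
  simp only [integral_tiltedUniform]
  refine ContDiff.smul (ContDiff.inv (contDiff_laplace hX.isCompact n continuous_const) ?_)
    (contDiff_laplace hX.isCompact n hg)
  intro θ
  rw [laplace_one]
  exact (hX.integral_exp_pos θ).ne'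

theorem contDiff_logPartition (hX : IsConvexBody X) (n : ℕ) :
    ContDiff ℝ n (logPartition X) := by
  have h : logPartition X = fun θ => Real.log (laplace X (fun _ => (1 : ℝ)) θ) := by
    ext θ
    rw [laplace_one, logPartition]
  rw [h]
  refine (contDiff_laplace hX.isCompact n continuous_const).log ?_
  intro θ
  rw [laplace_one]
  exact (hX.integral_exp_pos θ).ne'

end IsConvexBody

/-! ### Central moments of tilted measures -/

/-- The mean of the tilted measure; it is the gradient of the log-partition function. -/
noncomputable def tiltedMean {d : ℕ} (X : Set (Euc d)) (θ : Euc d) : Euc d :=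
  ∫ x, x ∂(tiltedUniform X θ)

/-- The central moment of order `n` of `⟨u, x⟩` under the tilted measure. -/
noncomputable def tiltedMoment {d : ℕ} (X : Set (Euc d)) (n : ℕ) (θ u : Euc d) : ℝ :=
  ∫ x, (inner ℝ u x - inner ℝ u (tiltedMean X θ)) ^ n ∂(tiltedUniform X θ)

theorem hasDerivAt_add_smul {d : ℕ} (θ u : Euc d) (s : ℝ) :
    HasDerivAt (fun s : ℝ => θ + s • u) u s := by
  simpa using ((hasDerivAt_id s).smul_const u).const_add θ

namespace IsConvexBody

variable {d : ℕ} {X : Set (Euc d)}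

theorem inner_tiltedMean (hX : IsConvexBody X) (θ u : Euc d) :
    inner ℝ u (tiltedMean X θ) = ∫ x, inner ℝ u x ∂(tiltedUniform X θ) :=
  (integral_inner (hX.integrable_tiltedUniform continuous_id θ) u).symm

theorem ae_restrict_mem_interior (hX : IsConvexBody X) :
    ∀ᵐ x ∂(volume.restrict X), x ∈ interior X := by
  have h1 : ∀ᵐ x ∂(volume.restrict X), x ∉ frontier X :=
    (Measure.absolutelyContinuous_of_le Measure.restrict_le_self).ae_le
      (measure_eq_zero_iff_ae_notMem.1 (hX.convex.addHaar_frontier volume))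
  filter_upwards [h1, ae_restrict_mem hX.measurableSet] with x h2 h3
  by_contra h4
  exact h2 ⟨subset_closure h3, h4⟩

theorem ae_mem_interior_tiltedUniform (hX : IsConvexBody X) (θ : Euc d) :
    ∀ᵐ x ∂(tiltedUniform X θ), x ∈ interior X :=
  (tilted_absolutelyContinuous _ _).ae_le hX.ae_restrict_mem_interior

/-- A function on `X` that is positive on the interior has positive tilted mean. -/
theorem integral_tiltedUniform_pos (hX : IsConvexBody X) (θ : Euc d) {g : Euc d → ℝ}
    (hg : Continuous g) (h : ∀ᵐ x ∂(tiltedUniform X θ), 0 < g x) :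
    0 < ∫ x, g x ∂(tiltedUniform X θ) := by
  have := hX.isProbabilityMeasure_tiltedUniform θ
  have h0 : 0 ≤ᵐ[tiltedUniform X θ] g := h.mono fun x hx => hx.le
  refine lt_of_le_of_ne (integral_nonneg_of_ae h0) fun h1 => ?_
  have h2 := (integral_eq_zero_iff_of_nonneg_ae h0 (hX.integrable_tiltedUniform hg θ)).1 h1.symm
  obtain ⟨x, hx1, hx2⟩ := (h.and h2).exists
  exact hx1.ne' hx2

/-- Otherwise a hyperplane through the mean would have `X` on one side. -/
theorem tiltedMean_mem_interior (hX : IsConvexBody X) (θ : Euc d) :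
    tiltedMean X θ ∈ interior X := by
  by_contra hm
  obtain ⟨f, hf⟩ := geometric_hahn_banach_open_point hX.convex.interior isOpen_interior hm
  set n := (InnerProductSpace.toDual ℝ (Euc d)).symm f
  have hn : ∀ x, f x = inner ℝ n x := fun x => by simp [n]
  have h1 : 0 < ∫ x, (inner ℝ n (tiltedMean X θ) - inner ℝ n x) ∂(tiltedUniform X θ) := by
    refine hX.integral_tiltedUniform_pos θ (by fun_prop) ?_
    filter_upwards [hX.ae_mem_interior_tiltedUniform θ] with x hx
    rw [← hn, ← hn]
    exact sub_pos.2 (hf x hx)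
  have := hX.isProbabilityMeasure_tiltedUniform θ
  rw [integral_sub (integrable_const _) (hX.integrable_tiltedUniform (by fun_prop) θ),
    ← hX.inner_tiltedMean] at h1
  simp at h1

theorem hasFDerivAt_logPartition (hX : IsConvexBody X) (θ : Euc d) :
    HasFDerivAt (logPartition X) (innerSL ℝ (tiltedMean X θ)) θ := by
  have h0 : laplace X (fun _ => (1 : ℝ)) θ ≠ 0 := by
    rw [laplace_one]
    exact (hX.integral_exp_pos θ).ne'
  have h : logPartition X = fun θ => Real.log (laplace X (fun _ => (1 : ℝ)) θ) := by
    ext θ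
    rw [laplace_one, logPartition]
  rw [h]
  have h1 := (hasFDerivAt_laplace hX.isCompact (continuous_const (y := (1 : ℝ))) θ).log h0
  refine h1.congr_fderiv ?_
  have e : (fun x : Euc d => (innerSL ℝ x).smulRight (1 : ℝ)) = fun x => innerSL ℝ x := by
    ext x w
    simp
  rw [e, ← integral_tiltedUniform, tiltedMean]
  exact (innerSL ℝ (E := Euc d)).integral_comp_comm (hX.integrable_tiltedUniform continuous_id θ)

theorem hasDerivAt_logPartition_line (hX : IsConvexBody X) (θ u : Euc d) (s : ℝ) :
    HasDerivAt (fun s : ℝ => logPartition X (θ + s • u))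
      (inner ℝ u (tiltedMean X (θ + s • u))) s := by
  have h := (hX.hasFDerivAt_logPartition (θ + s • u)).comp_hasDerivAt s (hasDerivAt_add_smul θ u s)
  rw [real_inner_comm]
  exact h

theorem hasDerivAt_integral_line (hX : IsConvexBody X) {g : Euc d → ℝ} (hg : Continuous g)
    (θ u : Euc d) (s : ℝ) :
    HasDerivAt (fun s : ℝ => ∫ x, g x ∂(tiltedUniform X (θ + s • u)))
      ((∫ x, inner ℝ u x * g x ∂(tiltedUniform X (θ + s • u)))
        - (∫ x, inner ℝ u x ∂(tiltedUniform X (θ + s • u)))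
          * ∫ x, g x ∂(tiltedUniform X (θ + s • u))) s := by
  have h := (hX.hasFDerivAt_integral_tiltedUniform hg (θ + s • u)).comp_hasDerivAt s
    (hasDerivAt_add_smul θ u s)
  refine h.congr_deriv ?_
  have hc : Continuous fun x : Euc d => (innerSL ℝ x).smulRight (g x) :=
    (ContinuousLinearMap.smulRightL ℝ (Euc d) ℝ).continuous₂.comp
      ((innerSL ℝ).continuous.prodMk hg)
  rw [sub_apply, ContinuousLinearMap.smulRight_apply, smul_eq_mul,
    ContinuousLinearMap.integral_apply (hX.integrable_tiltedUniform hc _),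
    ContinuousLinearMap.integral_apply
      (hX.integrable_tiltedUniform (innerSL ℝ).continuous _)]
  simp [real_inner_comm]

theorem tiltedMoment_two (hX : IsConvexBody X) (θ u : Euc d) :
    tiltedMoment X 2 θ u = (∫ x, inner ℝ u x * inner ℝ u x ∂(tiltedUniform X θ))
      - (∫ x, inner ℝ u x ∂(tiltedUniform X θ)) * ∫ x, inner ℝ u x ∂(tiltedUniform X θ) := by
  have := hX.isProbabilityMeasure_tiltedUniform θ
  rw [tiltedMoment, hX.inner_tiltedMean]
  set m := ∫ x, inner ℝ u x ∂(tiltedUniform X θ) with hm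
  have e : ∀ x : Euc d, (inner ℝ u x - m) ^ 2
      = inner ℝ u x * inner ℝ u x - 2 * m * inner ℝ u x + m ^ 2 := fun x => by ring
  simp only [e]
  rw [integral_add (hX.integrable_tiltedUniform (by fun_prop) θ) (integrable_const _),
    integral_sub (hX.integrable_tiltedUniform (by fun_prop) θ)
      (hX.integrable_tiltedUniform (by fun_prop) θ), integral_const_mul, ← hm]
  simp
  ring

theorem tiltedMoment_three (hX : IsConvexBody X) (θ u : Euc d) :
    tiltedMoment X 3 θ u = (∫ x, inner ℝ u x * (inner ℝ u x * inner ℝ u x) ∂(tiltedUniform X θ))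
      - (∫ x, inner ℝ u x ∂(tiltedUniform X θ))
        * (∫ x, inner ℝ u x * inner ℝ u x ∂(tiltedUniform X θ))
      - 2 * (∫ x, inner ℝ u x ∂(tiltedUniform X θ)) * tiltedMoment X 2 θ u := by
  have := hX.isProbabilityMeasure_tiltedUniform θ
  rw [hX.tiltedMoment_two, tiltedMoment, hX.inner_tiltedMean]
  set m := ∫ x, inner ℝ u x ∂(tiltedUniform X θ) with hm
  have e : ∀ x : Euc d, (inner ℝ u x - m) ^ 3
      = inner ℝ u x * (inner ℝ u x * inner ℝ u x) - 3 * m * (inner ℝ u x * inner ℝ u x)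
        + 3 * m ^ 2 * inner ℝ u x - m ^ 3 := fun x => by ring
  simp only [e]
  rw [integral_sub (hX.integrable_tiltedUniform (by fun_prop) θ) (integrable_const _),
    integral_add (hX.integrable_tiltedUniform (by fun_prop) θ)
      (hX.integrable_tiltedUniform (by fun_prop) θ),
    integral_sub (hX.integrable_tiltedUniform (by fun_prop) θ)
      (hX.integrable_tiltedUniform (by fun_prop) θ), integral_const_mul, integral_const_mul, ← hm]
  simp
  ring

theorem hasDerivAt_inner_tiltedMean_line (hX : IsConvexBody X) (θ u : Euc d) (s : ℝ) :
    HasDerivAt (fun s : ℝ => inner ℝ u (tiltedMean X (θ + s • u)))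
      (tiltedMoment X 2 (θ + s • u) u) s := by
  simp only [hX.inner_tiltedMean, hX.tiltedMoment_two]
  exact hX.hasDerivAt_integral_line (by fun_prop) θ u s

theorem hasDerivAt_tiltedMoment_two_line (hX : IsConvexBody X) (θ u : Euc d) (s : ℝ) :
    HasDerivAt (fun s : ℝ => tiltedMoment X 2 (θ + s • u) u)
      (tiltedMoment X 3 (θ + s • u) u) s := by
  have h1 := hX.hasDerivAt_integral_line (g := fun x => inner ℝ u x * inner ℝ u x)
    (by fun_prop) θ u s
  have h2 := hX.hasDerivAt_integral_line (g := fun x => inner ℝ u x) (by fun_prop) θ u s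
  rw [hX.tiltedMoment_three]
  simp only [hX.tiltedMoment_two]
  refine (h1.sub (h2.mul h2)).congr_deriv ?_
  ring

theorem abs_inner_sub_tiltedMean_le (hX : IsConvexBody X) (θ u : Euc d) {x : Euc d} (hx : x ∈ X) :
    |inner ℝ u x - inner ℝ u (tiltedMean X θ)| ≤ ‖u‖ * Metric.diam X := by
  rw [← inner_sub_right]
  refine (abs_real_inner_le_norm _ _).trans ?_
  gcongr
  rw [← dist_eq_norm]
  exact Metric.dist_le_diam_of_mem hX.isCompact.isBounded hx
    (interior_subset (hX.tiltedMean_mem_interior θ))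

theorem abs_tiltedMoment_le (hX : IsConvexBody X) (n : ℕ) (θ u : Euc d) :
    |tiltedMoment X n θ u| ≤ (‖u‖ * Metric.diam X) ^ n := by
  have := hX.isProbabilityMeasure_tiltedUniform θ
  have h := norm_integral_le_of_norm_le_const (μ := tiltedUniform X θ)
    (f := fun x => (inner ℝ u x - inner ℝ u (tiltedMean X θ)) ^ n)
    (C := (‖u‖ * Metric.diam X) ^ n) (by
      filter_upwards [hX.ae_mem_tiltedUniform θ] with x hx
      rw [Real.norm_eq_abs, abs_pow]
      exact pow_le_pow_left₀ (abs_nonneg _) (hX.abs_inner_sub_tiltedMean_le θ u hx) n)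
  simpa [tiltedMoment] using h

theorem tiltedMoment_two_pos (hX : IsConvexBody X) (θ : Euc d) {u : Euc d} (hu : u ≠ 0) :
    0 < tiltedMoment X 2 θ u := by
  refine hX.integral_tiltedUniform_pos θ (by fun_prop) ?_
  -- the points where the integrand vanishes lie on a hyperplane
  have h1 : volume {x : Euc d | inner ℝ u x = inner ℝ u (tiltedMean X θ)} = 0 := by
    set S : AffineSubspace ℝ (Euc d) := AffineSubspace.mk' (tiltedMean X θ) (ℝ ∙ u)ᗮ with hS
    have h2 : {x : Euc d | inner ℝ u x = inner ℝ u (tiltedMean X θ)} = (S : Set (Euc d)) := by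
      ext x
      rw [mem_ofPred_eq, SetLike.mem_coe, hS, AffineSubspace.mem_mk', vsub_eq_sub,
        Submodule.mem_orthogonal_singleton_iff_inner_right, inner_sub_right, sub_eq_zero]
    rw [h2]
    refine Measure.addHaar_affineSubspace volume S fun hT => hu ?_
    have h3 : tiltedMean X θ + u ∈ S := hT ▸ AffineSubspace.mem_top ℝ _ _
    rw [hS, AffineSubspace.mem_mk', vsub_eq_sub,
        Submodule.mem_orthogonal_singleton_iff_inner_right] at h3
    simpa using h3
  have h2 : ∀ᵐ x ∂(tiltedUniform X θ), ¬ inner ℝ u x = inner ℝ u (tiltedMean X θ) :=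
    (tilted_absolutelyContinuous _ _).ae_le (Measure.absolutelyContinuous_of_le
      Measure.restrict_le_self |>.ae_le (measure_eq_zero_iff_ae_notMem.1 h1))
  filter_upwards [h2] with x hx
  have := sub_ne_zero.2 hx
  positivity

/-- Self-concordance of the log-partition function in the dual: the third central moment is
controlled by the variance, with an absolute constant. -/
theorem abs_tiltedMoment_three_le (hX : IsConvexBody X) (θ u : Euc d) :
    |tiltedMoment X 3 θ u| ≤ thirdMomentConst * √(tiltedMoment X 2 θ u) ^ 3 := by
  rcases eq_or_ne u 0 with rfl | hu
  · simp [tiltedMoment]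
  have := hX.isProbabilityMeasure_tiltedUniform θ
  have hv := hX.tiltedMoment_two_pos θ hu
  set m := inner ℝ u (tiltedMean X θ) with hm
  have htail : ∀ (u : Euc d) (m a b : ℝ),
      (tiltedUniform X θ).real {x | a ≤ inner ℝ u x - m}
      * (tiltedUniform X θ).real {x | b ≤ inner ℝ u x - m}
      ≤ (tiltedUniform X θ).real {x | (a + b) / 2 ≤ inner ℝ u x - m} ^ 2 := by
    intro u m a b
    have h := tilted_tail_mul_le hX.measurableSet hX.convex θ u m a b
    have h2 := ENNReal.toReal_mono (ENNReal.pow_ne_top (measure_ne_top (tiltedUniform X θ) _)) h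
    rwa [ENNReal.toReal_mul, ENNReal.toReal_pow] at h2
  have h1 := integral_abs_pow_three_le (μ := tiltedUniform X θ) (Z := fun x => inner ℝ u x - m)
    (by fun_prop) (Real.sqrt_pos.2 hv) (hX.integrable_tiltedUniform (by fun_prop) θ)
    (by rw [Real.sq_sqrt hv.le]; rfl) (htail u m) (by
      intro a b
      have h2 := htail (-u) (-m) a b
      have e : ∀ x : Euc d, inner ℝ (-u) x - -m = -(inner ℝ u x - m) := fun x => by
        rw [inner_neg_left]
        ring
      simpa only [e] using h2)
  refine le_trans ?_ h1
  rw [tiltedMoment]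
  refine (abs_integral_le_integral_abs).trans_eq ?_
  simp only [abs_pow, ← hm]

end IsConvexBody

/-! ### Duality between the log-partition function and the entropic barrier -/

theorem le_add_add_of_second_deriv_le {k k' k'' : ℝ → ℝ} (h1 : ∀ s, HasDerivAt k (k' s) s)
    (h2 : ∀ s, HasDerivAt k' (k'' s) s) {c : ℝ} (hc : ∀ s, k'' s ≤ c) :
    k 1 ≤ k 0 + k' 0 + c / 2 := by
  have d1 : ∀ s, HasDerivAt (fun s => k' s - c * s) (k'' s - c) s := fun s => by
    exact ((h2 s).sub ((hasDerivAt_id s).const_mul c)).congr_deriv (by simp)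
  have a1 : Antitone fun s => k' s - c * s :=
    antitone_of_hasDerivAt_nonpos d1 fun s => sub_nonpos.2 (hc s)
  have d2 : ∀ s, HasDerivAt (fun s => k s - k' 0 * s - c / 2 * s ^ 2) (k' s - k' 0 - c * s) s :=
    fun s => by
    have := ((h1 s).sub ((hasDerivAt_id s).const_mul (k' 0))).sub
      (((hasDerivAt_id s).pow 2).const_mul (c / 2))
    refine this.congr_deriv ?_
    simp
    ring
  have a2 : AntitoneOn (fun s => k s - k' 0 * s - c / 2 * s ^ 2) (Ici 0) := by
    refine antitoneOn_of_deriv_nonpos (convex_Ici 0)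
      (fun s _ => (d2 s).continuousAt.continuousWithinAt)
      (fun s _ => (d2 s).differentiableAt.differentiableWithinAt) fun s hs => ?_
    rw [(d2 s).deriv]
    rw [interior_Ici] at hs
    have := a1 (le_of_lt (mem_Ioi.1 hs))
    simp only [mul_zero, sub_zero] at this
    linarith
  have := a2 (mem_Ici.2 le_rfl) (mem_Ici.2 zero_le_one) zero_le_one
  simp only at this
  linarith

theorem le_entropicBarrier {d : ℕ} (X : Set (Euc d)) (θ x : Euc d) :
    ((inner ℝ θ x - logPartition X θ : ℝ) : EReal) ≤ entropicBarrier X x :=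
  le_iSup (fun θ : Euc d => ((inner ℝ θ x - logPartition X θ : ℝ) : EReal)) θ

theorem entropicBarrier_ne_bot {d : ℕ} (X : Set (Euc d)) (x : Euc d) :
    entropicBarrier X x ≠ ⊥ :=
  ne_bot_of_le_ne_bot (EReal.coe_ne_bot _) (le_entropicBarrier X 0 x)

/-- The inverse of the gradient map of the log-partition function; on the interior of `X` this is
the gradient of the entropic barrier. -/
noncomputable def dualPoint {d : ℕ} (X : Set (Euc d)) : Euc d → Euc d :=
  Function.invFun (tiltedMean X)

namespace IsConvexBody

variable {d : ℕ} {X : Set (Euc d)}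

theorem logPartition_tangent_le (hX : IsConvexBody X) (θ θ' : Euc d) :
    logPartition X θ + inner ℝ (θ' - θ) (tiltedMean X θ) ≤ logPartition X θ' := by
  have h := le_add_add_of_second_deriv_le (c := 0)
    (fun s => (hX.hasDerivAt_logPartition_line θ (θ' - θ) s).neg)
    (fun s => (hX.hasDerivAt_inner_tiltedMean_line θ (θ' - θ) s).neg) (fun s => by
      rw [neg_nonpos]
      exact integral_nonneg fun x => sq_nonneg _)
  simp only [one_smul, zero_smul, add_zero, add_sub_cancel, Pi.neg_apply] at h
  linarith

theorem logPartition_le_quadratic (hX : IsConvexBody X) (θ θ' : Euc d) :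
    logPartition X θ' ≤ logPartition X θ + inner ℝ (θ' - θ) (tiltedMean X θ)
      + (‖θ' - θ‖ * Metric.diam X) ^ 2 / 2 := by
  have h := le_add_add_of_second_deriv_le
    (fun s => (hX.hasDerivAt_logPartition_line θ (θ' - θ) s))
    (fun s => (hX.hasDerivAt_inner_tiltedMean_line θ (θ' - θ) s)) (fun s =>
      (le_abs_self _).trans (hX.abs_tiltedMoment_le 2 _ _))
  simpa only [one_smul, zero_smul, add_zero, add_sub_cancel] using h

theorem tiltedMean_injective (hX : IsConvexBody X) : Function.Injective (tiltedMean X) := by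
  intro θ θ' h
  by_contra hne
  have hu : θ' - θ ≠ 0 := sub_ne_zero.2 (Ne.symm hne)
  have hm : StrictMono fun s : ℝ => inner ℝ (θ' - θ) (tiltedMean X (θ + s • (θ' - θ))) :=
    strictMono_of_hasDerivAt_pos (fun s => hX.hasDerivAt_inner_tiltedMean_line θ (θ' - θ) s)
      fun s => hX.tiltedMoment_two_pos _ hu
  have := hm zero_lt_one
  simp [h] at this

/-- The log-partition function grows faster than `⟨θ, x⟩` when `x` is interior. -/
theorem exists_coercive (hX : IsConvexBody X) {x : Euc d} (hx : x ∈ interior X) :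
    ∃ r c : ℝ, 0 < r ∧ ∀ θ, inner ℝ θ x + r * ‖θ‖ - c ≤ logPartition X θ := by
  obtain ⟨ε, hε, hB⟩ := Metric.mem_nhds_iff.1 (mem_interior_iff_mem_nhds.1 hx)
  set v := volume.real (Metric.ball (0 : Euc d) (ε / 4)) with hv
  have hv0 : 0 < v := ENNReal.toReal_pos (Metric.measure_ball_pos _ _ (by positivity)).ne'
    measure_ball_lt_top.ne
  refine ⟨ε / 4, -Real.log v, by positivity, fun θ => ?_⟩
  -- on the ball of radius `ε / 4` around `z`, the functional `θ` exceeds its value at `x`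
  set z := x + (ε / 2) • (‖θ‖⁻¹ • θ) with hz
  have hzn : ‖z - x‖ ≤ ε / 2 := by
    rw [hz, add_sub_cancel_left, norm_smul, norm_smul, norm_inv, norm_norm,
      Real.norm_of_nonneg (by positivity)]
    have : ‖θ‖⁻¹ * ‖θ‖ ≤ 1 := inv_mul_le_one
    nlinarith
  have hsub : Metric.ball z (ε / 4) ⊆ X := by
    intro y hy
    refine hB ?_
    rw [Metric.mem_ball, dist_eq_norm] at *
    have := norm_add_le (y - z) (z - x)
    rw [sub_add_sub_cancel] at this
    linarith
  have hin : inner ℝ θ z = inner ℝ θ x + ε / 2 * ‖θ‖ := by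
    rw [hz, inner_add_right, inner_smul_right, inner_smul_right, real_inner_self_eq_norm_sq]
    rcases eq_or_ne ‖θ‖ 0 with h | h
    · simp [h]
    · field_simp
  have h1 : v * Real.exp (inner ℝ θ x + ε / 4 * ‖θ‖) ≤ ∫ y in X, Real.exp (inner ℝ θ y) := by
    calc v * Real.exp (inner ℝ θ x + ε / 4 * ‖θ‖)
        = ∫ y in Metric.ball z (ε / 4), Real.exp (inner ℝ θ x + ε / 4 * ‖θ‖) := by
          rw [setIntegral_const, smul_eq_mul, hv, measureReal_def, measureReal_def,
            Measure.addHaar_ball_center volume z]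
      _ ≤ ∫ y in Metric.ball z (ε / 4), Real.exp (inner ℝ θ y) := by
          refine setIntegral_mono_on (integrableOn_const measure_ball_lt_top.ne)
            ((hX.integrable_exp θ).mono_measure (Measure.restrict_mono hsub le_rfl))
            measurableSet_ball fun y hy => ?_
          refine Real.exp_le_exp.2 ?_
          have h2 := abs_real_inner_le_norm θ (y - z)
          rw [Metric.mem_ball, dist_eq_norm] at hy
          have h3 : ‖θ‖ * ‖y - z‖ ≤ ‖θ‖ * (ε / 4) := by gcongr
          have h4 := (abs_le.1 (h2.trans h3)).1
          rw [inner_sub_right] at h4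
          linarith
      _ ≤ _ := setIntegral_mono_set (hX.integrable_exp θ)
          (Filter.Eventually.of_forall fun y => (Real.exp_pos _).le) hsub.eventuallyLE
  have h2 := Real.log_le_log (by positivity) h1
  rw [Real.log_mul hv0.ne' (Real.exp_pos _).ne', Real.log_exp] at h2
  rw [logPartition]
  linarith

/-- Every interior point is the mean of a tilted measure: `A(θ) - ⟨θ, x⟩` is coercive, and its
minimizer has mean `x`. -/
theorem exists_tiltedMean_eq (hX : IsConvexBody X) {x : Euc d} (hx : x ∈ interior X) :
    ∃ θ, tiltedMean X θ = x := by
  obtain ⟨r, c, hr, h⟩ := hX.exists_coercive hx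
  have hA : Continuous (logPartition X) := (hX.contDiff_logPartition 0).continuous
  obtain ⟨θ, hθ⟩ := Continuous.exists_forall_le' (f := fun θ => logPartition X θ - inner ℝ θ x)
    (by fun_prop) 0 (by
      have h1 := (tendsto_norm_cocompact_atTop (E := Euc d)).eventually_ge_atTop
        ((logPartition X 0 + c) / r)
      filter_upwards [h1] with θ hθ
      have h2 := h θ
      rw [div_le_iff₀ hr] at hθ
      simp only [inner_zero_left]
      linarith)
  -- first-order optimality of `θ` along the line in the direction `u`
  refine ⟨θ, ?_⟩
  refine ext_inner_left ℝ fun u => ?_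
  have h1 := (hX.hasDerivAt_logPartition_line θ u 0).sub
    ((hasDerivAt_const (0 : ℝ) x).inner ℝ (hasDerivAt_add_smul θ u 0) )
  have h2 : IsLocalMin ((fun s : ℝ => logPartition X (θ + s • u)) -
      fun s : ℝ => inner ℝ x (θ + s • u)) 0 := by
    refine Filter.Eventually.of_forall fun s => ?_
    have := hθ (θ + s • u)
    simpa [real_inner_comm] using this
  have h3 := h2.hasDerivAt_eq_zero h1
  simp only [zero_smul, add_zero, inner_zero_left, sub_eq_zero] at h3
  rw [h3, real_inner_comm]

theorem tiltedMean_dualPoint (hX : IsConvexBody X) {x : Euc d} (hx : x ∈ interior X) :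
    tiltedMean X (dualPoint X x) = x :=
  Function.invFun_eq (hX.exists_tiltedMean_eq hx)

theorem dualPoint_tiltedMean (hX : IsConvexBody X) (θ : Euc d) :
    dualPoint X (tiltedMean X θ) = θ :=
  Function.leftInverse_invFun hX.tiltedMean_injective θ

theorem contDiff_tiltedMean (hX : IsConvexBody X) (n : ℕ) : ContDiff ℝ n (tiltedMean X) :=
  hX.contDiff_integral_tiltedUniform continuous_id n

theorem inner_fderiv_tiltedMean (hX : IsConvexBody X) (θ u : Euc d) :
    inner ℝ u (fderiv ℝ (tiltedMean X) θ u) = tiltedMoment X 2 θ u := by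
  have h1 : HasDerivAt (fun s : ℝ => tiltedMean X (θ + s • u)) (fderiv ℝ (tiltedMean X) θ u) 0 := by
    have h : HasFDerivAt (tiltedMean X) (fderiv ℝ (tiltedMean X) (θ + (0 : ℝ) • u))
        (θ + (0 : ℝ) • u) :=
      ((hX.contDiff_tiltedMean 1).differentiable (by norm_num) _).hasFDerivAt
    have h' := h.comp_hasDerivAt (0 : ℝ) (hasDerivAt_add_smul θ u 0)
    simp only [zero_smul, add_zero] at h'
    exact h'
  have h2 := (hasDerivAt_const (0 : ℝ) u).inner ℝ h1
  simpa using h2.unique (hX.hasDerivAt_inner_tiltedMean_line θ u 0)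

/-- The inverse function theorem, with the variance as the nondegenerate Hessian. -/
theorem contDiffAt_dualPoint (hX : IsConvexBody X) {x : Euc d} (hx : x ∈ interior X) (n : ℕ) :
    ContDiffAt ℝ (n + 1 : ℕ) (dualPoint X) x := by
  obtain ⟨θ, rfl⟩ := hX.exists_tiltedMean_eq hx
  have hinj : Function.Injective (fderiv ℝ (tiltedMean X) θ : Euc d →ₗ[ℝ] Euc d) := by
    refine (injective_iff_map_eq_zero _).2 fun u hu => ?_
    by_contra hne
    have h1 := hX.tiltedMoment_two_pos θ hne
    rw [← hX.inner_fderiv_tiltedMean] at h1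
    have h2 : fderiv ℝ (tiltedMean X) θ u = 0 := hu
    simp [h2] at h1
  set B : Euc d ≃L[ℝ] Euc d :=
    (LinearEquiv.ofInjectiveEndo _ hinj).toContinuousLinearEquiv with hB
  have hc : ContDiffAt ℝ (n + 1 : ℕ) (tiltedMean X) θ :=
    (hX.contDiff_tiltedMean (n + 1)).contDiffAt
  have hn : ((n + 1 : ℕ) : WithTop ℕ∞) ≠ 0 := by
    exact_mod_cast Nat.succ_ne_zero n
  have hf : HasFDerivAt (tiltedMean X) (B : Euc d →L[ℝ] Euc d) θ := by
    refine (hc.differentiableAt hn).hasFDerivAt.congr_fderiv ?_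
    ext v
    simp [hB]
  have h1 := hc.to_localInverse hf hn
  refine h1.congr_of_eventuallyEq ?_
  have h2 := (hc.hasStrictFDerivAt' hf hn).eventually_right_inverse
  filter_upwards [h2] with y hy
  conv_lhs => rw [← hy]
  rw [hX.dualPoint_tiltedMean]
  rfl

theorem entropicBarrier_tiltedMean (hX : IsConvexBody X) (θ : Euc d) :
    entropicBarrier X (tiltedMean X θ)
      = ((inner ℝ θ (tiltedMean X θ) - logPartition X θ : ℝ) : EReal) := by
  refine le_antisymm (iSup_le fun θ' => EReal.coe_le_coe_iff.2 ?_) (le_entropicBarrier X _ _)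
  have h := hX.logPartition_tangent_le θ θ'
  rw [inner_sub_left] at h
  linarith

theorem entropicBarrier_of_mem_interior (hX : IsConvexBody X) {x : Euc d} (hx : x ∈ interior X) :
    entropicBarrier X x
      = ((inner ℝ (dualPoint X x) x - logPartition X (dualPoint X x) : ℝ) : EReal) := by
  have := hX.entropicBarrier_tiltedMean (dualPoint X x)
  rwa [hX.tiltedMean_dualPoint hx] at this

theorem coe_toReal_entropicBarrier (hX : IsConvexBody X) {x : Euc d} (hx : x ∈ interior X) :
    ((entropicBarrier X x).toReal : EReal) = entropicBarrier X x := by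
  rw [hX.entropicBarrier_of_mem_interior hx, EReal.toReal_coe]

theorem toReal_entropicBarrier (hX : IsConvexBody X) {x : Euc d} (hx : x ∈ interior X) :
    (entropicBarrier X x).toReal
      = inner ℝ (dualPoint X x) x - logPartition X (dualPoint X x) := by
  rw [hX.entropicBarrier_of_mem_interior hx, EReal.toReal_coe]

theorem hasFDerivAt_entropicBarrier (hX : IsConvexBody X) {x : Euc d} (hx : x ∈ interior X) :
    HasFDerivAt (fun x => (entropicBarrier X x).toReal) (innerSL ℝ (dualPoint X x)) x := by
  have h0 : HasFDerivAt (dualPoint X) (fderiv ℝ (dualPoint X) x) x :=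
    ((hX.contDiffAt_dualPoint hx 0).differentiableAt (by norm_num)).hasFDerivAt
  have h1 := (h0.inner ℝ (hasFDerivAt_id x)).sub
    ((hX.hasFDerivAt_logPartition (dualPoint X x)).comp x h0)
  have h2 := h1.congr_of_eventuallyEq (f₁ := fun x => (entropicBarrier X x).toReal) (by
    filter_upwards [isOpen_interior.mem_nhds hx] with y hy
    rw [hX.toReal_entropicBarrier hy]
    rfl)
  refine h2.congr_fderiv ?_
  ext v
  simp [hX.tiltedMean_dualPoint hx, real_inner_comm]

/-- The entropic barrier is infinite outside the interior: `⟨λn, z⟩ - A(λn) → ∞` along an outward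
normal `n` at `z`. -/
theorem entropicBarrier_eq_top (hX : IsConvexBody X) {z : Euc d} (hz : z ∉ interior X) :
    entropicBarrier X z = ⊤ := by
  obtain ⟨f, hf⟩ := geometric_hahn_banach_open_point hX.convex.interior isOpen_interior hz
  set n := (InnerProductSpace.toDual ℝ (Euc d)).symm f
  have hn : ∀ x, f x = inner ℝ n x := fun x => by simp [n]
  have hae : ∀ᵐ x ∂(volume.restrict X), inner ℝ n x < inner ℝ n z := by
    filter_upwards [hX.ae_restrict_mem_interior] with x hx
    rw [← hn, ← hn]
    exact hf x hx
  have hexp : ∀ (k : ℕ) (x : Euc d), Real.exp ((k : ℝ) * (inner ℝ n x - inner ℝ n z))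
      = Real.exp (inner ℝ ((k : ℝ) • n) x) * Real.exp (-(k * inner ℝ n z)) := fun k x => by
    rw [← Real.exp_add, inner_smul_left]
    congr 1
    simp
    ring
  have hlim : Filter.Tendsto
      (fun k : ℕ => ∫ x in X, Real.exp ((k : ℝ) * (inner ℝ n x - inner ℝ n z)))
      Filter.atTop (nhds 0) := by
    have := NeZero.mk hX.restrict_ne_zero
    have hfin : IsFiniteMeasure (volume.restrict X) := ⟨by
      simpa using hX.isCompact.measure_lt_top⟩
    have h := tendsto_integral_of_dominated_convergence (μ := volume.restrict X)
      (F := fun (k : ℕ) x => Real.exp ((k : ℝ) * (inner ℝ n x - inner ℝ n z))) (f := fun _ => 0)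
      (fun _ => (1 : ℝ)) (fun k => by fun_prop) (integrable_const _) (fun k => by
        filter_upwards [hae] with x hx
        rw [Real.norm_of_nonneg (Real.exp_pos _).le, Real.exp_le_one_iff]
        exact mul_nonpos_of_nonneg_of_nonpos (by positivity) (by linarith)) (by
        filter_upwards [hae] with x hx
        refine Real.tendsto_exp_atBot.comp ?_
        exact tendsto_natCast_atTop_atTop.atTop_mul_const_of_neg (sub_neg.2 hx))
    simpa using h
  have hpos : ∀ k : ℕ, 0 < ∫ x in X, Real.exp ((k : ℝ) * (inner ℝ n x - inner ℝ n z)) := by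
    intro k
    simp only [hexp, integral_mul_const]
    exact mul_pos (hX.integral_exp_pos _) (Real.exp_pos _)
  have hval : ∀ k : ℕ, -Real.log (∫ x in X, Real.exp ((k : ℝ) * (inner ℝ n x - inner ℝ n z)))
      = inner ℝ ((k : ℝ) • n) z - logPartition X ((k : ℝ) • n) := by
    intro k
    simp only [hexp, integral_mul_const]
    rw [Real.log_mul (hX.integral_exp_pos _).ne' (Real.exp_pos _).ne', Real.log_exp, logPartition,
      inner_smul_left]
    simp
    ring
  have htop : Filter.Tendsto (fun k : ℕ =>
      -Real.log (∫ x in X, Real.exp ((k : ℝ) * (inner ℝ n x - inner ℝ n z))))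
      Filter.atTop Filter.atTop := by
    refine Filter.tendsto_neg_atBot_atTop.comp (Real.tendsto_log_nhdsGT_zero.comp ?_)
    exact tendsto_nhdsWithin_iff.2 ⟨hlim, Filter.Eventually.of_forall hpos⟩
  refine EReal.eq_top_iff_forall_lt _ |>.2 fun y => ?_
  obtain ⟨k, hk⟩ := (htop.eventually_gt_atTop y).exists
  rw [hval] at hk
  exact lt_of_lt_of_le (EReal.coe_lt_coe_iff.2 hk) (le_entropicBarrier X _ z)

end IsConvexBody

/-! ### The entropic barrier is an admissible regularizer -/

/-- Iterated derivatives in a fixed direction are the derivatives along the line in this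
direction. -/
theorem hasDerivAt_iteratedFDerivWithin_line {d : ℕ} {S : Set (Euc d)} {f : Euc d → ℝ} {k : ℕ}
    (hd : DifferentiableOn ℝ (iteratedFDerivWithin ℝ k f S) S) {x h : Euc d} {s : ℝ}
    (hx : x + s • h ∈ interior S) :
    HasDerivAt (fun s : ℝ => iteratedFDerivWithin ℝ k f S (x + s • h) (fun _ => h))
      (iteratedFDerivWithin ℝ (k + 1) f S (x + s • h) (fun _ => h)) s := by
  have h1 := (hd _ (interior_subset hx)).hasFDerivWithinAt.hasFDerivAt
    (mem_interior_iff_mem_nhds.1 hx)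
  have h2 := h1.comp_hasDerivAt s (hasDerivAt_add_smul x h s)
  have h3 := (ContinuousMultilinearMap.apply ℝ (fun _ : Fin k => Euc d) ℝ
    (fun _ => h)).hasFDerivAt.comp_hasDerivAt s h2
  exact h3

theorem gradientWithin_eq {d : ℕ} {S : Set (Euc d)} {f : Euc d → ℝ} {g x : Euc d}
    (h : HasFDerivAt f (innerSL ℝ g) x) (hx : S ∈ nhds x) : gradientWithin f S x = g := by
  rw [gradientWithin, fderivWithin_of_mem_nhds hx, h.fderiv]
  refine (InnerProductSpace.toDual ℝ (Euc d)).injective ?_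
  rw [LinearIsometryEquiv.apply_symm_apply]
  ext v
  simp

namespace IsConvexBody

variable {d : ℕ} {X : Set (Euc d)}

theorem diam_pos (hX : IsConvexBody X) (hd : 1 ≤ d) : 0 < Metric.diam X := by
  have h0 : EuclideanSpace.single (⟨0, hd⟩ : Fin d) (1 : ℝ) ≠ 0 := by simp
  have h1 := hX.tiltedMoment_two_pos 0 h0
  have h2 := (le_abs_self _).trans
    (hX.abs_tiltedMoment_le 2 0 (EuclideanSpace.single (⟨0, hd⟩ : Fin d) (1 : ℝ)))
  refine lt_of_le_of_ne Metric.diam_nonneg fun h => ?_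
  rw [← h] at h2
  simp at h2
  linarith

theorem gradientWithin_entropicBarrier (hX : IsConvexBody X) {x : Euc d} (hx : x ∈ interior X) :
    gradientWithin (fun y => (entropicBarrier X y).toReal) (interior X) x = dualPoint X x :=
  gradientWithin_eq (hX.hasFDerivAt_entropicBarrier hx) (isOpen_interior.mem_nhds hx)

/-- Strong convexity of the barrier, dual to the quadratic upper bound on the log-partition
function, whose Hessian is a covariance on a set of diameter `D`. -/
theorem entropicBarrier_quadratic_le (hX : IsConvexBody X) (hD : 0 < Metric.diam X) (x : Euc d)
    {y : Euc d} (hy : y ∈ interior X) :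
    (((entropicBarrier X y).toReal + inner ℝ (dualPoint X y) (x - y)
      + 1 / Metric.diam X ^ 2 / 2 * ‖x - y‖ ^ 2 : ℝ) : EReal) ≤ entropicBarrier X x := by
  set D := Metric.diam X
  -- the maximizer over `θ` of the quadratic lower bound
  refine le_trans ?_ (le_entropicBarrier X (dualPoint X y + (1 / D ^ 2) • (x - y)) x)
  rw [EReal.coe_le_coe_iff, hX.toReal_entropicBarrier hy]
  have h := hX.logPartition_le_quadratic (dualPoint X y) (dualPoint X y + (1 / D ^ 2) • (x - y))
  rw [add_sub_cancel_left, hX.tiltedMean_dualPoint hy, norm_smul,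
    Real.norm_of_nonneg (by positivity), inner_smul_left] at h
  have e : inner ℝ (x - y) x = inner ℝ (x - y) y + ‖x - y‖ ^ 2 := by
    rw [← real_inner_self_eq_norm_sq, ← inner_add_right, add_sub_cancel]
  rw [inner_add_left, inner_smul_left, inner_sub_right, e]
  have e2 : (1 / D ^ 2 * ‖x - y‖ * D) ^ 2 / 2 = 1 / D ^ 2 / 2 * ‖x - y‖ ^ 2 := by
    field_simp
  rw [e2] at h
  simp only [conj_trivial] at h ⊢
  linarith

theorem entropicBarrier_quadratic_le_toReal (hX : IsConvexBody X) (hD : 0 < Metric.diam X)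
    {x y : Euc d} (hx : x ∈ interior X) (hy : y ∈ interior X) :
    (entropicBarrier X y).toReal + inner ℝ (dualPoint X y) (x - y)
      + 1 / Metric.diam X ^ 2 / 2 * ‖x - y‖ ^ 2 ≤ (entropicBarrier X x).toReal := by
  have h := hX.entropicBarrier_quadratic_le hD x hy
  rwa [← hX.coe_toReal_entropicBarrier hx, EReal.coe_le_coe_iff] at h

theorem strictConvexOn_entropicBarrier (hX : IsConvexBody X) (hD : 0 < Metric.diam X) :
    StrictConvexOn ℝ (interior X) (fun x => (entropicBarrier X x).toReal) := by
  refine ⟨hX.convex.interior, fun x hx y hy hxy a b ha hb hab => ?_⟩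
  have hz := hX.convex.interior hx hy ha.le hb.le hab
  have h1 := hX.entropicBarrier_quadratic_le_toReal hD hx hz
  have h2 := hX.entropicBarrier_quadratic_le_toReal hD hy hz
  set z := a • x + b • y with hzd
  have hxz : 0 < ‖x - z‖ := by
    rw [norm_pos_iff]
    have e : x - z = b • (x - y) := by
      rw [hzd, eq_sub_iff_add_eq.2 hab]
      module
    rw [e]
    exact smul_ne_zero hb.ne' (sub_ne_zero.2 hxy)
  have h3 : a * inner ℝ (dualPoint X z) (x - z) + b * inner ℝ (dualPoint X z) (y - z) = 0 := by
    rw [← inner_smul_right, ← inner_smul_right, ← inner_add_right]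
    have e : a • (x - z) + b • (y - z) = 0 := by
      rw [smul_sub, smul_sub, sub_add_sub_comm, ← add_smul, hab, one_smul, hzd, sub_self]
    rw [e, inner_zero_right]
  have h4 : 0 < a * (1 / Metric.diam X ^ 2 / 2 * ‖x - z‖ ^ 2) := by positivity
  have h5 : 0 ≤ b * (1 / Metric.diam X ^ 2 / 2 * ‖y - z‖ ^ 2) := by positivity
  have h6 := mul_le_mul_of_nonneg_left h1 ha.le
  have h7 := mul_le_mul_of_nonneg_left h2 hb.le
  simp only [smul_eq_mul]
  have h8 : (a + b) * (entropicBarrier X z).toReal = (entropicBarrier X z).toReal := by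
    rw [hab, one_mul]
  linarith

theorem convex_epigraph_entropicBarrier (hX : IsConvexBody X) :
    Convex ℝ {p : Euc d × ℝ | p.1 ∈ X ∧ entropicBarrier X p.1 ≤ (p.2 : EReal)} := by
  rintro ⟨x, s⟩ ⟨hx, hs⟩ ⟨y, t⟩ ⟨hy, ht⟩ a b ha hb hab
  refine ⟨hX.convex hx hy ha hb hab, iSup_le fun θ => ?_⟩
  have h1 := EReal.coe_le_coe_iff.1 ((le_entropicBarrier X θ x).trans hs)
  have h2 := EReal.coe_le_coe_iff.1 ((le_entropicBarrier X θ y).trans ht)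
  refine EReal.coe_le_coe_iff.2 ?_
  simp only [Prod.fst_add, Prod.smul_fst, Prod.snd_add, Prod.smul_snd, smul_eq_mul,
    inner_add_right, inner_smul_right] at h1 h2 ⊢
  have h3 : (a + b) * logPartition X θ = logPartition X θ := by rw [hab, one_mul]
  have h4 := mul_le_mul_of_nonneg_left h1 ha
  have h5 := mul_le_mul_of_nonneg_left h2 hb
  linarith

theorem isLegendre_entropicBarrier (hX : IsConvexBody X) (hD : 0 < Metric.diam X) :
    IsLegendre X (entropicBarrier X) where
  convex := hX.convex_epigraph_entropicBarrier
  ne_bot x _ := entropicBarrier_ne_bot X x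
  ne_top x hx := by
    rw [hX.entropicBarrier_of_mem_interior hx]
    exact EReal.coe_ne_top _
  differentiable x hx := (hX.hasFDerivAt_entropicBarrier hx).differentiableAt.differentiableWithinAt
  strictConvex := hX.strictConvexOn_entropicBarrier hD
  gradient_blowup z hz := by
    refine Filter.tendsto_atTop.2 fun R => ?_
    -- the points with a dual point in the ball of radius `R` form a compact subset of the interior
    have hK : IsCompact (tiltedMean X '' Metric.closedBall 0 R) :=
      (isCompact_closedBall 0 R).image (hX.contDiff_tiltedMean 0).continuous
    have hzK : z ∉ tiltedMean X '' Metric.closedBall 0 R := by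
      rintro ⟨θ, -, rfl⟩
      exact hz.2 (hX.tiltedMean_mem_interior θ)
    filter_upwards [mem_nhdsWithin_of_mem_nhds (hK.isClosed.isOpen_compl.mem_nhds hzK),
      self_mem_nhdsWithin] with x hx hxi
    rw [hX.gradientWithin_entropicBarrier hxi]
    by_contra hlt
    refine hx ⟨dualPoint X x, ?_, hX.tiltedMean_dualPoint hxi⟩
    rw [mem_closedBall_zero_iff]
    exact (not_le.1 hlt).le

/-- The convex conjugate of the entropic barrier is the log-partition function. -/
theorem convexConjugate_entropicBarrier (hX : IsConvexBody X) (w : Euc d) :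
    convexConjugate X (entropicBarrier X) w = (logPartition X w : EReal) := by
  refine le_antisymm (iSup₂_le fun x _ => ?_) ?_
  · have h := le_entropicBarrier X w x
    induction hψ : entropicBarrier X x with
    | bot => exact absurd hψ (entropicBarrier_ne_bot X x)
    | top => simp
    | coe r =>
      rw [hψ, EReal.coe_le_coe_iff] at h
      rw [← EReal.coe_sub, EReal.coe_le_coe_iff]
      linarith
  · refine le_trans ?_ (le_iSup₂ (f := fun x (_ : x ∈ X) =>
      ((inner ℝ w x : ℝ) : EReal) - entropicBarrier X x) (tiltedMean X w)
      (interior_subset (hX.tiltedMean_mem_interior w)))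
    rw [hX.entropicBarrier_tiltedMean, ← EReal.coe_sub, EReal.coe_le_coe_iff]
    linarith

theorem thriceDifferentiableOn_logPartition (hX : IsConvexBody X) :
    ThriceDifferentiableOn univ (logPartition X) := by
  intro k hk
  rw [iteratedFDerivWithin_univ, differentiableOn_univ]
  exact (hX.contDiff_logPartition 3).differentiable_iteratedFDeriv (by exact_mod_cast hk)

theorem iteratedFDerivWithin_three_logPartition (hX : IsConvexBody X) (w h : Euc d) :
    iteratedFDerivWithin ℝ 3 (logPartition X) univ w (fun _ => h) = tiltedMoment X 3 w h := by
  have hd := hX.thriceDifferentiableOn_logPartition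
  have hl : ∀ k < 3, ∀ s : ℝ, HasDerivAt
      (fun s : ℝ => iteratedFDerivWithin ℝ k (logPartition X) univ (w + s • h) (fun _ => h))
      (iteratedFDerivWithin ℝ (k + 1) (logPartition X) univ (w + s • h) (fun _ => h)) s :=
    fun k hk s => hasDerivAt_iteratedFDerivWithin_line (hd k hk) (by simp)
  have h1 : ∀ s : ℝ, iteratedFDerivWithin ℝ 1 (logPartition X) univ (w + s • h) (fun _ => h)
      = inner ℝ h (tiltedMean X (w + s • h)) := fun s => by
    refine (hl 0 (by norm_num) s).unique ?_
    simp only [iteratedFDerivWithin_zero_apply]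
    exact hX.hasDerivAt_logPartition_line w h s
  have h2 : ∀ s : ℝ, iteratedFDerivWithin ℝ 2 (logPartition X) univ (w + s • h) (fun _ => h)
      = tiltedMoment X 2 (w + s • h) h := fun s => by
    refine (hl 1 (by norm_num) s).unique ?_
    simp only [h1]
    exact hX.hasDerivAt_inner_tiltedMean_line w h s
  have h3 : iteratedFDerivWithin ℝ 3 (logPartition X) univ (w + (0 : ℝ) • h) (fun _ => h)
      = tiltedMoment X 3 (w + (0 : ℝ) • h) h := by
    refine (hl 2 (by norm_num) 0).unique ?_
    simp only [h2]
    exact hX.hasDerivAt_tiltedMoment_two_line w h 0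
  simpa using h3

theorem isAdmissibleRegularizer_entropicBarrier (hX : IsConvexBody X) (hD : 0 < Metric.diam X) :
    IsAdmissibleRegularizer X (1 / Metric.diam X ^ 2) (Metric.diam X ^ 3)
      (entropicBarrier X) where
  legendre := hX.isLegendre_entropicBarrier hD
  stronglyConvex x _ y hy := by
    rw [hX.gradientWithin_entropicBarrier hy]
    exact hX.entropicBarrier_quadratic_le hD x hy
  conjugate_finite w := by
    rw [hX.convexConjugate_entropicBarrier]
    exact ⟨EReal.coe_ne_top _, EReal.coe_ne_bot _⟩
  conjugate_smooth := by
    simp only [hX.convexConjugate_entropicBarrier, EReal.toReal_coe]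
    refine ⟨hX.thriceDifferentiableOn_logPartition, fun w _ h hh => ?_⟩
    rw [hX.iteratedFDerivWithin_three_logPartition]
    simpa [hh] using hX.abs_tiltedMoment_le 3 w h

end IsConvexBody

/-! ### Self-concordance of the entropic barrier -/

/-- If `|w'| ≤ 2M w^{3/2}`, then `w^{-1/2}` is `M`-Lipschitz; multiplied out, this makes sense
where `w` vanishes as well. -/
theorem sqrt_sub_sqrt_le_of_selfConcordant {S : Set ℝ} (hS : Convex ℝ S) {w w' : ℝ → ℝ} {M : ℝ}
    (hM : 0 ≤ M) (hw : ∀ s ∈ S, 0 ≤ w s) (hd : ∀ s ∈ S, HasDerivAt w (w' s) s)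
    (hsc : ∀ s ∈ S, |w' s| ≤ 2 * M * √(w s) ^ 3) {s t : ℝ} (hs : s ∈ S) (ht : t ∈ S) :
    √(w t) - √(w s) ≤ M * |t - s| * (√(w s) * √(w t)) := by
  -- `w + ε` is positive and satisfies the same inequality
  have key : ∀ ε : ℝ, 0 < ε → √(w t + ε) - √(w s + ε)
      ≤ M * |t - s| * (√(w s + ε) * √(w t + ε)) := by
    intro ε hε
    have hpos : ∀ r ∈ S, 0 < w r + ε := fun r hr => add_pos_of_nonneg_of_pos (hw r hr) hε
    have h1 : ∀ r ∈ S, HasDerivWithinAt (fun r => (√(w r + ε))⁻¹)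
        (-(w' r / (2 * √(w r + ε))) / √(w r + ε) ^ 2) S r := fun r hr =>
      ((((hd r hr).add_const ε).sqrt (hpos r hr).ne').inv
        (Real.sqrt_pos.2 (hpos r hr)).ne').hasDerivWithinAt
    have h2 : ∀ r ∈ S, ‖-(w' r / (2 * √(w r + ε))) / √(w r + ε) ^ 2‖ ≤ M := by
      intro r hr
      have h3 := Real.sqrt_pos.2 (hpos r hr)
      rw [Real.norm_eq_abs, abs_div, abs_neg, abs_div,
        abs_of_pos (by positivity : 0 < 2 * √(w r + ε)),
        abs_of_pos (by positivity : 0 < √(w r + ε) ^ 2), div_div, div_le_iff₀ (by positivity)]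
      refine (hsc r hr).trans ?_
      have h4 : √(w r) ^ 3 ≤ √(w r + ε) ^ 3 := by
        gcongr
        linarith
      nlinarith
    have h3 := hS.norm_image_sub_le_of_norm_hasDerivWithin_le h1 h2 ht hs
    have h4 := Real.sqrt_pos.2 (hpos s hs)
    have h5 := Real.sqrt_pos.2 (hpos t ht)
    rw [Real.norm_eq_abs, Real.norm_eq_abs, abs_sub_comm s t] at h3
    have h6 := (le_abs_self _).trans h3
    have h7 := mul_le_mul_of_nonneg_right h6 (by positivity : 0 ≤ √(w s + ε) * √(w t + ε))
    have e : ((√(w s + ε))⁻¹ - (√(w t + ε))⁻¹) * (√(w s + ε) * √(w t + ε))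
        = √(w t + ε) - √(w s + ε) := by
      field_simp
    linarith
  have hlim : ∀ r,
      Filter.Tendsto (fun ε : ℝ => √(w r + ε)) (nhdsWithin 0 (Ioi 0)) (nhds √(w r)) := by
    intro r
    have : Continuous fun ε : ℝ => √(w r + ε) := by fun_prop
    have h := this.tendsto 0
    rw [add_zero] at h
    exact h.mono_left nhdsWithin_le_nhds
  exact le_of_tendsto_of_tendsto ((hlim t).sub (hlim s))
    (((hlim s).mul (hlim t)).const_mul (M * |t - s|))
    (by filter_upwards [self_mem_nhdsWithin] with ε hε using key ε hε)

/-- The second derivative of a self-concordant function grows at most by a factor of four over a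
short distance in the local norm of the starting point. -/
theorem le_four_mul_of_selfConcordant {S : Set ℝ} (hS : Convex ℝ S) {w w' : ℝ → ℝ} {M : ℝ}
    (hM : 0 ≤ M) (hw : ∀ s ∈ S, 0 ≤ w s) (hd : ∀ s ∈ S, HasDerivAt w (w' s) s)
    (hsc : ∀ s ∈ S, |w' s| ≤ 2 * M * √(w s) ^ 3) {s t : ℝ} (hs : s ∈ S) (ht : t ∈ S)
    (hst : M * |t - s| * √(w s) ≤ 1 / 2) : w t ≤ 4 * w s := by
  have h := sqrt_sub_sqrt_le_of_selfConcordant hS hM hw hd hsc hs ht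
  have h1 : √(w t) ≤ 2 * √(w s) := by
    have := mul_le_mul_of_nonneg_right hst (Real.sqrt_nonneg (w t))
    linarith
  have h2 := pow_le_pow_left₀ (Real.sqrt_nonneg _) h1 2
  rw [mul_pow, Real.sq_sqrt (hw t ht), Real.sq_sqrt (hw s hs)] at h2
  linarith

/-- The second derivative of a self-concordant function drops at most by a factor of four over a
short distance in the local norm of the starting point. -/
theorem le_four_mul_of_selfConcordant' {S : Set ℝ} (hS : Convex ℝ S) {w w' : ℝ → ℝ} {M : ℝ}
    (hM : 0 ≤ M) (hw : ∀ s ∈ S, 0 ≤ w s) (hd : ∀ s ∈ S, HasDerivAt w (w' s) s)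
    (hsc : ∀ s ∈ S, |w' s| ≤ 2 * M * √(w s) ^ 3) {s t : ℝ} (hs : s ∈ S) (ht : t ∈ S)
    (hst : M * |t - s| * √(w s) ≤ 1) : w s ≤ 4 * w t := by
  have h := sqrt_sub_sqrt_le_of_selfConcordant hS hM hw hd hsc ht hs
  rw [abs_sub_comm] at h
  have h1 : √(w s) ≤ 2 * √(w t) := by
    have := mul_le_mul_of_nonneg_right hst (Real.sqrt_nonneg (w t))
    linarith
  have h2 := pow_le_pow_left₀ (Real.sqrt_nonneg _) h1 2
  rw [mul_pow, Real.sq_sqrt (hw t ht), Real.sq_sqrt (hw s hs)] at h2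
  linarith

/-- The second derivative of the entropic barrier at `x` in the direction `h`. -/
noncomputable def barrierHess {d : ℕ} (X : Set (Euc d)) (x h : Euc d) : ℝ :=
  inner ℝ (fderiv ℝ (dualPoint X) x h) h

/-- The third derivative of the entropic barrier at `x` in the direction `h`. -/
noncomputable def barrierThird {d : ℕ} (X : Set (Euc d)) (x h : Euc d) : ℝ :=
  -tiltedMoment X 3 (dualPoint X x) (fderiv ℝ (dualPoint X) x h)

namespace IsConvexBody

variable {d : ℕ} {X : Set (Euc d)}

theorem inner_fderiv_tiltedMean_comm (hX : IsConvexBody X) (θ u v : Euc d) :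
    inner ℝ v (fderiv ℝ (tiltedMean X) θ u) = inner ℝ u (fderiv ℝ (tiltedMean X) θ v) := by
  have hm : fderiv ℝ (tiltedMean X) θ = _ :=
    (hX.hasFDerivAt_integral_tiltedUniform continuous_id θ).fderiv
  simp only [id_eq] at hm
  have hc : Continuous fun x : Euc d => (innerSL ℝ x).smulRight x :=
    (ContinuousLinearMap.smulRightL ℝ (Euc d) (Euc d)).continuous₂.comp
      ((innerSL ℝ).continuous.prodMk continuous_id)
  have key : ∀ u v : Euc d, inner ℝ v (fderiv ℝ (tiltedMean X) θ u)
      = (∫ x, inner ℝ x u * inner ℝ v x ∂(tiltedUniform X θ))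
        - (∫ x, inner ℝ x u ∂(tiltedUniform X θ)) * inner ℝ v (tiltedMean X θ) := by
    intro u v
    rw [hm, sub_apply, ContinuousLinearMap.smulRight_apply, inner_sub_right, inner_smul_right,
      ContinuousLinearMap.integral_apply (hX.integrable_tiltedUniform hc _),
      ContinuousLinearMap.integral_apply
        (hX.integrable_tiltedUniform (innerSL ℝ).continuous _), ← integral_inner]
    · simp [inner_smul_right, tiltedMean]
    · exact hX.integrable_tiltedUniform (hc.clm_apply continuous_const) _
  rw [key, key, hX.inner_tiltedMean, hX.inner_tiltedMean, mul_comm]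
  simp only [real_inner_comm, mul_comm]

theorem differentiableAt_dualPoint (hX : IsConvexBody X) {x : Euc d} (hx : x ∈ interior X) :
    DifferentiableAt ℝ (dualPoint X) x :=
  (hX.contDiffAt_dualPoint hx 0).differentiableAt (by norm_num)

theorem fderiv_tiltedMean_fderiv_dualPoint (hX : IsConvexBody X) {x : Euc d} (hx : x ∈ interior X)
    (h : Euc d) :
    fderiv ℝ (tiltedMean X) (dualPoint X x) (fderiv ℝ (dualPoint X) x h) = h := by
  have h1 : HasFDerivAt (tiltedMean X) (fderiv ℝ (tiltedMean X) (dualPoint X x)) (dualPoint X x) :=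
    ((hX.contDiff_tiltedMean 1).differentiable (by norm_num) _).hasFDerivAt
  have h2 := h1.comp x (hX.differentiableAt_dualPoint hx).hasFDerivAt
  have h3 : HasFDerivAt (tiltedMean X ∘ dualPoint X) (ContinuousLinearMap.id ℝ (Euc d)) x := by
    refine (hasFDerivAt_id x).congr_of_eventuallyEq ?_
    filter_upwards [isOpen_interior.mem_nhds hx] with y hy
    exact hX.tiltedMean_dualPoint hy
  exact congrArg (fun L : Euc d →L[ℝ] Euc d => L h) (h2.unique h3)

theorem barrierHess_eq (hX : IsConvexBody X) {x : Euc d} (hx : x ∈ interior X) (h : Euc d) :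
    barrierHess X x h
      = tiltedMoment X 2 (dualPoint X x) (fderiv ℝ (dualPoint X) x h) := by
  rw [← hX.inner_fderiv_tiltedMean, hX.fderiv_tiltedMean_fderiv_dualPoint hx, barrierHess]

theorem barrierHess_nonneg (hX : IsConvexBody X) {x : Euc d} (hx : x ∈ interior X) (h : Euc d) :
    0 ≤ barrierHess X x h := by
  rw [hX.barrierHess_eq hx]
  exact integral_nonneg fun x => sq_nonneg _

/-- Self-concordance of the entropic barrier, with an absolute constant. -/
theorem abs_barrierThird_le (hX : IsConvexBody X) {x : Euc d} (hx : x ∈ interior X) (h : Euc d) :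
    |barrierThird X x h| ≤ 2 * (thirdMomentConst / 2) * √(barrierHess X x h) ^ 3 := by
  rw [hX.barrierHess_eq hx, barrierThird, abs_neg]
  convert hX.abs_tiltedMoment_three_le _ _ using 2
  ring

theorem hasDerivAt_entropicBarrier_line (hX : IsConvexBody X) {x h : Euc d} {s : ℝ}
    (hx : x + s • h ∈ interior X) :
    HasDerivAt (fun s : ℝ => (entropicBarrier X (x + s • h)).toReal)
      (inner ℝ (dualPoint X (x + s • h)) h) s := by
  have h1 := (hX.hasFDerivAt_entropicBarrier hx).comp_hasDerivAt s (hasDerivAt_add_smul x h s)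
  exact h1

theorem hasDerivAt_dualPoint_line (hX : IsConvexBody X) {x h : Euc d} {s : ℝ}
    (hx : x + s • h ∈ interior X) :
    HasDerivAt (fun s : ℝ => dualPoint X (x + s • h))
      (fderiv ℝ (dualPoint X) (x + s • h) h) s :=
  (hX.differentiableAt_dualPoint hx).hasFDerivAt.comp_hasDerivAt s (hasDerivAt_add_smul x h s)

theorem hasDerivAt_inner_dualPoint_line (hX : IsConvexBody X) {x h : Euc d} {s : ℝ}
    (hx : x + s • h ∈ interior X) :
    HasDerivAt (fun s : ℝ => inner ℝ (dualPoint X (x + s • h)) h)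
      (barrierHess X (x + s • h) h) s := by
  refine ((hX.hasDerivAt_dualPoint_line hx).inner ℝ (hasDerivAt_const s h)).congr_deriv ?_
  simp [barrierHess]

/-- The third derivative of the barrier comes from differentiating `∇²A(θ(s)) θ'(s) = h`, where
`θ(s)` is the dual point of `x + s h`. -/
theorem hasDerivAt_barrierHess_line (hX : IsConvexBody X) {x h : Euc d} {s : ℝ}
    (hx : x + s • h ∈ interior X) :
    HasDerivAt (fun s : ℝ => barrierHess X (x + s • h) h)
      (barrierThird X (x + s • h) h) s := by
  set θ : ℝ → Euc d := fun s => dualPoint X (x + s • h) with hθ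
  set u : ℝ → Euc d := fun s => fderiv ℝ (dualPoint X) (x + s • h) h with hu
  have hdu : DifferentiableAt ℝ u s := by
    have h1 : ContDiffAt ℝ 1 (fderiv ℝ (dualPoint X)) (x + s • h) :=
      (hX.contDiffAt_dualPoint hx 1).fderiv_right (m := 1) (by norm_num)
    have h2 := (h1.differentiableAt (by norm_num)).comp s
      (hasDerivAt_add_smul x h s).differentiableAt
    exact h2.clm_apply (differentiableAt_const h)
  have hm : Differentiable ℝ (fderiv ℝ (tiltedMean X)) :=
    ((hX.contDiff_tiltedMean 2).fderiv_right (m := 1) (by norm_num)).differentiable (by norm_num)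
  -- the variance in the fixed direction `u s`, along the dual curve
  have hB : HasDerivAt (fun r => fderiv ℝ (tiltedMean X) (θ r))
      (fderiv ℝ (fderiv ℝ (tiltedMean X)) (θ s) (u s)) s :=
    (hm (θ s)).hasFDerivAt.comp_hasDerivAt s (hX.hasDerivAt_dualPoint_line hx)
  have h3 : inner ℝ (u s) (fderiv ℝ (fderiv ℝ (tiltedMean X)) (θ s) (u s) (u s))
      = tiltedMoment X 3 (θ s) (u s) := by
    have h4 : HasFDerivAt (fderiv ℝ (tiltedMean X))
        (fderiv ℝ (fderiv ℝ (tiltedMean X)) (θ s + (0 : ℝ) • u s)) (θ s + (0 : ℝ) • u s) :=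
      (hm _).hasFDerivAt
    have h5 := h4.comp_hasDerivAt (0 : ℝ) (hasDerivAt_add_smul (θ s) (u s) 0)
    have h6 := (hasDerivAt_const (0 : ℝ) (u s)).inner ℝ
      (h5.clm_apply (hasDerivAt_const (0 : ℝ) (u s)))
    have h7 := hX.hasDerivAt_tiltedMoment_two_line (θ s) (u s) 0
    simp only [← hX.inner_fderiv_tiltedMean] at h7
    have h8 := h6.unique h7
    simpa using h8
  have h9 := (hasDerivAt_const s (u s)).inner ℝ (hB.clm_apply hdu.hasDerivAt)
  have h10 : HasDerivAt (fun r => inner ℝ (u s) (fderiv ℝ (tiltedMean X) (θ r) (u r))) 0 s := by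
    refine (hasDerivAt_const s (inner ℝ (u s) h)).congr_of_eventuallyEq ?_
    have hc : ContinuousAt (fun r : ℝ => x + r • h) s := (hasDerivAt_add_smul x h s).continuousAt
    filter_upwards [hc.preimage_mem_nhds (isOpen_interior.mem_nhds hx)] with r hr
    rw [hX.fderiv_tiltedMean_fderiv_dualPoint hr]
  have h11 := h9.unique h10
  rw [inner_zero_left, add_zero, inner_add_right, h3, hX.inner_fderiv_tiltedMean_comm,
    hX.fderiv_tiltedMean_fderiv_dualPoint hx] at h11
  refine (hdu.hasDerivAt.inner ℝ (hasDerivAt_const s h)).congr_deriv ?_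
  rw [inner_zero_right, zero_add, barrierThird]
  linarith

/-- Dikin's ellipsoid: a step that is short in the local norm of the barrier stays inside. -/
theorem add_smul_mem_interior (hX : IsConvexBody X) {x : Euc d} (hx : x ∈ interior X) (h : Euc d)
    {R : ℝ} (hR : 0 ≤ R) (hle : thirdMomentConst / 2 * R * √(barrierHess X x h) ≤ 1 / 2) :
    x + R • h ∈ interior X := by
  by_contra hout
  have hκ := thirdMomentConst_pos
  set S : Set ℝ := Icc 0 R ∩ (fun r : ℝ => x + r • h) ⁻¹' (interior X)ᶜ with hS
  have hSc : IsCompact S := isCompact_Icc.inter_right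
    (isOpen_interior.isClosed_compl.preimage (by fun_prop))
  obtain ⟨b, hbS, hb⟩ := hSc.exists_isLeast ⟨R, ⟨hR, le_rfl⟩, hout⟩
  have hin : ∀ r ∈ Ico 0 b, x + r • h ∈ interior X := by
    intro r hr
    by_contra hr'
    exact absurd (hb ⟨⟨hr.1, hr.2.le.trans hbS.1.2⟩, hr'⟩) (not_le.2 hr.2)
  have hb0 : 0 < b := by
    refine lt_of_le_of_ne hbS.1.1 fun h0 => hbS.2 ?_
    rw [← h0]
    simpa using hx
  set P := barrierHess X x h with hP
  have hess : ∀ r ∈ Ico 0 b, barrierHess X (x + r • h) h ≤ 4 * P := by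
    intro r hr
    have h1 := le_four_mul_of_selfConcordant (convex_Ico 0 b) (by positivity)
      (fun r hr => hX.barrierHess_nonneg (hin r hr) h)
      (fun r hr => hX.hasDerivAt_barrierHess_line (hin r hr))
      (fun r hr => hX.abs_barrierThird_le (hin r hr) h) (s := 0) (left_mem_Ico.2 hb0) hr (by
        rw [zero_smul, add_zero, sub_zero, abs_of_nonneg hr.1]
        refine le_trans ?_ hle
        have := hr.2.le.trans hbS.1.2
        gcongr)
    simpa using h1
  have hP0 : 0 ≤ P := hX.barrierHess_nonneg hx h
  have hslope : ∀ r ∈ Ico 0 b, inner ℝ (dualPoint X (x + r • h)) h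
      ≤ inner ℝ (dualPoint X x) h + 4 * P * b := by
    intro r hr
    have h1 := (convex_Ico 0 b).norm_image_sub_le_of_norm_hasDerivWithin_le
      (f := fun r : ℝ => inner ℝ (dualPoint X (x + r • h)) h) (C := 4 * P)
      (fun r hr => (hX.hasDerivAt_inner_dualPoint_line (hin r hr)).hasDerivWithinAt)
      (fun r hr => by
        rw [Real.norm_of_nonneg (hX.barrierHess_nonneg (hin r hr) h)]
        exact hess r hr) (left_mem_Ico.2 hb0) hr
    simp only [zero_smul, add_zero, sub_zero] at h1
    rw [Real.norm_of_nonneg hr.1] at h1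
    have h2 := (le_abs_self _).trans h1
    have h3 : 4 * P * r ≤ 4 * P * b := by
      have := hr.2.le
      gcongr
    linarith
  set c := |inner ℝ (dualPoint X x) h + 4 * P * b| with hc
  -- the barrier stays bounded up to the exit point, against its lower semicontinuity
  have hbound : entropicBarrier X (x + b • h)
      ≤ (((entropicBarrier X x).toReal + b * c : ℝ) : EReal) := by
    refine iSup_le fun θ => EReal.coe_le_coe_iff.2 ?_
    have hle : ∀ r ∈ Ico 0 b, inner ℝ θ (x + r • h) - logPartition X θ
        ≤ (entropicBarrier X x).toReal + b * c := by
      intro r hr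
      have h1 := le_entropicBarrier X θ (x + r • h)
      rw [← hX.coe_toReal_entropicBarrier (hin r hr), EReal.coe_le_coe_iff,
        hX.toReal_entropicBarrier (hin r hr)] at h1
      have h2 := le_entropicBarrier X (dualPoint X (x + r • h)) x
      rw [← hX.coe_toReal_entropicBarrier hx, EReal.coe_le_coe_iff] at h2
      have h3 : r * inner ℝ (dualPoint X (x + r • h)) h ≤ b * c := by
        refine mul_le_mul_of_nonneg_left ((hslope r hr).trans (le_abs_self _)) hr.1 |>.trans ?_
        have := hr.2.le
        gcongr
      have h4 : inner ℝ (dualPoint X (x + r • h)) (x + r • h)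
          = inner ℝ (dualPoint X (x + r • h)) x + r * inner ℝ (dualPoint X (x + r • h)) h := by
        rw [inner_add_right, inner_smul_right]
      linarith
    have hcont : Continuous fun r : ℝ => inner ℝ θ (x + r • h) - logPartition X θ := by fun_prop
    have hcl : IsClosed {r : ℝ | inner ℝ θ (x + r • h) - logPartition X θ
        ≤ (entropicBarrier X x).toReal + b * c} := isClosed_le hcont continuous_const
    have hmem : b ∈ closure (Ico 0 b) := by
      rw [closure_Ico hb0.ne]
      exact right_mem_Icc.2 hb0.le
    exact hcl.closure_subset_iff.2 hle hmem
  rw [hX.entropicBarrier_eq_top hbS.2] at hbound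
  exact EReal.coe_ne_top _ (top_le_iff.1 hbound)

end IsConvexBody

/-! ### Estimates on a segment -/

/-- Error of the trapezoidal rule, with a crude constant. -/
theorem abs_trapezoid_le {a a₁ a₂ a₃ : ℝ → ℝ} (h0 : ∀ s ∈ Icc (0 : ℝ) 1, HasDerivAt a (a₁ s) s)
    (h1 : ∀ s ∈ Icc (0 : ℝ) 1, HasDerivAt a₁ (a₂ s) s)
    (h2 : ∀ s ∈ Icc (0 : ℝ) 1, HasDerivAt a₂ (a₃ s) s) {B : ℝ}
    (hB : ∀ s ∈ Icc (0 : ℝ) 1, |a₃ s| ≤ B) :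
    |a 1 - a 0 - (a₁ 0 + a₁ 1) / 2| ≤ B / 2 := by
  have m0 : (0 : ℝ) ∈ Icc (0 : ℝ) 1 := ⟨le_rfl, zero_le_one⟩
  have m1 : (1 : ℝ) ∈ Icc (0 : ℝ) 1 := ⟨zero_le_one, le_rfl⟩
  have d1 : ∀ s ∈ Icc (0 : ℝ) 1, HasDerivWithinAt (fun s => (a₁ s - a₁ 0 - s * a₂ s) / 2)
      (-(s * a₃ s) / 2) (Icc 0 1) s := fun s hs => by
    have := ((((h1 s hs).sub_const (a₁ 0)).sub ((hasDerivAt_id s).mul (h2 s hs))).div_const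
      2).hasDerivWithinAt (s := Icc (0 : ℝ) 1)
    refine this.congr_deriv ?_
    simp
  have b1 : ∀ s ∈ Icc (0 : ℝ) 1, ‖-(s * a₃ s) / 2‖ ≤ B / 2 := fun s hs => by
    rw [Real.norm_eq_abs, abs_div, abs_neg, abs_mul, abs_of_nonneg hs.1, abs_two]
    have h3 := hB s hs
    have h4 := abs_nonneg (a₃ s)
    have h5 : s * |a₃ s| ≤ 1 * |a₃ s| := by
      gcongr
      exact hs.2
    linarith
  have b2 : ∀ s ∈ Icc (0 : ℝ) 1, ‖(a₁ s - a₁ 0 - s * a₂ s) / 2‖ ≤ B / 2 := fun s hs => by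
    have h := (convex_Icc (0 : ℝ) 1).norm_image_sub_le_of_norm_hasDerivWithin_le d1 b1 m0 hs
    simp only [sub_self, zero_mul, zero_div, sub_zero] at h
    refine h.trans ?_
    rw [Real.norm_of_nonneg hs.1]
    have : 0 ≤ B / 2 := (norm_nonneg _).trans (b1 0 m0)
    nlinarith [hs.2]
  have d2 : ∀ s ∈ Icc (0 : ℝ) 1, HasDerivWithinAt (fun s => a s - s / 2 * (a₁ 0 + a₁ s))
      ((a₁ s - a₁ 0 - s * a₂ s) / 2) (Icc 0 1) s := fun s hs => by
    have := ((h0 s hs).sub (((hasDerivAt_id s).div_const 2).mul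
      ((h1 s hs).const_add (a₁ 0)))).hasDerivWithinAt (s := Icc (0 : ℝ) 1)
    refine this.congr_deriv ?_
    simp
    ring
  have h := (convex_Icc (0 : ℝ) 1).norm_image_sub_le_of_norm_hasDerivWithin_le d2 b2 m0 m1
  rw [Real.norm_eq_abs] at h
  have e : a 1 - a 0 - (a₁ 0 + a₁ 1) / 2
      = a 1 - 1 / 2 * (a₁ 0 + a₁ 1) - (a 0 - 0 / 2 * (a₁ 0 + a₁ 0)) := by ring
  rw [e]
  simpa using h

theorem monotoneOn_of_hasDerivAt_nonneg {a a' : ℝ → ℝ} {S : Set ℝ} (hS : Convex ℝ S)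
    (h : ∀ s ∈ S, HasDerivAt a (a' s) s) (h0 : ∀ s ∈ S, 0 ≤ a' s) : MonotoneOn a S := by
  refine monotoneOn_of_deriv_nonneg hS (fun s hs => (h s hs).continuousAt.continuousWithinAt)
    (fun s hs => (h s (interior_subset hs)).differentiableAt.differentiableWithinAt) fun s hs => ?_
  rw [(h s (interior_subset hs)).deriv]
  exact h0 s (interior_subset hs)

/-- A self-concordant function with bounded slope on an interval of length `R` has bounded second
derivative at the endpoint: a large second derivative would persist and make the slope grow. -/
theorem second_deriv_le_of_slope_le {φ₁ φ₂ φ₃ : ℝ → ℝ} {R C G : ℝ} (hR : 0 < R) (hC : 0 ≤ C)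
    (h1 : ∀ s ∈ Icc 0 R, HasDerivAt φ₁ (φ₂ s) s) (h2 : ∀ s ∈ Icc 0 R, HasDerivAt φ₂ (φ₃ s) s)
    (hφ : ∀ s ∈ Icc 0 R, 0 ≤ φ₂ s) (hsc : ∀ s ∈ Icc 0 R, |φ₃ s| ≤ 2 * C * √(φ₂ s) ^ 3)
    (hG : ∀ s ∈ Icc 0 R, |φ₁ s| ≤ G) : φ₂ 0 ≤ 8 * G / R + 64 * C ^ 2 * G ^ 2 := by
  have m0 : (0 : ℝ) ∈ Icc 0 R := ⟨le_rfl, hR.le⟩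
  have hG0 : 0 ≤ G := (abs_nonneg _).trans (hG 0 m0)
  have key : ∀ r : ℝ, 0 < r → r ≤ R → C * r * √(φ₂ 0) ≤ 1 → φ₂ 0 * r ≤ 8 * G := by
    intro r hr hrR hle
    have hlow : ∀ s ∈ Icc 0 r, φ₂ 0 ≤ 4 * φ₂ s := by
      intro s hs
      refine le_four_mul_of_selfConcordant' (convex_Icc 0 R) hC hφ h2 hsc m0
        ⟨hs.1, hs.2.trans hrR⟩ (le_trans ?_ hle)
      rw [sub_zero, abs_of_nonneg hs.1]
      have := hs.2
      gcongr
    obtain ⟨ξ, hξ, he⟩ := exists_hasDerivAt_eq_slope φ₁ φ₂ hr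
      (fun s hs => (h1 s ⟨hs.1, hs.2.trans hrR⟩).continuousAt.continuousWithinAt)
      (fun s hs => h1 s ⟨hs.1.le, hs.2.le.trans hrR⟩)
    have h3 := hlow ξ ⟨hξ.1.le, hξ.2.le⟩
    rw [sub_zero, eq_div_iff hr.ne'] at he
    have h4 := (abs_le.1 (hG 0 m0)).1
    have h5 := (abs_le.1 (hG r ⟨hr.le, hrR⟩)).2
    nlinarith
  rcases le_or_gt (C * R * √(φ₂ 0)) 1 with h | h
  · have h3 : φ₂ 0 ≤ 8 * G / R := by
      rw [le_div_iff₀ hR]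
      exact key R hR le_rfl h
    have : 0 ≤ 64 * C ^ 2 * G ^ 2 := by positivity
    linarith
  · have hs : 0 < √(φ₂ 0) := by
      by_contra h0
      have : √(φ₂ 0) = 0 := le_antisymm (not_lt.1 h0) (Real.sqrt_nonneg _)
      rw [this] at h
      simp at h
      linarith
    have hC0 : 0 < C := by
      rcases hC.eq_or_lt with h0 | h0
      · rw [← h0] at h
        simp at h
        linarith
      · exact h0
    have h4 := key (1 / (C * √(φ₂ 0))) (by positivity) (by
      rw [div_le_iff₀ (by positivity)]
      nlinarith) (by
      field_simp
      exact le_rfl)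
    have h5 : φ₂ 0 * (1 / (C * √(φ₂ 0))) = √(φ₂ 0) / C := by
      nth_rw 1 [← Real.sq_sqrt (hφ 0 m0)]
      field_simp
    rw [h5, div_le_iff₀ hC0] at h4
    have h6 := pow_le_pow_left₀ hs.le h4 2
    rw [Real.sq_sqrt (hφ 0 m0)] at h6
    have : 0 ≤ 8 * G / R := by positivity
    nlinarith

theorem sqrt_pow_three_div_eq {η : ℝ} (hη : 0 < η) (x : ℝ) :
    √x ^ 3 / η = √η * √(x / η) ^ 3 := by
  rw [Real.sqrt_div' _ hη.le, div_pow]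
  have h1 := Real.sq_sqrt hη.le
  have h2 := Real.sqrt_pos.2 hη
  have e : √η ^ 3 = √η * η := by
    rw [pow_succ, h1, mul_comm]
  rw [e]
  field_simp

set_option maxHeartbeats 800000 in
/-- The per-round estimate, for the restrictions to the segment between two consecutive decisions:
`p` is the barrier, `q` the sum of the past losses and `φ` the current loss.
The segment has length `l`. The hypothesis `hcurv` bounds the second derivative of `φ` as soon as
`R` times the step stays in Dikin's ellipsoid, where the slope of `φ` has room to grow. -/
theorem round_estimate {p p₁ p₂ p₃ q q₁ q₂ q₃ φ φ₁ φ₂ φ₃ : ℝ → ℝ} {η k C L D l : ℝ} (hη : 0 < η)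
    (hk : 0 < k) (hC : 0 ≤ C) (hL : 0 < L) (hD : 0 < D) (hl : 0 ≤ l)
    (hp : ∀ s ∈ Icc (0 : ℝ) 1, HasDerivAt p (p₁ s) s ∧ HasDerivAt p₁ (p₂ s) s ∧
      HasDerivAt p₂ (p₃ s) s ∧ 0 ≤ p₂ s ∧ |p₃ s| ≤ 2 * k * √(p₂ s) ^ 3)
    (hq : ∀ s ∈ Icc (0 : ℝ) 1, HasDerivAt q (q₁ s) s ∧ HasDerivAt q₁ (q₂ s) s ∧
      HasDerivAt q₂ (q₃ s) s ∧ 0 ≤ q₂ s ∧ |q₃ s| ≤ 2 * C * √(q₂ s) ^ 3)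
    (hφ : ∀ s ∈ Icc (0 : ℝ) 1, HasDerivAt φ (φ₁ s) s ∧ HasDerivAt φ₁ (φ₂ s) s ∧
      HasDerivAt φ₂ (φ₃ s) s ∧ 0 ≤ φ₂ s ∧ |φ₃ s| ≤ 2 * C * √(φ₂ s) ^ 3)
    (hslope : ∀ s ∈ Icc (0 : ℝ) 1, |φ₁ s| ≤ L * l)
    (hstat0 : p₁ 0 / η + q₁ 0 = 0) (hstat1 : p₁ 1 / η + q₁ 1 + φ₁ 1 = 0)
    (hstrong : l ^ 2 / D ^ 2 ≤ p₁ 1 - p₁ 0)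
    (hcurv : ∀ s ∈ Icc (0 : ℝ) 1, ∀ R, 0 < R → k * R * √(p₂ s) ≤ 1 / 2 →
      φ₂ s ≤ 8 * (L * l) / R + 64 * C ^ 2 * (L * l) ^ 2) :
    φ 0 + φ 1 + 2 * (p 0 / η + q 0) - 2 * (p 1 / η + q 1 + φ 1)
      ≤ 36 * (k * η * D * L + 3 * C * √η * D * L) * (η * D ^ 2 * L ^ 2) := by
  have m0 : (0 : ℝ) ∈ Icc (0 : ℝ) 1 := ⟨le_rfl, zero_le_one⟩
  have m1 : (1 : ℝ) ∈ Icc (0 : ℝ) 1 := ⟨zero_le_one, le_rfl⟩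
  -- the average of the objectives of two consecutive rounds
  set a : ℝ → ℝ := fun s => p s / η + q s + φ s / 2 with ha
  set a₁ : ℝ → ℝ := fun s => p₁ s / η + q₁ s + φ₁ s / 2 with ha₁
  set a₂ : ℝ → ℝ := fun s => p₂ s / η + q₂ s + φ₂ s / 2 with ha₂
  set a₃ : ℝ → ℝ := fun s => p₃ s / η + q₃ s + φ₃ s / 2 with ha₃
  have da : ∀ s ∈ Icc (0 : ℝ) 1, HasDerivAt a (a₁ s) s := fun s hs =>
    (((hp s hs).1.div_const η).add (hq s hs).1).add ((hφ s hs).1.div_const 2)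
  have da₁ : ∀ s ∈ Icc (0 : ℝ) 1, HasDerivAt a₁ (a₂ s) s := fun s hs =>
    (((hp s hs).2.1.div_const η).add (hq s hs).2.1).add ((hφ s hs).2.1.div_const 2)
  have da₂ : ∀ s ∈ Icc (0 : ℝ) 1, HasDerivAt a₂ (a₃ s) s := fun s hs =>
    (((hp s hs).2.2.1.div_const η).add (hq s hs).2.2.1).add ((hφ s hs).2.2.1.div_const 2)
  have hp0 : ∀ s ∈ Icc (0 : ℝ) 1, 0 ≤ p₂ s / η := fun s hs => div_nonneg (hp s hs).2.2.2.1 hη.le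
  have hq0 : ∀ s ∈ Icc (0 : ℝ) 1, 0 ≤ q₂ s := fun s hs => (hq s hs).2.2.2.1
  have hφ0 : ∀ s ∈ Icc (0 : ℝ) 1, 0 ≤ φ₂ s := fun s hs => (hφ s hs).2.2.2.1
  have ha0 : ∀ s ∈ Icc (0 : ℝ) 1, 0 ≤ a₂ s := fun s hs => by
    have := hp0 s hs
    have := hq0 s hs
    have := hφ0 s hs
    simp only [ha₂]
    linarith
  set M := k * √η + 3 * C with hM
  have hsη := Real.sqrt_pos.2 hη
  have hM0 : 0 < M := by positivity
  have hsc : ∀ s ∈ Icc (0 : ℝ) 1, |a₃ s| ≤ 2 * M * √(a₂ s) ^ 3 := by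
    intro s hs
    have e1 := hp0 s hs
    have e2 := hq0 s hs
    have e3 := hφ0 s hs
    have b1 : |p₃ s / η| ≤ 2 * k * √η * √(a₂ s) ^ 3 := by
      rw [abs_div, abs_of_pos hη]
      calc |p₃ s| / η ≤ 2 * k * √(p₂ s) ^ 3 / η := by
            gcongr
            exact (hp s hs).2.2.2.2
        _ = 2 * k * √η * √(p₂ s / η) ^ 3 := by
            rw [mul_div_assoc, sqrt_pow_three_div_eq hη]
            ring
        _ ≤ _ := by
            gcongr
            simp only [ha₂]
            linarith
    have b2 : |q₃ s| ≤ 2 * C * √(a₂ s) ^ 3 := by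
      refine (hq s hs).2.2.2.2.trans ?_
      gcongr
      simp only [ha₂]
      linarith
    have b3 : |φ₃ s / 2| ≤ 4 * C * √(a₂ s) ^ 3 := by
      rw [abs_div, abs_two]
      have h2 : √(2 : ℝ) ≤ 2 := by
        rw [Real.sqrt_le_left (by norm_num)]
        norm_num
      calc |φ₃ s| / 2 ≤ 2 * C * √(φ₂ s) ^ 3 / 2 := by
            gcongr
            exact (hφ s hs).2.2.2.2
        _ = 2 * C * √2 * √(φ₂ s / 2) ^ 3 := by
            rw [mul_div_assoc, sqrt_pow_three_div_eq two_pos]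
            ring
        _ ≤ 2 * C * 2 * √(a₂ s) ^ 3 := by
            gcongr
            simp only [ha₂]
            linarith
        _ = _ := by ring
    calc |a₃ s| ≤ |p₃ s / η| + |q₃ s| + |φ₃ s / 2| := abs_add_three _ _ _
      _ ≤ _ := by
        rw [hM]
        linarith
  have hmono : MonotoneOn a₁ (Icc 0 1) :=
    monotoneOn_of_hasDerivAt_nonneg (convex_Icc 0 1) da₁ ha0
  have hqm : q₁ 0 ≤ q₁ 1 := monotoneOn_of_hasDerivAt_nonneg (convex_Icc 0 1)
    (fun s hs => (hq s hs).2.1) hq0 m0 m1 zero_le_one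
  have hφm : φ₁ 0 ≤ φ₁ 1 := monotoneOn_of_hasDerivAt_nonneg (convex_Icc 0 1)
    (fun s hs => (hφ s hs).2.1) hφ0 m0 m1 zero_le_one
  have ea0 : a₁ 0 = φ₁ 0 / 2 := by
    simp only [ha₁]
    linarith
  have ea1 : a₁ 1 = -(φ₁ 1 / 2) := by
    simp only [ha₁]
    linarith
  have s0 := abs_le.1 (hslope 0 m0)
  have s1 := abs_le.1 (hslope 1 m1)
  set W := a₁ 1 - a₁ 0 with hW
  have hWl : W ≤ L * l := by
    rw [hW, ea0, ea1]
    linarith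
  have hlW : l ^ 2 / D ^ 2 / η ≤ W := by
    have h1 : l ^ 2 / D ^ 2 / η ≤ (p₁ 1 - p₁ 0) / η := by gcongr
    rw [sub_div] at h1
    simp only [hW, ha₁]
    linarith
  have hlb : l ≤ η * D ^ 2 * L := by
    rcases hl.eq_or_lt with h0 | h0
    · rw [← h0]
      positivity
    · have h1 := hlW.trans hWl
      rw [div_div, div_le_iff₀ (by positivity)] at h1
      have h2 : l * l ≤ l * (η * D ^ 2 * L) := by linarith
      exact le_of_mul_le_mul_left h2 h0
  set W' := η * D ^ 2 * L ^ 2 with hW'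
  have hLl : L * l ≤ W' := by
    calc L * l ≤ L * (η * D ^ 2 * L) := by gcongr
      _ = W' := by ring
  have hW'0 : 0 < W' := by positivity
  have hsW : √W' = √η * D * L := by
    rw [hW', Real.sqrt_eq_iff_mul_self_eq (by positivity) (by positivity)]
    have := Real.mul_self_sqrt hη.le
    calc η * D ^ 2 * L ^ 2 = (√η * √η) * D ^ 2 * L ^ 2 := by rw [this]
      _ = _ := by ring
  set N := k * η * D * L + 3 * C * √η * D * L with hN
  have hMN : M * √W' = N := by
    rw [hsW, hM, hN]
    have := Real.mul_self_sqrt hη.le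
    calc (k * √η + 3 * C) * (√η * D * L) = k * (√η * √η) * D * L + 3 * C * √η * D * L := by ring
      _ = _ := by rw [this]
  have hN0 : 0 < N := by
    rw [← hMN]
    have := Real.sqrt_pos.2 hW'0
    positivity
  -- in terms of `a` the contribution of the round is twice the decrease of `a`
  have hE : φ 0 + φ 1 + 2 * (p 0 / η + q 0) - 2 * (p 1 / η + q 1 + φ 1) = 2 * (a 0 - a 1) := by
    simp only [ha]
    ring
  rw [hE]
  rcases lt_or_ge (1 / 2) N with hbig | hsmall
  · -- the first-order estimate suffices
    obtain ⟨ξ, hξ, he⟩ := exists_hasDerivAt_eq_slope a a₁ zero_lt_one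
      (fun s hs => (da s hs).continuousAt.continuousWithinAt)
      (fun s hs => da s ⟨hs.1.le, hs.2.le⟩)
    have h1 := hmono m0 ⟨hξ.1.le, hξ.2.le⟩ hξ.1.le
    rw [he, ea0] at h1
    simp only [sub_zero, div_one] at h1
    have h2 : 1 / 2 * W' ≤ N * W' := by gcongr
    nlinarith
  · obtain ⟨ξ, hξ, he⟩ := exists_hasDerivAt_eq_slope a₁ a₂ zero_lt_one
      (fun s hs => (da₁ s hs).continuousAt.continuousWithinAt)
      (fun s hs => da₁ s ⟨hs.1.le, hs.2.le⟩)
    rw [sub_zero, div_one, ← hW] at he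
    have hWW : W ≤ W' := hWl.trans hLl
    have ha4 : ∀ s ∈ Icc (0 : ℝ) 1, a₂ s ≤ 4 * W' := by
      intro s hs
      have h1 := le_four_mul_of_selfConcordant (convex_Icc 0 1) hM0.le ha0 da₂ hsc
        (s := ξ) ⟨hξ.1.le, hξ.2.le⟩ hs (by
          refine le_trans ?_ hsmall
          rw [← hMN, he]
          have h2 : |s - ξ| ≤ 1 := by
            rw [abs_le]
            constructor <;> linarith [hs.1, hs.2, hξ.1, hξ.2]
          calc M * |s - ξ| * √W ≤ M * 1 * √W' := by gcongr
            _ = M * √W' := by ring)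
      rw [he] at h1
      linarith
    have hs4 : √(4 * W') = 2 * √W' := by
      rw [Real.sqrt_mul (by norm_num)]
      congr 1
      rw [Real.sqrt_eq_iff_mul_self_eq (by norm_num) (by norm_num)]
      norm_num
    have hB : ∀ s ∈ Icc (0 : ℝ) 1, |a₃ s| ≤ 16 * N * W' := by
      intro s hs
      refine (hsc s hs).trans ?_
      calc 2 * M * √(a₂ s) ^ 3 ≤ 2 * M * √(4 * W') ^ 3 := by
            gcongr
            exact ha4 s hs
        _ = 16 * (M * √W') * (√W' * √W') := by
            rw [hs4]
            ring
        _ = 16 * N * W' := by rw [hMN, Real.mul_self_sqrt hW'0.le]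
    -- the trapezoidal rule replaces the decrease of `a` by its slopes, that is by those of `φ`
    have htrap := (abs_le.1 (abs_trapezoid_le da da₁ da₂ hB)).1
    obtain ⟨ζ, hζ, hez⟩ := exists_hasDerivAt_eq_slope φ₁ φ₂ zero_lt_one
      (fun s hs => (hφ s hs).2.1.continuousAt.continuousWithinAt)
      (fun s hs => (hφ s ⟨hs.1.le, hs.2.le⟩).2.1)
    rw [sub_zero, div_one] at hez
    have hζm : ζ ∈ Icc (0 : ℝ) 1 := ⟨hζ.1.le, hζ.2.le⟩
    have hp4 : √(p₂ ζ) ≤ 2 * (η * D * L) := by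
      rw [Real.sqrt_le_left (by positivity)]
      have h1 := ha4 ζ hζm
      have h2 := hq0 ζ hζm
      have h3 := hφ0 ζ hζm
      have h4 : p₂ ζ / η ≤ 4 * W' := by
        simp only [ha₂] at h1
        linarith
      rw [div_le_iff₀ hη] at h4
      calc p₂ ζ ≤ 4 * W' * η := h4
        _ = _ := by ring
    -- the local norm of the step is at most `2ηDL`, which fixes the length of the chord
    have hcz := hcurv ζ hζm (1 / (4 * k * η * D * L)) (by positivity) (by
      calc k * (1 / (4 * k * η * D * L)) * √(p₂ ζ)
          ≤ k * (1 / (4 * k * η * D * L)) * (2 * (η * D * L)) := by gcongr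
        _ = 1 / 2 := by
          field_simp
          norm_num)
    have e1 : 8 * (L * l) / (1 / (4 * k * η * D * L)) = 32 * (k * η * D * L) * (L * l) := by
      field_simp
      ring
    rw [e1] at hcz
    have hC' : 0 ≤ 3 * C * √η * D * L := by positivity
    have hk' : 0 ≤ k * η * D * L := by positivity
    have h5 : 32 * (k * η * D * L) * (L * l) ≤ 32 * N * W' := by
      gcongr
      rw [hN]
      linarith
    have h6 : 64 * C ^ 2 * (L * l) ^ 2 ≤ 4 * N * W' := by
      calc 64 * C ^ 2 * (L * l) ^ 2 ≤ 64 * C ^ 2 * W' ^ 2 := by gcongr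
        _ = 64 / 9 * (3 * C * √W') ^ 2 * W' := by
            rw [mul_pow _ √W', Real.sq_sqrt hW'0.le]
            ring
        _ = 64 / 9 * (3 * C * √η * D * L) ^ 2 * W' := by
            rw [hsW]
            ring
        _ ≤ 64 / 9 * (N * (1 / 2)) * W' := by
            have h7 : 3 * C * √η * D * L ≤ N := by
              rw [hN]
              linarith
            gcongr
            rw [sq]
            exact mul_le_mul h7 (h7.trans hsmall) hC' hN0.le
        _ ≤ 4 * N * W' := by
            have : 0 < N * W' := by positivity
            linarith
    rw [ea0, ea1] at htrap
    have : 0 < N * W' := by positivity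
    linarith

/-! ### Follow the regularized leader -/

theorem norm_gradientWithin {d : ℕ} (f : Euc d → ℝ) (S : Set (Euc d)) (x : Euc d) :
    ‖gradientWithin f S x‖ = ‖fderivWithin ℝ f S x‖ := by
  rw [gradientWithin, LinearIsometryEquiv.norm_map]

/-- The `k`-th derivative of `f` at `x` in the direction `h`. -/
noncomputable def directionalDeriv {d : ℕ} (X : Set (Euc d)) (f : Euc d → ℝ) (k : ℕ)
    (x h : Euc d) : ℝ :=
  iteratedFDerivWithin ℝ k f X x (fun _ => h)

theorem rpow_three_halves_eq {x : ℝ} (hx : 0 ≤ x) : x ^ (3 / 2 : ℝ) = √x ^ 3 := by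
  rw [Real.sqrt_eq_rpow, ← Real.rpow_natCast, ← Real.rpow_mul hx]
  norm_num

theorem sum_sqrt_pow_three_le {ι : Type*} (s : Finset ι) (a : ι → ℝ) (ha : ∀ i ∈ s, 0 ≤ a i) :
    ∑ i ∈ s, √(a i) ^ 3 ≤ √(∑ i ∈ s, a i) ^ 3 := by
  have e : ∀ x : ℝ, 0 ≤ x → √x ^ 3 = x * √x := fun x hx => by
    rw [pow_succ, Real.sq_sqrt hx]
  rw [e _ (Finset.sum_nonneg ha), Finset.sum_mul]
  refine Finset.sum_le_sum fun i hi => ?_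
  rw [e _ (ha i hi)]
  have h1 := Finset.single_le_sum ha hi
  have h2 := ha i hi
  gcongr

namespace IsAdmissibleLoss

variable {d : ℕ} {X : Set (Euc d)} {L β C : ℝ} {f : Euc d → ℝ} {x h : Euc d} {s : ℝ}

theorem hasDerivAt_directionalDeriv (hf : IsAdmissibleLoss X L β C f) {k : ℕ} (hk : k < 3)
    (hx : x + s • h ∈ interior X) :
    HasDerivAt (fun s : ℝ => directionalDeriv X f k (x + s • h) h)
      (directionalDeriv X f (k + 1) (x + s • h) h) s :=
  hasDerivAt_iteratedFDerivWithin_line (hf.selfConcordant.1 k hk) hx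

theorem hasDerivAt_line (hf : IsAdmissibleLoss X L β C f) (hx : x + s • h ∈ interior X) :
    HasDerivAt (fun s : ℝ => f (x + s • h)) (directionalDeriv X f 1 (x + s • h) h) s := by
  have := hf.hasDerivAt_directionalDeriv (k := 0) (by norm_num) hx
  simpa only [directionalDeriv, iteratedFDerivWithin_zero_apply] using this

theorem abs_directionalDeriv_one_le (hf : IsAdmissibleLoss X L β C f) (hx : x ∈ interior X)
    (h : Euc d) : |directionalDeriv X f 1 x h| ≤ L * ‖h‖ := by
  have h1 : HasDerivAt (fun s : ℝ => f (x + s • h))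
      (directionalDeriv X f 1 (x + (0 : ℝ) • h) h) 0 :=
    hf.hasDerivAt_line (by simpa using hx)
  have h2 : HasFDerivAt f (fderivWithin ℝ f X (x + (0 : ℝ) • h)) (x + (0 : ℝ) • h) := by
    have hx' : x + (0 : ℝ) • h ∈ interior X := by simpa using hx
    exact (hf.lipschitz.1 _ (interior_subset hx')).hasFDerivWithinAt.hasFDerivAt
      (mem_interior_iff_mem_nhds.1 hx')
  have h3 := h1.unique (h2.comp_hasDerivAt (0 : ℝ) (hasDerivAt_add_smul x h 0))
  rw [zero_smul, add_zero] at h3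
  rw [h3, ← Real.norm_eq_abs]
  refine (ContinuousLinearMap.le_opNorm _ _).trans ?_
  gcongr
  rw [← norm_gradientWithin]
  exact hf.lipschitz.2 x (interior_subset hx)

/-- Self-concordance involves the power `3/2` of the second derivative, which has its intended
meaning because the second derivative is nonnegative by convexity. -/
theorem directionalDeriv_two_nonneg (hf : IsAdmissibleLoss X L β C f) (hx : x ∈ interior X)
    (h : Euc d) : 0 ≤ directionalDeriv X f 2 x h := by
  set J : Set ℝ := (fun s : ℝ => x + s • h) ⁻¹' interior X with hJ
  have hJo : IsOpen J := isOpen_interior.preimage (by fun_prop)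
  have h0 : (0 : ℝ) ∈ J := by
    rw [hJ, mem_preimage]
    simpa using hx
  have hconv : ConvexOn ℝ J fun s : ℝ => f (x + s • h) := by
    have h1 : ConvexOn ℝ (interior X) f :=
      hf.convex.subset interior_subset hf.convex.1.interior
    have h2 := h1.comp_affineMap (AffineMap.lineMap x (x + h))
    have e : (fun s : ℝ => x + s • h) = AffineMap.lineMap x (x + h) := by
      ext1 s
      simp [AffineMap.lineMap_apply, add_comm]
    have e2 : (fun s : ℝ => f (x + s • h)) = f ∘ AffineMap.lineMap x (x + h) := by
      rw [← e]
      rfl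
    rw [hJ, e2, e]
    exact h2
  have hmono := hconv.monotoneOn_deriv fun s hs => (hf.hasDerivAt_line hs).differentiableAt
  have hmono' : MonotoneOn (fun s : ℝ => directionalDeriv X f 1 (x + s • h) h) J := by
    refine hmono.congr fun s hs => ?_
    exact (hf.hasDerivAt_line hs).deriv
  have h3 := hmono'.derivWithin_nonneg (x := 0)
  rw [derivWithin_of_isOpen hJo h0,
    (hf.hasDerivAt_directionalDeriv (k := 1) (by norm_num) h0).deriv] at h3
  simpa using h3

theorem abs_directionalDeriv_three_le (hf : IsAdmissibleLoss X L β C f) (hx : x ∈ interior X)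
    (h : Euc d) :
    |directionalDeriv X f 3 x h| ≤ 2 * C * √(directionalDeriv X f 2 x h) ^ 3 := by
  rw [← rpow_three_halves_eq (hf.directionalDeriv_two_nonneg hx h)]
  exact hf.selfConcordant.2 x (interior_subset hx) h

end IsAdmissibleLoss

/-- The objective of round `t` as a real number; it agrees with `ftrlObjective` on the interior. -/
noncomputable def realObjective {d : ℕ} (X : Set (Euc d)) (η : ℝ) (f : ℕ → Euc d → ℝ) (t : ℕ)
    (x : Euc d) : ℝ :=
  (entropicBarrier X x).toReal / η + ∑ τ ∈ Finset.Ico 1 t, f τ x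

theorem le_ftrlObjective {d : ℕ} {ψ : Euc d → EReal} {η : ℝ} (hη : 0 < η) (f : ℕ → Euc d → ℝ)
    (t : ℕ) {x : Euc d} {b : ℝ} (hb : (b : EReal) ≤ ψ x) :
    ((∑ τ ∈ Finset.Ico 1 t, f τ x + 1 / η * b : ℝ) : EReal) ≤ ftrlObjective ψ η f t x := by
  rw [EReal.coe_add, EReal.coe_mul, ftrlObjective]
  refine add_le_add le_rfl (mul_le_mul_of_nonneg_left hb ?_)
  exact EReal.coe_nonneg.2 (by positivity)

theorem ftrlObjective_le {d : ℕ} {ψ : Euc d → EReal} {η : ℝ} (hη : 0 < η) (f : ℕ → Euc d → ℝ)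
    (t : ℕ) {x : Euc d} {b : ℝ} (hb : ψ x ≤ (b : EReal)) :
    ftrlObjective ψ η f t x ≤ ((∑ τ ∈ Finset.Ico 1 t, f τ x + 1 / η * b : ℝ) : EReal) := by
  rw [EReal.coe_add, EReal.coe_mul, ftrlObjective]
  refine add_le_add le_rfl (mul_le_mul_of_nonneg_left hb ?_)
  exact EReal.coe_nonneg.2 (by positivity)

theorem realObjective_succ {d : ℕ} {X : Set (Euc d)} {η : ℝ} {f : ℕ → Euc d → ℝ} {t : ℕ}
    (ht : 1 ≤ t) (x : Euc d) :
    realObjective X η f (t + 1) x = realObjective X η f t x + f t x := by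
  rw [realObjective, realObjective, Finset.sum_Ico_succ_top ht, add_assoc]

theorem lowerSemicontinuousOn_ftrlObjective {d : ℕ} {X : Set (Euc d)} {η : ℝ} (hη : 0 < η)
    {f : ℕ → Euc d → ℝ} {t : ℕ}
    (hf : ∀ τ ∈ Finset.Ico 1 t, ContinuousOn (f τ) X) :
    LowerSemicontinuousOn (ftrlObjective (entropicBarrier X) η f t) X := by
  intro x hx y hy
  -- one affine minorant of the barrier already lifts the objective above `y`
  obtain ⟨θ, hθ⟩ : ∃ θ : Euc d, y < ((∑ τ ∈ Finset.Ico 1 t, f τ x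
      + 1 / η * (inner ℝ θ x - logPartition X θ) : ℝ) : EReal) := by
    by_contra! hcon
    induction y with
    | bot => exact EReal.coe_ne_bot _ (le_bot_iff.1 (hcon 0))
    | top => exact not_top_lt hy
    | coe r =>
      refine absurd hy (not_lt.2 ?_)
      refine (ftrlObjective_le hη f t (b := η * (r - ∑ τ ∈ Finset.Ico 1 t, f τ x))
        (iSup_le fun θ => EReal.coe_le_coe_iff.2 ?_)).trans (EReal.coe_le_coe_iff.2 ?_)
      · have h1 := EReal.coe_le_coe_iff.1 (hcon θ)
        have h2 : 1 / η * (inner ℝ θ x - logPartition X θ)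
            ≤ r - ∑ τ ∈ Finset.Ico 1 t, f τ x := by linarith
        rwa [one_div, inv_mul_le_iff₀ hη] at h2
      · field_simp
        linarith
  have hc : ContinuousOn (fun x => ∑ τ ∈ Finset.Ico 1 t, f τ x
      + 1 / η * (inner ℝ θ x - logPartition X θ)) X := by
    refine (continuousOn_finsetSum _ hf).add (Continuous.continuousOn ?_)
    fun_prop
  have hc' : ContinuousWithinAt (fun x => ((∑ τ ∈ Finset.Ico 1 t, f τ x
      + 1 / η * (inner ℝ θ x - logPartition X θ) : ℝ) : EReal)) X x :=
    continuous_coe_real_ereal.continuousAt.comp_continuousWithinAt (hc x hx)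
  filter_upwards [hc'.eventually (lt_mem_nhds hθ)] with z hz
  exact hz.trans_le (le_ftrlObjective hη f t (le_entropicBarrier X θ z))

namespace IsConvexBody

variable {d : ℕ} {X : Set (Euc d)} {η L β C : ℝ} {f : ℕ → Euc d → ℝ} {t : ℕ}

theorem ftrlObjective_of_mem_interior (hX : IsConvexBody X) {x : Euc d} (hx : x ∈ interior X) :
    ftrlObjective (entropicBarrier X) η f t x = (realObjective X η f t x : EReal) := by
  rw [ftrlObjective, realObjective, ← hX.coe_toReal_entropicBarrier hx, ← EReal.coe_mul,
    ← EReal.coe_add, EReal.toReal_coe]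
  congr 1
  ring

theorem ftrlObjective_eq_top (hX : IsConvexBody X) (hη : 0 < η) {x : Euc d}
    (hx : x ∉ interior X) : ftrlObjective (entropicBarrier X) η f t x = ⊤ := by
  rw [ftrlObjective, hX.entropicBarrier_eq_top hx, EReal.coe_mul_top_of_pos (by positivity),
    EReal.coe_add_top]

theorem mem_interior_of_isFTRLPlay (hX : IsConvexBody X) (hη : 0 < η) {z : Euc d}
    (hz : IsFTRLPlay X (entropicBarrier X) η f t z) : z ∈ interior X := by
  by_contra hzi
  obtain ⟨y, hy⟩ := hX.nonempty_interior
  have h := hz.2 y (interior_subset hy)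
  rw [hX.ftrlObjective_eq_top hη hzi, hX.ftrlObjective_of_mem_interior hy] at h
  exact EReal.coe_ne_top _ (top_le_iff.1 h)

theorem realObjective_le_of_isFTRLPlay (hX : IsConvexBody X) (hη : 0 < η) {z y : Euc d}
    (hz : IsFTRLPlay X (entropicBarrier X) η f t z) (hy : y ∈ interior X) :
    realObjective X η f t z ≤ realObjective X η f t y := by
  have h := hz.2 y (interior_subset hy)
  rwa [hX.ftrlObjective_of_mem_interior (hX.mem_interior_of_isFTRLPlay hη hz),
    hX.ftrlObjective_of_mem_interior hy, EReal.coe_le_coe_iff] at h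

theorem strictConvexOn_realObjective (hX : IsConvexBody X) (hD : 0 < Metric.diam X) (hη : 0 < η)
    (hf : ∀ τ ∈ Finset.Ico 1 t, ConvexOn ℝ X (f τ)) :
    StrictConvexOn ℝ (interior X) (realObjective X η f t) := by
  refine ⟨hX.convex.interior, fun x hx y hy hxy a b ha hb hab => ?_⟩
  have h1 := (hX.strictConvexOn_entropicBarrier hD).2 hx hy hxy ha hb hab
  have h2 : ∑ τ ∈ Finset.Ico 1 t, f τ (a • x + b • y)
      ≤ a * ∑ τ ∈ Finset.Ico 1 t, f τ x + b * ∑ τ ∈ Finset.Ico 1 t, f τ y := by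
    rw [Finset.mul_sum, Finset.mul_sum, ← Finset.sum_add_distrib]
    exact Finset.sum_le_sum fun τ hτ =>
      (hf τ hτ).2 (interior_subset hx) (interior_subset hy) ha.le hb.le hab
  have h3 := div_lt_div_of_pos_right h1 hη
  simp only [smul_eq_mul, add_div, mul_div_assoc] at h3
  simp only [realObjective, smul_eq_mul]
  linarith

theorem existsUnique_isFTRLPlay (hX : IsConvexBody X) (hD : 0 < Metric.diam X) (hη : 0 < η)
    (hc : ∀ τ ∈ Finset.Ico 1 t, ContinuousOn (f τ) X)
    (hf : ∀ τ ∈ Finset.Ico 1 t, ConvexOn ℝ X (f τ)) :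
    ∃! z, IsFTRLPlay X (entropicBarrier X) η f t z := by
  obtain ⟨z, hz, hmin⟩ := LowerSemicontinuousOn.exists_isMinOn
    (hX.nonempty_interior.mono interior_subset) hX.isCompact
    (lowerSemicontinuousOn_ftrlObjective (X := X) hη hc)
  have hz' : IsFTRLPlay X (entropicBarrier X) η f t z := ⟨hz, fun y hy => hmin hy⟩
  refine ⟨z, hz', fun w hw => ?_⟩
  exact (hX.strictConvexOn_realObjective hD hη hf).eq_of_isMinOn
    (fun y hy => hX.realObjective_le_of_isFTRLPlay hη hw hy)
    (fun y hy => hX.realObjective_le_of_isFTRLPlay hη hz' hy)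
    (hX.mem_interior_of_isFTRLPlay hη hw) (hX.mem_interior_of_isFTRLPlay hη hz')

theorem hasDerivAt_realObjective_line (hX : IsConvexBody X)
    (hf : ∀ τ ∈ Finset.Ico 1 t, IsAdmissibleLoss X L β C (f τ)) {x h : Euc d} {s : ℝ}
    (hx : x + s • h ∈ interior X) :
    HasDerivAt (fun s : ℝ => realObjective X η f t (x + s • h))
      (inner ℝ (dualPoint X (x + s • h)) h / η
        + ∑ τ ∈ Finset.Ico 1 t, directionalDeriv X (f τ) 1 (x + s • h) h) s :=
  ((hX.hasDerivAt_entropicBarrier_line hx).div_const η).add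
    (HasDerivAt.fun_sum fun τ hτ => (hf τ hτ).hasDerivAt_line hx)

/-- First-order optimality of the decisions, which are interior. -/
theorem stationary_of_isFTRLPlay (hX : IsConvexBody X) (hη : 0 < η)
    (hf : ∀ τ ∈ Finset.Ico 1 t, IsAdmissibleLoss X L β C (f τ)) {z : Euc d}
    (hz : IsFTRLPlay X (entropicBarrier X) η f t z) (h : Euc d) :
    inner ℝ (dualPoint X z) h / η
        + ∑ τ ∈ Finset.Ico 1 t, directionalDeriv X (f τ) 1 z h = 0 := by
  have hzi := hX.mem_interior_of_isFTRLPlay hη hz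
  have hzi' : z + (0 : ℝ) • h ∈ interior X := by simpa using hzi
  have h1 : IsLocalMin (fun s : ℝ => realObjective X η f t (z + s • h)) 0 := by
    have hc : ContinuousAt (fun r : ℝ => z + r • h) 0 := (hasDerivAt_add_smul z h 0).continuousAt
    filter_upwards [hc.preimage_mem_nhds (isOpen_interior.mem_nhds hzi')] with s hs
    rw [zero_smul, add_zero]
    exact hX.realObjective_le_of_isFTRLPlay hη hz hs
  have h2 := h1.hasDerivAt_eq_zero (hX.hasDerivAt_realObjective_line hf hzi')
  simpa using h2

/-- The contribution of one round to the alternating regret. -/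
theorem round_le (hX : IsConvexBody X) (hD : 0 < Metric.diam X) (hη : 0 < η) (hL : 0 < L)
    (hC : 0 ≤ C) (ht : 1 ≤ t) (hf : ∀ τ ∈ Finset.Icc 1 t, IsAdmissibleLoss X L β C (f τ))
    {x y : Euc d} (hx : IsFTRLPlay X (entropicBarrier X) η f t x)
    (hy : IsFTRLPlay X (entropicBarrier X) η f (t + 1) y) :
    f t x + f t y + 2 * realObjective X η f t x - 2 * realObjective X η f (t + 1) y
      ≤ 36 * (thirdMomentConst / 2 * η * Metric.diam X * L + 3 * C * √η * Metric.diam X * L)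
        * (η * Metric.diam X ^ 2 * L ^ 2) := by
  have hxi := hX.mem_interior_of_isFTRLPlay hη hx
  have hyi := hX.mem_interior_of_isFTRLPlay hη hy
  have hf' : ∀ τ ∈ Finset.Ico 1 t, IsAdmissibleLoss X L β C (f τ) := fun τ hτ =>
    hf τ (Finset.mem_Icc.2 ⟨(Finset.mem_Ico.1 hτ).1, (Finset.mem_Ico.1 hτ).2.le⟩)
  have hf'' : ∀ τ ∈ Finset.Ico 1 (t + 1), IsAdmissibleLoss X L β C (f τ) := fun τ hτ =>
    hf τ (Finset.mem_Icc.2 ⟨(Finset.mem_Ico.1 hτ).1, Nat.lt_succ_iff.1 (Finset.mem_Ico.1 hτ).2⟩)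
  have hft := hf t (Finset.mem_Icc.2 ⟨ht, le_rfl⟩)
  have hκ := thirdMomentConst_pos
  set h := y - x with hh
  have hseg : ∀ s ∈ Icc (0 : ℝ) 1, x + s • h ∈ interior X := by
    intro s hs
    have := hX.convex.interior hxi hyi (sub_nonneg.2 hs.2) hs.1 (by ring)
    convert this using 1
    rw [hh]
    module
  have e0 : x + (0 : ℝ) • h = x := by simp
  have e1 : x + (1 : ℝ) • h = y := by simp [hh]
  have key := round_estimate (η := η) (k := thirdMomentConst / 2) (C := C) (L := L)
    (D := Metric.diam X) (l := ‖h‖)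
    (p := fun s => (entropicBarrier X (x + s • h)).toReal)
    (p₁ := fun s => inner ℝ (dualPoint X (x + s • h)) h)
    (p₂ := fun s => barrierHess X (x + s • h) h)
    (p₃ := fun s => barrierThird X (x + s • h) h)
    (q := fun s => ∑ τ ∈ Finset.Ico 1 t, f τ (x + s • h))
    (q₁ := fun s => ∑ τ ∈ Finset.Ico 1 t, directionalDeriv X (f τ) 1 (x + s • h) h)
    (q₂ := fun s => ∑ τ ∈ Finset.Ico 1 t, directionalDeriv X (f τ) 2 (x + s • h) h)
    (q₃ := fun s => ∑ τ ∈ Finset.Ico 1 t, directionalDeriv X (f τ) 3 (x + s • h) h)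
    (φ := fun s => f t (x + s • h))
    (φ₁ := fun s => directionalDeriv X (f t) 1 (x + s • h) h)
    (φ₂ := fun s => directionalDeriv X (f t) 2 (x + s • h) h)
    (φ₃ := fun s => directionalDeriv X (f t) 3 (x + s • h) h)
    hη (by positivity) hC hL hD (norm_nonneg _)
    (fun s hs => ⟨hX.hasDerivAt_entropicBarrier_line (hseg s hs),
      hX.hasDerivAt_inner_dualPoint_line (hseg s hs),
      hX.hasDerivAt_barrierHess_line (hseg s hs), hX.barrierHess_nonneg (hseg s hs) h,
      hX.abs_barrierThird_le (hseg s hs) h⟩)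
    (fun s hs => ⟨HasDerivAt.fun_sum fun τ hτ => (hf' τ hτ).hasDerivAt_line (hseg s hs),
      HasDerivAt.fun_sum fun τ hτ =>
        (hf' τ hτ).hasDerivAt_directionalDeriv (by norm_num) (hseg s hs),
      HasDerivAt.fun_sum fun τ hτ =>
        (hf' τ hτ).hasDerivAt_directionalDeriv (by norm_num) (hseg s hs),
      Finset.sum_nonneg fun τ hτ => (hf' τ hτ).directionalDeriv_two_nonneg (hseg s hs) h, by
        refine (Finset.abs_sum_le_sum_abs _ _).trans ((Finset.sum_le_sum fun τ hτ =>
          (hf' τ hτ).abs_directionalDeriv_three_le (hseg s hs) h).trans ?_)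
        rw [← Finset.mul_sum]
        exact mul_le_mul_of_nonneg_left (sum_sqrt_pow_three_le _ _ fun τ hτ =>
          (hf' τ hτ).directionalDeriv_two_nonneg (hseg s hs) h) (by positivity)⟩)
    (fun s hs => ⟨hft.hasDerivAt_line (hseg s hs),
      hft.hasDerivAt_directionalDeriv (by norm_num) (hseg s hs),
      hft.hasDerivAt_directionalDeriv (by norm_num) (hseg s hs),
      hft.directionalDeriv_two_nonneg (hseg s hs) h,
      hft.abs_directionalDeriv_three_le (hseg s hs) h⟩)
    (fun s hs => hft.abs_directionalDeriv_one_le (hseg s hs) h)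
    (by
      simp only [e0]
      exact hX.stationary_of_isFTRLPlay hη hf' hx h)
    (by
      simp only [e1]
      have := hX.stationary_of_isFTRLPlay hη hf'' hy h
      rw [Finset.sum_Ico_succ_top ht, ← add_assoc] at this
      exact this)
    (by
      simp only [e0, e1]
      have h1 := hX.entropicBarrier_quadratic_le_toReal hD hxi hyi
      have h2 := hX.entropicBarrier_quadratic_le_toReal hD hyi hxi
      rw [← neg_sub y x, ← hh, inner_neg_right, norm_neg] at h1
      rw [← hh] at h2
      have h3 : ‖h‖ ^ 2 / Metric.diam X ^ 2 = 2 * (1 / Metric.diam X ^ 2 / 2 * ‖h‖ ^ 2) := by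
        field_simp
      linarith)
    (fun s hs R hR hle => by
      -- Dikin's ellipsoid provides room for the slope of the loss to grow
      have hin : ∀ r ∈ Icc 0 R, (x + s • h) + r • h ∈ interior X := fun r hr =>
        hX.add_smul_mem_interior (hseg s hs) h hr.1 (le_trans (by
          have := hr.2
          gcongr) hle)
      have h1 := second_deriv_le_of_slope_le hR hC
        (fun r hr => hft.hasDerivAt_directionalDeriv (k := 1) (by norm_num) (hin r hr))
        (fun r hr => hft.hasDerivAt_directionalDeriv (k := 2) (by norm_num) (hin r hr))
        (fun r hr => hft.directionalDeriv_two_nonneg (hin r hr) h)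
        (fun r hr => hft.abs_directionalDeriv_three_le (hin r hr) h)
        (fun r hr => hft.abs_directionalDeriv_one_le (hin r hr) h)
      simpa using h1)
  simp only [e0, e1] at key
  rw [realObjective_succ ht, realObjective, realObjective]
  linarith

end IsConvexBody

/-! ### Comparators and the regret -/

namespace IsConvexBody

variable {d : ℕ} {X : Set (Euc d)}

/-- `X` contains the contracted copy `(1 - ε) u + ε X`, which bounds the log-partition function
from below. -/
theorem logPartition_ge_of_contraction (hX : IsConvexBody X) {u : Euc d} (hu : u ∈ X) {ε : ℝ}
    (hε : 0 < ε) (hε1 : ε ≤ 1) (θ : Euc d) :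
    d * Real.log ε + inner ℝ θ ((1 - ε) • u) + logPartition X (ε • θ) ≤ logPartition X θ := by
  set c := (1 - ε) • u with hc
  set F : Euc d → ℝ := X.indicator fun x => Real.exp (inner ℝ θ x) with hF
  have hFi : Integrable F := (integrable_indicator_iff hX.measurableSet).2 (hX.integrable_exp θ)
  have hFint : ∫ x, F x = ∫ x in X, Real.exp (inner ℝ θ x) := integral_indicator hX.measurableSet
  have hchange : ∫ y, F (c + ε • y) = (ε ^ d)⁻¹ * ∫ x, F x := by
    have h1 := Measure.integral_comp_smul (μ := (volume : Measure (Euc d)))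
      (fun y => F (c + y)) ε
    rw [integral_add_left_eq_self F c, finrank_euclideanSpace_fin, abs_of_pos (by positivity),
      smul_eq_mul] at h1
    exact h1
  have hmem : ∀ y ∈ X, c + ε • y ∈ X := fun y hy =>
    hX.convex hu hy (sub_nonneg.2 hε1) hε.le (by ring)
  have hexp : ∀ y : Euc d, Real.exp (inner ℝ θ (c + ε • y))
      = Real.exp (inner ℝ θ c) * Real.exp (inner ℝ (ε • θ) y) := fun y => by
    rw [← Real.exp_add, inner_add_right, inner_smul_right θ y, inner_smul_left]
    simp
  have hle : Real.exp (inner ℝ θ c) * ∫ y in X, Real.exp (inner ℝ (ε • θ) y)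
      ≤ ∫ y, F (c + ε • y) := by
    rw [← integral_const_mul, ← integral_indicator hX.measurableSet]
    refine integral_mono ((integrable_indicator_iff hX.measurableSet).2
      ((hX.integrable_exp (ε • θ)).const_mul _)) ?_ fun y => ?_
    · exact (hFi.comp_add_left c).comp_smul hε.ne'
    · by_cases hy : y ∈ X
      · rw [indicator_of_mem hy]
        simp only [hF]
        rw [indicator_of_mem (hmem y hy), hexp]
      · rw [indicator_of_notMem hy]
        exact indicator_nonneg (fun x _ => (Real.exp_pos _).le) _
  rw [hchange, hFint] at hle
  have hpos := hX.integral_exp_pos (ε • θ)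
  have h2 : ε ^ d * (Real.exp (inner ℝ θ c) * ∫ y in X, Real.exp (inner ℝ (ε • θ) y))
      ≤ ∫ x in X, Real.exp (inner ℝ θ x) := by
    have h3 := mul_le_mul_of_nonneg_left hle (by positivity : 0 ≤ ε ^ d)
    rwa [← mul_assoc (ε ^ d) (ε ^ d)⁻¹, mul_inv_cancel₀ (by positivity), one_mul] at h3
  have h4 := Real.log_le_log (by positivity) h2
  rw [Real.log_mul (by positivity) (by positivity), Real.log_mul (Real.exp_pos _).ne' hpos.ne',
    Real.log_exp, Real.log_pow] at h4
  simp only [logPartition]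
  linarith

/-- The barrier at a point moved from `u` towards the centroid by a factor `ε` exceeds its minimum
by at most `d log (1/ε)`. -/
theorem entropicBarrier_contraction_le (hX : IsConvexBody X) {u : Euc d} (hu : u ∈ X) {ε : ℝ}
    (hε : 0 < ε) (hε1 : ε ≤ 1) :
    entropicBarrier X ((1 - ε) • u + ε • tiltedMean X 0)
      ≤ ((d * Real.log ε⁻¹ - logPartition X 0 : ℝ) : EReal) := by
  refine iSup_le fun θ => EReal.coe_le_coe_iff.2 ?_
  have h1 := hX.logPartition_ge_of_contraction hu hε hε1 θ
  have h2 := hX.logPartition_tangent_le 0 (ε • θ)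
  rw [sub_zero, inner_smul_left] at h2
  rw [inner_add_right, inner_smul_right θ (tiltedMean X 0), Real.log_inv]
  simp only [conj_trivial] at h2
  linarith

theorem loss_contraction_le (hX : IsConvexBody X) {L β C : ℝ} {f : Euc d → ℝ}
    (hf : IsAdmissibleLoss X L β C f) (hL : 0 < L) {u c : Euc d} (hu : u ∈ X) (hc : c ∈ X) {ε : ℝ}
    (hε : 0 < ε) (hε1 : ε ≤ 1) :
    f ((1 - ε) • u + ε • c) ≤ f u + ε * (L * Metric.diam X) := by
  have h1 := hf.convex.2 hu hc (sub_nonneg.2 hε1) hε.le (by ring)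
  have h2 := hX.convex.norm_image_sub_le_of_norm_fderivWithin_le hf.lipschitz.1
    (fun x hx => (norm_gradientWithin f X x).symm.trans_le (hf.lipschitz.2 x hx)) hu hc
  have h3 : ‖c - u‖ ≤ Metric.diam X := by
    rw [← dist_eq_norm]
    exact Metric.dist_le_diam_of_mem hX.isCompact.isBounded hc hu
  have h4 : f c - f u ≤ L * Metric.diam X :=
    ((le_abs_self _).trans h2).trans (by gcongr)
  have h5 := mul_le_mul_of_nonneg_left h4 hε.le
  simp only [smul_eq_mul] at h1
  linarith

/-- The alternating regret of follow-the-regularized-leader with an arbitrary learning rate. -/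
theorem altRegret_le (hX : IsConvexBody X) (hD : 0 < Metric.diam X) {η L β C : ℝ}
    {f : ℕ → Euc d → ℝ} {T : ℕ} (hη : 0 < η) (hL : 0 < L) (hC : 0 ≤ C) (hT : 1 ≤ T)
    (hf : ∀ t ∈ Finset.Icc 1 T, IsAdmissibleLoss X L β C (f t)) {x : ℕ → Euc d}
    (hx : ∀ t ∈ Finset.Icc 1 (T + 1), IsFTRLPlay X (entropicBarrier X) η f t (x t))
    {u : Euc d} (hu : u ∈ X) :
    altRegret f x T u ≤ 2 * (d * Real.log T / η) + 2 * (L * Metric.diam X)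
      + T * (36 * (thirdMomentConst / 2 * η * Metric.diam X * L
        + 3 * C * √η * Metric.diam X * L) * (η * Metric.diam X ^ 2 * L ^ 2)) := by
  set B := 36 * (thirdMomentConst / 2 * η * Metric.diam X * L
        + 3 * C * √η * Metric.diam X * L) * (η * Metric.diam X ^ 2 * L ^ 2) with hB
  have hround : ∀ n ≤ T, ∑ t ∈ Finset.Icc 1 n, (f t (x t) + f t (x (t + 1)))
      ≤ n * B + 2 * realObjective X η f (n + 1) (x (n + 1)) - 2 * realObjective X η f 1 (x 1) := by
    intro n hn
    induction n with
    | zero => simp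
    | succ n ih =>
      have h1 := ih (by omega)
      have h2 := hX.round_le (t := n + 1) hD hη hL hC (by omega)
        (fun τ hτ => hf τ (Finset.mem_Icc.2 ⟨(Finset.mem_Icc.1 hτ).1,
          (Finset.mem_Icc.1 hτ).2.trans hn⟩))
        (hx (n + 1) (Finset.mem_Icc.2 ⟨by omega, by omega⟩))
        (hx (n + 1 + 1) (Finset.mem_Icc.2 ⟨by omega, by omega⟩))
      rw [← hB] at h2
      rw [Finset.sum_Icc_succ_top (by omega)]
      push_cast
      linarith
  have hT0 : (0 : ℝ) < T := by exact_mod_cast hT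
  have hε : (0 : ℝ) < (T : ℝ)⁻¹ := by positivity
  have hε1 : (T : ℝ)⁻¹ ≤ 1 := inv_le_one_of_one_le₀ (by exact_mod_cast hT)
  have hc := hX.tiltedMean_mem_interior 0
  -- the comparator is moved into the interior, where the barrier is finite
  set v := (1 - (T : ℝ)⁻¹) • u + (T : ℝ)⁻¹ • tiltedMean X 0 with hv
  have hvi : v ∈ interior X :=
    hX.convex.combo_self_interior_mem_interior hu hc (sub_nonneg.2 hε1) hε (by ring)
  have h1 := hX.realObjective_le_of_isFTRLPlay hη
    (hx (T + 1) (Finset.mem_Icc.2 ⟨by omega, le_rfl⟩)) hvi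
  have h2 : (entropicBarrier X v).toReal ≤ d * Real.log T - logPartition X 0 := by
    have h := hX.entropicBarrier_contraction_le hu hε hε1
    rwa [← hv, inv_inv, ← hX.coe_toReal_entropicBarrier hvi, EReal.coe_le_coe_iff] at h
  have hx1 := hX.mem_interior_of_isFTRLPlay hη (hx 1 (Finset.mem_Icc.2 ⟨le_rfl, by omega⟩))
  have h3 : -logPartition X 0 ≤ (entropicBarrier X (x 1)).toReal := by
    have h := le_entropicBarrier X 0 (x 1)
    rwa [← hX.coe_toReal_entropicBarrier hx1, EReal.coe_le_coe_iff, inner_zero_left,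
      zero_sub] at h
  have h4 : ∑ t ∈ Finset.Icc 1 T, f t v ≤ ∑ t ∈ Finset.Icc 1 T, f t u + L * Metric.diam X := by
    calc ∑ t ∈ Finset.Icc 1 T, f t v
        ≤ ∑ t ∈ Finset.Icc 1 T, (f t u + (T : ℝ)⁻¹ * (L * Metric.diam X)) :=
          Finset.sum_le_sum fun t ht =>
            hX.loss_contraction_le (hf t ht) hL hu (interior_subset hc) hε hε1
      _ = _ := by
        rw [Finset.sum_add_distrib, Finset.sum_const, Nat.card_Icc, nsmul_eq_mul,
          Nat.add_sub_cancel, mul_inv_cancel_left₀ hT0.ne']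
  have h5 := hround T le_rfl
  have h6 : ((entropicBarrier X v).toReal - (entropicBarrier X (x 1)).toReal) / η
      ≤ d * Real.log T / η := by
    gcongr
    linarith
  rw [sub_div] at h6
  have e1 : realObjective X η f (T + 1) v
      = (entropicBarrier X v).toReal / η + ∑ t ∈ Finset.Icc 1 T, f t v := rfl
  have e2 : realObjective X η f 1 (x 1) = (entropicBarrier X (x 1)).toReal / η := by
    simp [realObjective]
  rw [e1] at h1
  rw [e2] at h5
  rw [altRegret]
  linarith

end IsConvexBody

/-! ### The learning rate -/

theorem rpow_rate_mul {P S N p q r s : ℝ} (hP : 0 < P) (hS : 0 < S) (hN : 0 < N)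
    (hpq : p + q = 1) (hrs : r + s = 0) :
    (P ^ p * S ^ r * N ^ r) * (P ^ q * S ^ s * N ^ s) = P := by
  calc (P ^ p * S ^ r * N ^ r) * (P ^ q * S ^ s * N ^ s)
      = (P ^ p * P ^ q) * (S ^ r * S ^ s) * (N ^ r * N ^ s) := by ring
    _ = P := by
      rw [← Real.rpow_add hP, ← Real.rpow_add hS, ← Real.rpow_add hN, hpq, hrs]
      simp

theorem rpow_rate_pow {P S N p r e p' r' : ℝ} (hP : 0 < P) (hS : 0 < S) (hN : 0 < N)
    (hp : p * e = p') (hr : r * e + 1 = r') :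
    N * S * (P ^ p * S ^ r * N ^ r) ^ e = P ^ p' * S ^ r' * N ^ r' := by
  rw [Real.mul_rpow (by positivity) (by positivity), Real.mul_rpow (by positivity) (by positivity),
    ← Real.rpow_mul hP.le, ← Real.rpow_mul hS.le, ← Real.rpow_mul hN.le, hp, ← hr,
    Real.rpow_add hS, Real.rpow_add hN, Real.rpow_one, Real.rpow_one]
  ring

section Rates

variable {d T : ℕ} {L β C D : ℝ}

theorem tunedRate_pos (hd : 1 ≤ d) (hT : 2 ≤ T) (hL : 0 < L) (hβ : 0 ≤ β) (hC : 0 ≤ C)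
    (hD : 0 < D) : 0 < tunedRate d T L β C D := by
  have hT0 : (0 : ℝ) < T := by exact_mod_cast (by omega : 0 < T)
  have hlog : 0 < Real.log T := Real.log_pos (by exact_mod_cast hT)
  have hd0 : (0 : ℝ) < d := by exact_mod_cast hd
  have hQ : 0 < L ^ 3 * D ^ 3 + β * L ^ 2 * D ^ 2 := by positivity
  simp only [tunedRate]
  split_ifs with h
  · positivity
  · have : 0 < C := lt_of_le_of_ne hC (Ne.symm h)
    exact lt_min (by positivity) (by positivity)

/-- The learning rate balances the two contributions to the regret. -/
theorem regret_le_regretRate (hd : 1 ≤ d) (hT : 2 ≤ T) (hL : 0 < L) (hβ : 0 ≤ β) (hC : 0 ≤ C)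
    (hD : 0 < D) {k : ℝ} (hk : 0 < k) {η : ℝ} (hη : η = tunedRate d T L β C D) :
    2 * (d * Real.log T / η) + 2 * (L * D)
      + T * (36 * (k * η * D * L + 3 * C * √η * D * L) * (η * D ^ 2 * L ^ 2))
      ≤ (36 * k + 116) * regretRate d T L β C D := by
  have hT0 : (0 : ℝ) < T := by exact_mod_cast (by omega : 0 < T)
  have hT1 : (1 : ℝ) ≤ T := by exact_mod_cast (by omega : 1 ≤ T)
  have hlog : 1 / 2 ≤ Real.log T := by
    have h1 := Real.log_le_log two_pos (by exact_mod_cast hT : (2 : ℝ) ≤ T)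
    have := Real.log_two_gt_d9
    linarith
  have hd1 : (1 : ℝ) ≤ d := by exact_mod_cast hd
  have hη0 : 0 < η := hη ▸ tunedRate_pos hd hT hL hβ hC hD
  set P : ℝ := d * Real.log T with hPdef
  have hPh : 1 / 2 ≤ P := by nlinarith
  have hP : 0 < P := by linarith
  set Q := L ^ 3 * D ^ 3 + β * L ^ 2 * D ^ 2 with hQdef
  have hQ3 : (L * D) ^ 3 ≤ Q := by
    have : 0 ≤ β * L ^ 2 * D ^ 2 := by positivity
    rw [mul_pow, hQdef]
    linarith
  have hQ : 0 < Q := lt_of_lt_of_le (by positivity) hQ3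
  set R₁ := P ^ (3 / 5 : ℝ) * (C * L ^ 3 * D ^ 3) ^ (2 / 5 : ℝ) * (T : ℝ) ^ (2 / 5 : ℝ) with hR₁
  set R₂ := P ^ (2 / 3 : ℝ) * Q ^ (1 / 3 : ℝ) * (T : ℝ) ^ (1 / 3 : ℝ) with hR₂
  set a := P ^ (2 / 5 : ℝ) * (C * L ^ 3 * D ^ 3) ^ (-(2 / 5) : ℝ) * (T : ℝ) ^ (-(2 / 5) : ℝ)
    with ha
  set b := P ^ (1 / 3 : ℝ) * Q ^ (-(1 / 3) : ℝ) * (T : ℝ) ^ (-(1 / 3) : ℝ) with hb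
  have hb0 : 0 < b := by positivity
  have hR₁0 : 0 ≤ R₁ := by positivity
  have hR₂0 : 0 < R₂ := by positivity
  have hrate : regretRate d T L β C D = max R₁ R₂ := rfl
  have hηb : η ≤ b := by
    rw [hη, tunedRate]
    split_ifs
    · exact le_rfl
    · exact min_le_right _ _
  have hb1 : R₂ * b = P := rpow_rate_mul hP hQ hT0 (by norm_num) (by norm_num)
  have hb2 : T * Q * b ^ (2 : ℝ) = R₂ := rpow_rate_pow hP hQ hT0 (by norm_num) (by norm_num)
  have ha1 : 0 < C → R₁ * a = P := fun hC0 =>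
    rpow_rate_mul hP (by positivity) hT0 (by norm_num) (by norm_num)
  have ha2 : 0 < C → T * (C * L ^ 3 * D ^ 3) * a ^ (3 / 2 : ℝ) = R₁ := fun hC0 =>
    rpow_rate_pow hP (by positivity) hT0 (by norm_num) (by norm_num)
  have i1 : P / η ≤ max R₁ R₂ := by
    rw [div_le_iff₀ hη0]
    rcases hC.eq_or_lt with hC0 | hC0
    · have e : η = b := by
        rw [hη, tunedRate]
        rw [if_pos hC0.symm]
      rw [e, ← hb1]
      gcongr
      exact le_max_right _ _
    · have e : η = min a b := by
        rw [hη, tunedRate]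
        rw [if_neg hC0.ne']
      rcases min_choice a b with h | h
      · rw [e, h, ← ha1 hC0]
        have ha0 : 0 < a := by positivity
        gcongr
        exact le_max_left _ _
      · rw [e, h, ← hb1]
        gcongr
        exact le_max_right _ _
  have i2 : T * ((L * D) ^ 3 * η ^ 2) ≤ R₂ := by
    rw [← hb2, Real.rpow_two, mul_assoc]
    gcongr
  have i3 : T * (C * (L * D) ^ 3 * (√η * η)) ≤ R₁ := by
    rcases hC.eq_or_lt with hC0 | hC0
    · rw [← hC0]
      simpa using hR₁0
    · have hηa : η ≤ a := by
        rw [hη, tunedRate]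
        rw [if_neg hC0.ne']
        exact min_le_left _ _
      have e : √η * η = η ^ (3 / 2 : ℝ) := by
        rw [rpow_three_halves_eq hη0.le, pow_succ, Real.sq_sqrt hη0.le, mul_comm]
      calc T * (C * (L * D) ^ 3 * (√η * η)) = T * (C * L ^ 3 * D ^ 3) * η ^ (3 / 2 : ℝ) := by
            rw [← e]
            ring
        _ ≤ T * (C * L ^ 3 * D ^ 3) * a ^ (3 / 2 : ℝ) := by gcongr
        _ = R₁ := ha2 hC0
  have i4 : L * D ≤ 2 * R₂ := by
    have j1 : L * D ≤ Q ^ (1 / 3 : ℝ) := by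
      have h1 : ((L * D) ^ 3) ^ (1 / 3 : ℝ) ≤ Q ^ (1 / 3 : ℝ) := by gcongr
      rwa [← Real.rpow_natCast, ← Real.rpow_mul (by positivity), Nat.cast_ofNat,
        mul_one_div_cancel (by norm_num), Real.rpow_one] at h1
    have j2 : 1 ≤ (T : ℝ) ^ (1 / 3 : ℝ) := Real.one_le_rpow hT1 (by norm_num)
    have j3 : 1 / 2 ≤ P ^ (2 / 3 : ℝ) := by
      calc (1 / 2 : ℝ) = (1 / 2) ^ (1 : ℝ) := by norm_num
        _ ≤ (1 / 2) ^ (2 / 3 : ℝ) :=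
          Real.rpow_le_rpow_of_exponent_ge (by norm_num) (by norm_num) (by norm_num)
        _ ≤ P ^ (2 / 3 : ℝ) := by gcongr
    calc L * D = 2 * (1 / 2 * (L * D) * 1) := by ring
      _ ≤ 2 * (P ^ (2 / 3 : ℝ) * Q ^ (1 / 3 : ℝ) * (T : ℝ) ^ (1 / 3 : ℝ)) := by gcongr
  have m1 := le_max_left R₁ R₂
  have m2 := le_max_right R₁ R₂
  have e : T * (36 * (k * η * D * L + 3 * C * √η * D * L) * (η * D ^ 2 * L ^ 2))
      = 36 * k * (T * ((L * D) ^ 3 * η ^ 2)) + 108 * (T * (C * (L * D) ^ 3 * (√η * η))) := by ring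
  rw [e, hrate]
  have i5 : 36 * k * (T * ((L * D) ^ 3 * η ^ 2)) ≤ 36 * k * max R₁ R₂ := by
    gcongr
    exact i2.trans m2
  linarith

end Rates

/-! ### Alternating regret with the entropic barrier -/

theorem mainTheorem5 :
    -- the entropic barrier is an admissible regularizer with `σ = 1/D²` and `M = D³`
    (∀ (d : ℕ) (X : Set (Euc d)) (D : ℝ), 1 ≤ d →
      IsCompact X → Convex ℝ X → (interior X).Nonempty → Metric.diam X = D →
        IsAdmissibleRegularizer X (1 / D ^ 2) (D ^ 3) (entropicBarrier X)) ∧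
    -- the regret bound, with an absolute constant `K`
    (∃ K : ℝ, 0 < K ∧
      ∀ (d T : ℕ) (X : Set (Euc d)) (D L β C : ℝ) (f : ℕ → Euc d → ℝ), 1 ≤ d → 2 ≤ T →
        IsCompact X → Convex ℝ X → (interior X).Nonempty → Metric.diam X = D →
        0 < L → 0 ≤ β → 0 ≤ C →
        (∀ t ∈ Finset.Icc 1 T, IsAdmissibleLoss X L β C (f t)) →
          -- every round has exactly one FTRL decision
          (∀ t ∈ Finset.Icc 1 (T + 1),
            ∃! z, IsFTRLPlay X (entropicBarrier X) (tunedRate d T L β C D) f t z) ∧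
          -- and the alternating regret of these decisions is bounded
          (∀ x : ℕ → Euc d,
            (∀ t ∈ Finset.Icc 1 (T + 1),
              IsFTRLPlay X (entropicBarrier X) (tunedRate d T L β C D) f t (x t)) →
            ∀ u ∈ X, altRegret f x T u ≤ K * regretRate d T L β C D)) := by
  have hκ := thirdMomentConst_pos
  refine ⟨fun d X D hd hc hconv hne hD => ?_, 36 * (thirdMomentConst / 2) + 116, by positivity,
    fun d T X D L β C f hd hT hc hconv hne hD hL hβ hC hf => ?_⟩
  · have hX : IsConvexBody X := ⟨hc, hconv, hne⟩
    rw [← hD]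
    exact hX.isAdmissibleRegularizer_entropicBarrier (hX.diam_pos hd)
  · have hX : IsConvexBody X := ⟨hc, hconv, hne⟩
    have hD0 := hX.diam_pos hd
    subst hD
    have hη := tunedRate_pos hd hT hL hβ hC hD0
    refine ⟨fun t ht => ?_, fun x hx u hu => ?_⟩
    · have hmem : ∀ τ ∈ Finset.Ico 1 t, τ ∈ Finset.Icc 1 T := fun τ hτ => by
        rw [Finset.mem_Ico] at hτ
        rw [Finset.mem_Icc] at ht ⊢
        omega
      exact hX.existsUnique_isFTRLPlay hD0 hη
        (fun τ hτ => (hf τ (hmem τ hτ)).lipschitz.1.continuousOn)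
        (fun τ hτ => (hf τ (hmem τ hτ)).convex)
    · exact (hX.altRegret_le hD0 hη hL hC (by omega) hf hx hu).trans
        (regret_le_regretRate hd hT hL hβ hC hD0 (by positivity) rfl)
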